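/- **Corollary 5.11 (reduction from LWE to $k$-sparse CLWE).** *Notation.* For $s>0$ let $\rho_s(x)=\exp(-\pi (x/s)^2)$; $D_s$ is the Gaussian on $\mathbb R$ with density $\rho_s(x)/s$, and $D_{\mathbb Z,s}$ is the distribution on $\mathbb Z$ with mass $\rho_s(x)/\sum_{y\in\mathbb Z}\rho_s(y)$ at $x$. $\mathbb Z_q=\{0,\dots,q-1\}$, $\mathbb T=[0,1)=\mathbb R/\mathbb Z$, $U(\cdot)$ is the uniform distribution, and $\mathcal S_{n,k}$ is the set of vectors in $\{-1,0,1\}^n$ with exactly $k$ non-zero entries. * $\mathsf{LWE}(n,\mathbb Z_q^\ell,\mathbb Z_q^\ell,D_{\mathbb Z,\sigma})$: draw one secret $\mathbf s\sim U(\mathbb Z_q^\ell)$ and, independently, $\mathbf a_1,\dots,\mathbf a_n\sim U(\mathbb Z_q^\ell)$, $e_1,\dots,e_n\sim D_{\mathbb Z,\sigma}$; output $(\mathbf a_i,\langle\mathbf s,\mathbf a_i\rangle+e_i \bmod q)$ for $i=1,\dots,n$. * $\mathsf{CLWE}(m,D_1^n,\frac1{\sqrt k}\mathcal S_{n,k},\gamma,\beta)$: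 draw one secret $\mathbf s\sim U(\frac1{\sqrt k}\mathcal S_{n,k})$ and, independently, $\mathbf a_1,\dots,\mathbf a_m\sim D_1^n$, $e_1,\dots,e_m\sim D_\beta$; output $(\mathbf a_i,\gamma\langle\mathbf a_i,\mathbf s\rangle+e_i \bmod 1)$ for $i=1,\dots,m$. A *distinguisher* is a randomized non-uniform straight-line program on real data. Each instruction costs one unit of time and is one of: load a real constant, read an input coordinate, read an internal random number (these are independent and uniform on $[0,1)$), $+$, $-$, $\times$, $/$, or select one of two earlier values according to a comparison of two earlier values. Its running time is its number of instructions. Its advantage between two distributions is the absolute difference of its probabilities of outputting $1$. We say there is no $T$-time distinguisher with advantage $\epsilon$ if every distinguisher of running time at most $T$ has advantage less than $\epsilon$. A function $\nu(\lambda)$ is negligible if $\lambda^c\nu(\lambda)\to0$ for every $c\in\mathbb N$, and $w=\omega(\log\lambda)$ means $w(\lambda)/\log\lambda\to+\infty$. *Statement.* There are a universal constant $C>0$ and a universal polynomial $P$ in five variables with coefficients in $\mathbb N$ such that the following holds. Let $q,\ell,n,m,k\in\mathbb N$ and $\sigma\in\mathbb R_{>0}$ be functions of the security parameter $\lambda\in\mathbb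 N$, with $q,m\ge1$ and $1<k<n$, and let $w_1,w_2,w_3$ be real functions of $\lambda$ that are $\omega(\log\lambda)$. Suppose that $\log(q)/2^\ell$ is negligible and that for all $\lambda$ $$\sigma\ \ge\ 2\sqrt{\ln n+\ln m+w_1},\qquad k\log_2(n/k)\ \ge\ (\ell+1)\log_2(q)+w_2 .$$ Put $$\gamma=\sqrt k\cdot\sqrt{\ln m+\ln n+w_3},\qquad \beta=C\cdot\frac{\sigma\sqrt k}{q}.$$ Then there is a negligible function $\nu$ such that for all $\lambda$, all $T\in\mathbb N$ and all $\epsilon>0$: if there is no distinguisher running in time $$T+P\big(n,\ m,\ \lceil\log_2 q\rceil,\ \lceil\log_2\lceil\sigma\rceil\rceil,\ \lceil\log_2\lambda\rceil\big)$$ (with $\lceil\log_2 0\rceil$ read as $0$; likewise, at the finitely many $\lambda$ where a radicand above may be negative, its square root is read as $0$) with advantage $\epsilon$ between $\mathsf{LWE}(n,\mathbb Z_q^\ell,\mathbb Z_q^\ell,D_{\mathbb Z,\sigma})$ and $U(\mathbb Z_q^{\ell\times n}\times\mathbb Z_q^n)$, then there is no $T$-time distinguisher with advantage $2\epsilon m+\nu(\lambda)$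 between $\mathsf{CLWE}(m,D_1^n,\frac1{\sqrt k}\mathcal S_{n,k},\gamma,\beta)$ and $D_1^{n\times m}\times U(\mathbb T^m)$. -/

import Mathlib

noncomputable section

namespace SparseCLWE

open MeasureTheory

/-! ### Asymptotics in the security parameter -/

/-- `f = negl(λ)`: `f` decays faster than every inverse polynomial in `λ`. -/
def Negligible (f : ℕ → ℝ) : Prop :=
  Asymptotics.SuperpolynomialDecay Filter.atTop (fun lam : ℕ => (lam : ℝ)) f

/-- `w = ω(log λ)`: the ratio `w(λ) / log λ` tends to `+∞`. -/
def IsOmegaLog (w : ℕ → ℝ) : Prop :=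
  Filter.Tendsto (fun lam : ℕ => w lam / Real.log lam) Filter.atTop Filter.atTop

/-! ### Data sets and elementary distributions -/

/-- The data of `m` samples `(aᵢ, bᵢ)` with `aᵢ ∈ ℝⁿ` and `bᵢ ∈ ℝ`. Elements of `ℤ_q` and of
`𝕋_q = ℝ/qℤ` are represented by reals in `[0, q)`. -/
abbrev Samples (m n : ℕ) : Type := (Fin m → Fin n → ℝ) × (Fin m → ℝ)

/-- The representative in `[0, q)` of the real number `x` modulo `q`. -/
def modQ (q : ℕ) (x : ℝ) : ℝ := q * Int.fract (x / q)

/-- The uniform distribution on `ℤ_q = {0, …, q - 1}`, as a distribution on `ℤ`. -/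
def uniformZq (q : ℕ) : Measure ℤ :=
  ProbabilityTheory.uniformOn (Set.Ico (0 : ℤ) q)

/-- The uniform distribution on `ℤ_q = {0, …, q - 1}`, as a distribution on `ℝ`. -/
def uniformZqReal (q : ℕ) : Measure ℝ := (uniformZq q).map (fun z : ℤ => (z : ℝ))

/-- The uniform distribution on `𝕋 = [0, 1)`. -/
def uniformTorus : Measure ℝ := volume.restrict (Set.Ico (0 : ℝ) 1)

/-- The Gaussian function `ρ_s(x) = exp(-π (x/s)²)`. -/
def rho (s x : ℝ) : ℝ := Real.exp (-Real.pi * (x / s) ^ 2)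

/-- The continuous Gaussian `D_s` of width `s` on `ℝ`, with density `ρ_s(x)/s`, that is, with
mean `0` and variance `s²/(2π)`. -/
def gaussian (s : ℝ) : Measure ℝ :=
  ProbabilityTheory.gaussianReal 0 (Real.toNNReal (s ^ 2 / (2 * Real.pi)))

/-- The discrete Gaussian `D_{ℤ,s}`: the integer `x` has mass `ρ_s(x) / ∑_{y ∈ ℤ} ρ_s(y)`. -/
def discreteGaussian (s : ℝ) : Measure ℤ :=
  Measure.sum fun x : ℤ =>
    ENNReal.ofReal (rho s x / ∑' y : ℤ, rho s y) • Measure.dirac x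

/-- The discrete Gaussian `D_{ℤ,s}` as a distribution on `ℝ`. -/
def discreteGaussianReal (s : ℝ) : Measure ℝ :=
  (discreteGaussian s).map (fun z : ℤ => (z : ℝ))

/-- The set `𝒮_{n,k}` of vectors in `{-1, 0, 1}ⁿ` with exactly `k` non-zero entries. -/
def sparseVectors (n k : ℕ) : Set (Fin n → ℤ) :=
  {s | (∀ i, s i = -1 ∨ s i = 0 ∨ s i = 1) ∧ (Finset.univ.filter fun i => s i ≠ 0).card = k}

/-- The uniform distribution on `(1/√k) 𝒮_{n,k}`. -/
def scaledSparseSecret (n k : ℕ) : Measure (Fin n → ℝ) :=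
  (ProbabilityTheory.uniformOn (sparseVectors n k)).map fun s i => (s i : ℝ) / Real.sqrt k

/-! ### LWE and CLWE -/

/-- `LWE(m, 𝒜, 𝒮, ℰ)` with modulus `q`: sample `s ~ 𝒮` once, and `a₁, …, a_m ~ 𝒜` and
`e₁, …, e_m ~ ℰ` independently, and output `(aᵢ, ⟨s, aᵢ⟩ + eᵢ mod q)` for all `i`. -/
def LWE (q m : ℕ) {n : ℕ} (A : Measure (Fin n → ℝ)) (S : Measure (Fin n → ℤ)) (E : Measure ℝ) :
    Measure (Samples m n) :=
  (S.prod ((Measure.pi fun _ : Fin m => A).prod (Measure.pi fun _ : Fin m => E))).map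
    fun p => (p.2.1, fun i => modQ q (∑ j, (p.1 j : ℝ) * p.2.1 i j + p.2.2 i))

/-- `CLWE(m, 𝒜, 𝒮, γ, β)`: sample `s ~ 𝒮` once, and `a₁, …, a_m ~ 𝒜` and `e₁, …, e_m ~ D_β`
independently, and output `(aᵢ, γ ⟨aᵢ, s⟩ + eᵢ mod 1)` for all `i`. -/
def CLWE (m : ℕ) {n : ℕ} (A : Measure (Fin n → ℝ)) (S : Measure (Fin n → ℝ)) (γ β : ℝ) :
    Measure (Samples m n) :=
  (S.prod ((Measure.pi fun _ : Fin m => A).prod (Measure.pi fun _ : Fin m => gaussian β))).map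
    fun p => (p.2.1, fun i => modQ 1 (γ * (∑ j, p.2.1 i j * p.1 j) + p.2.2 i))

/-- Standard LWE with `m` samples in dimension `n`: `LWE(m, ℤ_qⁿ, ℤ_qⁿ, D_{ℤ,σ})`. -/
def standardLWE (q m n : ℕ) (σ : ℝ) : Measure (Samples m n) :=
  LWE q m (Measure.pi fun _ : Fin n => uniformZqReal q) (Measure.pi fun _ : Fin n => uniformZq q)
    (discreteGaussianReal σ)

/-- The uniform distribution on `ℤ_q^{n × m} × ℤ_q^m`. -/
def uniformSamples (q m n : ℕ) : Measure (Samples m n) :=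
  (Measure.pi fun _ : Fin m => Measure.pi fun _ : Fin n => uniformZqReal q).prod
    (Measure.pi fun _ : Fin m => uniformZqReal q)

/-- CLWE with sparse secrets: `CLWE(m, D₁ⁿ, (1/√k) 𝒮_{n,k}, γ, β)`. -/
def sparseCLWE (m n k : ℕ) (γ β : ℝ) : Measure (Samples m n) :=
  CLWE m (Measure.pi fun _ : Fin n => gaussian 1) (scaledSparseSecret n k) γ β

/-- The distribution `D₁^{n × m} × U(𝕋^m)`. -/
def nullCLWE (m n : ℕ) : Measure (Samples m n) :=
  (Measure.pi fun _ : Fin m => Measure.pi fun _ : Fin n => gaussian 1).prod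
    (Measure.pi fun _ : Fin m => uniformTorus)

/-! ### Randomized algorithms on real data, with a step count

The machine is the real-number straight-line machine: each instruction is one time step and
appends one real number to the list of values computed so far. Programs may contain real
constants, so that an algorithm may depend on all parameters of the problem (non-uniform
algorithms). Reading an input number or a random number takes a step. There is no rounding
instruction. -/

/-- The instructions of a program that receives `m` samples in dimension `n` and `c` internal
random numbers. Natural-number operands are positions in the list of earlier values. -/
inductive Instr (m n c : ℕ) : Type
  /-- a real constant -/
  | const (r : ℝ)
  /-- read the `j`-th coordinate of `aᵢ` -/
  | readA (i : Fin m) (j : Fin n)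
  /-- read `bᵢ` -/
  | readB (i : Fin m)
  /-- read the `i`-th internal random number -/
  | coin (i : Fin c)
  | add (i j : ℕ)
  | sub (i j : ℕ)
  | mul (i j : ℕ)
  /-- division, with the convention `x / 0 = 0` -/
  | div (i j : ℕ)
  /-- if value `i` is at most value `j`, then value `k`, else value `l` -/
  | branch (i j k l : ℕ)

/-- The value computed by an instruction on data `x`, internal random numbers `ω`, and earlier
values `v` (a position outside the list reads as `0`). -/
def Instr.eval {m n c : ℕ} (x : Samples m n) (ω : Fin c → ℝ) (v : List ℝ) : Instr m n c → ℝ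
  | .const r => r
  | .readA i j => x.1 i j
  | .readB i => x.2 i
  | .coin i => ω i
  | .add i j => v.getD i 0 + v.getD j 0
  | .sub i j => v.getD i 0 - v.getD j 0
  | .mul i j => v.getD i 0 * v.getD j 0
  | .div i j => v.getD i 0 / v.getD j 0
  | .branch i j k l => if v.getD i 0 ≤ v.getD j 0 then v.getD k 0 else v.getD l 0

/-- A randomized algorithm on `m` samples in dimension `n`: the number of its internal random
numbers (independent and uniform on `[0, 1)`) and its program. -/
structure Distinguisher (m n : ℕ) : Type where
  coins : ℕ
  code : List (Instr m n coins)

namespace Distinguisher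

variable {m n : ℕ}

/-- The running time: the number of instructions, each of which is executed once. -/
def time (D : Distinguisher m n) : ℕ := D.code.length

/-- The list of all values computed by the program. -/
def run (D : Distinguisher m n) (x : Samples m n) (ω : Fin D.coins → ℝ) : List ℝ :=
  D.code.foldl (fun v I => v ++ [I.eval x ω v]) []

/-- The output: the value of the last instruction (`0` for the empty program). -/
def output (D : Distinguisher m n) (x : Samples m n) (ω : Fin D.coins → ℝ) : ℝ :=
  (D.run x ω).getLastD 0

/-- The probability that the output is `1` on data drawn from `μ`, over the data and the internal
randomness. -/
def acceptProb (D : Distinguisher m n) (μ : Measure (Samples m n)) : ℝ :=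
  (μ.prod (Measure.pi fun _ : Fin D.coins => uniformTorus)).real {p | D.output p.1 p.2 = 1}

/-- The advantage in distinguishing `μ` from `ν`. -/
def advantage (D : Distinguisher m n) (μ ν : Measure (Samples m n)) : ℝ :=
  |D.acceptProb μ - D.acceptProb ν|

end Distinguisher

/-- There is a distinguisher between `μ` and `ν` with running time at most `T` and advantage at
least `ε`. -/
def Distinguishable {m n : ℕ} (T : ℕ) (ε : ℝ) (μ ν : Measure (Samples m n)) : Prop :=
  ∃ D : Distinguisher m n, D.time ≤ T ∧ ε ≤ D.advantage μ ν

/-- The value of the polynomial `P` at `(n, m, log q, log σ, log λ)`, with logarithms to base `2`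
rounded up to natural numbers. -/
def overhead (P : MvPolynomial (Fin 5) ℕ) (n m q : ℕ) (σ : ℝ) (lam : ℕ) : ℕ :=
  MvPolynomial.eval ![n, m, Nat.clog 2 q, Nat.clog 2 ⌈σ⌉₊, Nat.clog 2 lam] P

end SparseCLWE

end

/-! Torus core (`near_secretExp`). Dividing by q and adding continuous Gaussian noise turns vectors
over ℤ_q into vectors on the torus, so consider m rows (u, ⟨x, u⟩ + noise mod 1) with a common
sparse x and u uniform on the torus. Replace the ℤ_q-vector behind each u by s_j C + e_j, where C
consists of n vectors in ℤ_q^(l+1) shared by all rows and s_j is fresh for each row. A hybrid over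
the rows bounds the cost by mε. Up to noise the label is now ⟨s_j, Cx⟩/q, so x enters the signal
only through Cx. By the leftover hash lemma Cx may be replaced by a uniform v independent of C. All
but a log(q)/2^l fraction of the v are carried to the first unit vector by an invertible matrix, and
the induced change of variables preserves the laws of C and of the s_j, so the label may be taken to
be the first coordinate of s_j plus noise. Reveal that coordinate together with the first
coordinates of the vectors of C: what remains is LWE in dimension l. A second hybrid, again costing
mε, makes the vectors uniform, and the revealed uniform coordinate makes the label uniform. Hence
the loss 2mε and the l + 1 in the entropy condition.

Noise. Let f be the continuous noise on the vector, of the same width as the LWE error e. The label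
receives the extra noise -2⟨x, f⟩ + g. In an LWE row this turns ⟨x, e + f⟩ into ⟨x, e - f⟩ + g, and
e + f, e - f are nearly independent by rotation invariance of Gaussians, so the label noise
decouples from the vector. In units of σ²/q² the squared width is 5k for g, 2k + 5k = 7k for LWE
rows and 4k + 5k = 9k for uniform rows; the last gives the factor 3 in β.

Closeness. Every Gaussian approximation is a domination μ ≤ cν of probability measures, where c is a
power of a theta series supplied by Poisson summation. Constants multiply over products, and for
tests with values in [0,1] the error is c - 1 (`Dom.near`).

Gaussian vectors. If a has law D_1 and r = γ/√k, then ra modulo 1 is nearly uniform, and integer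
shifts of ra do not change a label ⟨x, ra⟩ mod 1. So torus rows are lifted to Gaussian rows by
sampling from the coset ℤ + u. This is done with a random shift Y whose law does not depend on u:
its distribution function is the normalized mass of the coset up to y, which is monotone because
Gaussians are log-concave.

Program. Secrets, noises and shifts are fixed as real constants, the bound is proved for every
choice of them (`lweClose_of_not_distinguishable`), and only then is it averaged. The program merely
does arithmetic on the LWE samples; fractional parts are obtained by repeated subtraction of powers
of two. -/

noncomputable section

namespace SparseCLWE

open MeasureTheory

open scoped ENNReal

/-! ### Gaussian densities and theta series -/

/-- The density `exp (-π x² / V) / √V` of the Gaussian of squared width `V`. -/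
def gaussDensity (V x : ℝ) : ℝ := Real.exp (-Real.pi * x ^ 2 / V) / Real.sqrt V

/-- The theta series `∑ exp (-π V z²)` over the integers. -/
def theta (V : ℝ) : ℝ := ∑' z : ℤ, Real.exp (-Real.pi * V * (z : ℝ) ^ 2)

/-- The Gaussian of squared width `V`. -/
def gaussV (V : ℝ) : Measure ℝ :=
  ProbabilityTheory.gaussianReal 0 (Real.toNNReal (V / (2 * Real.pi)))

instance (V : ℝ) : IsProbabilityMeasure (gaussV V) := by unfold gaussV; infer_instance

lemma gaussian_eq_gaussV (s : ℝ) : gaussian s = gaussV (s ^ 2) := rfl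

lemma gaussDensity_nonneg (V x : ℝ) : 0 ≤ gaussDensity V x := by unfold gaussDensity; positivity

@[fun_prop]
lemma measurable_gaussDensity (V : ℝ) : Measurable (gaussDensity V) := by
  unfold gaussDensity; fun_prop

lemma gaussV_eq_withDensity {V : ℝ} (hV : 0 < V) :
    gaussV V = volume.withDensity fun x => ENNReal.ofReal (gaussDensity V x) := by
  have hpi := Real.pi_pos
  have h0 : Real.toNNReal (V / (2 * Real.pi)) ≠ 0 := by
    simp only [ne_eq, Real.toNNReal_eq_zero, not_le]; positivity
  unfold gaussV
  rw [ProbabilityTheory.gaussianReal_of_var_ne_zero _ h0]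
  congr 1
  ext x
  simp only [ProbabilityTheory.gaussianPDF, ProbabilityTheory.gaussianPDFReal, gaussDensity]
  rw [Real.coe_toNNReal _ (by positivity)]
  congr 1
  rw [show 2 * Real.pi * (V / (2 * Real.pi)) = V by field_simp, div_eq_mul_inv, mul_comm]
  congr 2
  rw [sub_zero]
  field_simp

lemma lintegral_gaussV {V : ℝ} (hV : 0 < V) {F : ℝ → ℝ≥0∞} (hF : Measurable F) :
    ∫⁻ x, F x ∂gaussV V = ∫⁻ x, ENNReal.ofReal (gaussDensity V x) * F x := by
  rw [gaussV_eq_withDensity hV, lintegral_withDensity_eq_lintegral_mul _ (by fun_prop) hF]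
  rfl

lemma summable_exp_neg_mul_abs {p : ℝ} (hp : 0 < p) :
    HasSum (fun z : ℤ => Real.exp (-p) ^ z.natAbs)
      (1 + 2 * (Real.exp (-p) / (1 - Real.exp (-p)))) := by
  have h1 : Real.exp (-p) < 1 := by rw [Real.exp_lt_one_iff]; linarith
  have h0 : 0 ≤ Real.exp (-p) := (Real.exp_pos _).le
  have hg := hasSum_geometric_of_lt_one h0 h1
  have hg' : HasSum (fun n : ℕ => Real.exp (-p) ^ (n + 1))
      (Real.exp (-p) / (1 - Real.exp (-p))) := by
    have := hg.mul_left (Real.exp (-p))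
    simpa [pow_succ', div_eq_mul_inv] using this
  have := HasSum.of_nat_of_neg_add_one (f := fun z : ℤ => Real.exp (-p) ^ z.natAbs)
    (by simpa using hg) (m' := Real.exp (-p) / (1 - Real.exp (-p))) (by
      refine hg'.congr_fun fun n => ?_
      congr 1)
  convert this using 1
  have : 1 - Real.exp (-p) ≠ 0 := by linarith
  field_simp
  ring

lemma exp_neg_mul_sq_le {V : ℝ} (hV : 0 < V) (z : ℤ) :
    Real.exp (-Real.pi * V * (z : ℝ) ^ 2) ≤ Real.exp (-(Real.pi * V)) ^ z.natAbs := by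
  rw [← Real.exp_nat_mul, Real.exp_le_exp]
  have h : ((z.natAbs : ℕ) : ℝ) ≤ (z : ℝ) ^ 2 := by
    have : (z.natAbs : ℤ) ≤ z ^ 2 := by
      rw [← Int.natAbs_sq]; exact_mod_cast Nat.le_self_pow two_ne_zero _
    calc ((z.natAbs : ℕ) : ℝ) = (((z.natAbs : ℕ) : ℤ) : ℝ) := (Int.cast_natCast _).symm
      _ ≤ ((z ^ 2 : ℤ) : ℝ) := Int.cast_le.mpr this
      _ = _ := by push_cast; rfl
  have := mul_le_mul_of_nonneg_left h (mul_pos Real.pi_pos hV).le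
  nlinarith

lemma summable_theta {V : ℝ} (hV : 0 < V) :
    Summable fun z : ℤ => Real.exp (-Real.pi * V * (z : ℝ) ^ 2) :=
  Summable.of_nonneg_of_le (fun _ => (Real.exp_pos _).le) (exp_neg_mul_sq_le hV)
    (summable_exp_neg_mul_abs (mul_pos Real.pi_pos hV)).summable

lemma one_le_theta {V : ℝ} (hV : 0 < V) : 1 ≤ theta V := by
  have := (summable_theta hV).le_tsum 0 (fun _ _ => (Real.exp_pos _).le)
  simpa [theta] using this

lemma theta_anti {V W : ℝ} (hV : 0 < V) (h : V ≤ W) : theta W ≤ theta V := by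
  refine (summable_theta (hV.trans_le h)).tsum_le_tsum (fun z => ?_) (summable_theta hV)
  rw [Real.exp_le_exp]
  have := mul_le_mul_of_nonneg_right h (mul_nonneg Real.pi_pos.le (sq_nonneg (z : ℝ)))
  nlinarith

lemma theta_le {V : ℝ} (hV : 0 < V) (h : Real.exp (-(Real.pi * V)) ≤ 1 / 2) :
    theta V ≤ 1 + 4 * Real.exp (-(Real.pi * V)) := by
  have hs := summable_exp_neg_mul_abs (mul_pos Real.pi_pos hV)
  refine ((summable_theta hV).tsum_le_tsum (exp_neg_mul_sq_le hV) hs.summable).trans ?_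
  rw [hs.tsum_eq]
  have h0 := Real.exp_pos (-(Real.pi * V))
  have : Real.exp (-(Real.pi * V)) / (1 - Real.exp (-(Real.pi * V)))
      ≤ 2 * Real.exp (-(Real.pi * V)) := by
    rw [div_le_iff₀ (by linarith)]; nlinarith
  linarith

/-- From (z + 2c)² ≥ 0. This crude majorant has the same summable shape for all c in a bounded set,
so it gives both summability and locally uniform convergence in c. -/
lemma gaussDensity_add_le {V : ℝ} (hV : 0 < V) (z : ℤ) (c : ℝ) :
    gaussDensity V (z + c) ≤ Real.exp (Real.pi * c ^ 2 / V) / Real.sqrt V *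
      Real.exp (-Real.pi * (2 * V)⁻¹ * (z : ℝ) ^ 2) := by
  rw [gaussDensity, div_mul_eq_mul_div, ← Real.exp_add]
  gcongr
  have h : (z : ℝ) ^ 2 / 2 - c ^ 2 ≤ (z + c) ^ 2 := by nlinarith [sq_nonneg ((z : ℝ) + 2 * c)]
  have h2 := mul_le_mul_of_nonneg_left h (div_pos Real.pi_pos hV).le
  have e1 : -Real.pi * (↑z + c) ^ 2 / V = -(Real.pi / V * (↑z + c) ^ 2) := by ring
  have e2 : Real.pi * c ^ 2 / V + -Real.pi * (2 * V)⁻¹ * (z : ℝ) ^ 2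
      = -(Real.pi / V * ((z : ℝ) ^ 2 / 2 - c ^ 2)) := by field_simp; ring
  rw [e1, e2]; linarith

lemma summable_gaussDensity {V : ℝ} (hV : 0 < V) (c : ℝ) :
    Summable fun z : ℤ => gaussDensity V (z + c) := by
  have hs := (summable_theta (V := (2 * V)⁻¹) (by positivity)).mul_left
    (Real.exp (Real.pi * c ^ 2 / V) / Real.sqrt V)
  exact Summable.of_nonneg_of_le (fun _ => gaussDensity_nonneg _ _)
    (fun z => gaussDensity_add_le hV z c) hs

/-- Poisson summation writes the left side as a Fourier series in c with the positive coefficients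
exp(-πVn²); dropping the phases bounds it by its value at c = 0. -/
lemma tsum_gaussDensity_le {V : ℝ} (hV : 0 < V) (c : ℝ) :
    ∑' z : ℤ, gaussDensity V (z + c) ≤ theta V := by
  have hre : (0 : ℝ) < ((V : ℝ) : ℂ).re := by simpa using hV
  have key := Complex.tsum_exp_neg_quadratic hre (-Complex.I * c)
  have hsq : ((V : ℂ) ^ (1 / 2 : ℂ)) = ((Real.sqrt V : ℝ) : ℂ) := by
    rw [Real.sqrt_eq_rpow, Complex.ofReal_cpow hV.le]; norm_num
  have hr : ∀ n : ℤ, Complex.exp (-Real.pi / (V : ℂ) *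
      ((n : ℂ) + Complex.I * (-Complex.I * c)) ^ 2)
      = ((Real.exp (-Real.pi * (n + c) ^ 2 / V) : ℝ) : ℂ) := by
    intro n
    rw [Complex.ofReal_exp]
    congr 1
    push_cast
    have : Complex.I * (-Complex.I * c) = c := by
      rw [← mul_assoc, mul_neg, Complex.I_mul_I]; simp
    rw [this]; ring
  simp_rw [hr] at key
  rw [hsq, ← Complex.ofReal_tsum, ← Complex.ofReal_one, ← Complex.ofReal_div,
    ← Complex.ofReal_mul] at key
  have hl : ∑' z : ℤ, gaussDensity V (z + c)
      = 1 / Real.sqrt V * ∑' n : ℤ, Real.exp (-Real.pi * (n + c) ^ 2 / V) := by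
    rw [← tsum_mul_left]; congr 1; ext n; rw [gaussDensity]; ring
  rw [hl]
  have hn : ∀ n : ℤ, ‖Complex.exp (-Real.pi * (V : ℂ) * (n : ℂ) ^ 2 +
      2 * Real.pi * (-Complex.I * c) * n)‖ = Real.exp (-Real.pi * V * (n : ℝ) ^ 2) := by
    intro n
    rw [Complex.norm_exp]
    congr 1
    have : (-Real.pi * (V : ℂ) * (n : ℂ) ^ 2 + 2 * Real.pi * (-Complex.I * c) * n)
      = ((-Real.pi * V * (n : ℝ) ^ 2 : ℝ) : ℂ) + ((-(2 * Real.pi * c * n) : ℝ) : ℂ) * Complex.I := by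
      push_cast; ring
    rw [this, Complex.add_re, Complex.re_ofReal_mul, Complex.I_re, mul_zero, add_zero,
      Complex.ofReal_re]
  calc _ ≤ ‖((1 / Real.sqrt V * ∑' n : ℤ, Real.exp (-Real.pi * (n + c) ^ 2 / V) : ℝ) : ℂ)‖ := by
        rw [Complex.norm_real]; exact le_abs_self _
    _ ≤ _ := by
        rw [← key]
        refine (norm_tsum_le_tsum_norm ?_).trans ?_
        · simp_rw [hn]; exact summable_theta hV
        · simp_rw [hn]; exact le_rfl

lemma tsum_ofReal_gaussDensity_le {V : ℝ} (hV : 0 < V) (c : ℝ) :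
    ∑' z : ℤ, ENNReal.ofReal (gaussDensity V (z + c)) ≤ ENNReal.ofReal (theta V) := by
  rw [← ENNReal.ofReal_tsum_of_nonneg (fun _ => gaussDensity_nonneg _ _)
    (summable_gaussDensity hV c)]
  exact ENNReal.ofReal_le_ofReal (tsum_gaussDensity_le hV c)

/-- The product of a Gaussian in `f` and a Gaussian in `h - χ f`, with the square completed. -/
lemma gaussDensity_mul {A B : ℝ} (hA : 0 < A) (hB : 0 < B) (χ f h : ℝ) :
    gaussDensity A f * gaussDensity B (h - χ * f) =
      gaussDensity (χ ^ 2 * A + B) h *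
        gaussDensity (A * B / (χ ^ 2 * A + B)) (f - χ * A * h / (χ ^ 2 * A + B)) := by
  have hT : 0 < χ ^ 2 * A + B := by positivity
  unfold gaussDensity
  rw [div_mul_div_comm, div_mul_div_comm, ← Real.exp_add, ← Real.exp_add,
    ← Real.sqrt_mul hA.le, ← Real.sqrt_mul hT.le]
  -- The marginal of `h = χ f + e` has squared width `χ² A + B`; given `h`, the variable `f` is
  -- Gaussian of squared width `AB / (χ² A + B)` about its regression on `h`.
  congr 1
  · congr 1; field_simp; ring
  · congr 1; field_simp

lemma tsum_gaussDensity_mul_le {A B : ℝ} (hA : 0 < A) (hB : 0 < B) (χ φ h : ℝ) :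
    ∑' z : ℤ, ENNReal.ofReal (gaussDensity A (z + φ)) *
      ENNReal.ofReal (gaussDensity B (h - χ * (z + φ))) ≤
    ENNReal.ofReal (theta (A * B / (χ ^ 2 * A + B))) *
      ENNReal.ofReal (gaussDensity (χ ^ 2 * A + B) h) := by
  have hT : 0 < χ ^ 2 * A + B := by positivity
  have : ∀ z : ℤ, ENNReal.ofReal (gaussDensity A (z + φ)) *
      ENNReal.ofReal (gaussDensity B (h - χ * (z + φ))) =
      ENNReal.ofReal (gaussDensity (χ ^ 2 * A + B) h) *
        ENNReal.ofReal (gaussDensity (A * B / (χ ^ 2 * A + B))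
          (z + (φ - χ * A * h / (χ ^ 2 * A + B)))) := by
    intro z
    rw [← ENNReal.ofReal_mul (gaussDensity_nonneg _ _), gaussDensity_mul hA hB,
      ENNReal.ofReal_mul (gaussDensity_nonneg _ _), add_sub_assoc]
  simp_rw [this]
  rw [ENNReal.tsum_mul_left, mul_comm]
  gcongr
  exact tsum_ofReal_gaussDensity_le (by positivity) _

/-- Rotation by 45 degrees: with `f = g - z`, the sum is `g` and the difference is `2z - g`. The
factor 2 is the Jacobian of passing from `z` to `2z - g`. -/
lemma gaussDensity_add_sub {A : ℝ} (hA : 0 < A) (z g : ℝ) :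
    gaussDensity A z * gaussDensity A (g - z) =
      gaussDensity (2 * A) g * (2 * gaussDensity (2 * A) (2 * z - g)) := by
  unfold gaussDensity
  rw [div_mul_div_comm, ← mul_div_assoc, div_mul_div_comm, Real.mul_self_sqrt hA.le,
    Real.mul_self_sqrt (by positivity : 0 ≤ 2 * A), ← Real.exp_add, mul_left_comm, ← Real.exp_add,
    mul_div_mul_left _ _ two_ne_zero]
  congr 2
  field_simp
  ring

lemma gaussDensity_two_mul (V x c : ℝ) :
    2 * gaussDensity V (2 * x - c) = gaussDensity (V / 4) (x - c / 2) := by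
  unfold gaussDensity
  have h : Real.sqrt (V / 4) = Real.sqrt V / 2 := by
    rw [Real.sqrt_div' _ (by norm_num), show (4 : ℝ) = 2 ^ 2 by norm_num,
      Real.sqrt_sq (by norm_num)]
  rw [h, div_div_eq_mul_div, mul_comm 2, ← div_mul_eq_mul_div, mul_div_right_comm]
  congr 3
  rw [div_div_eq_mul_div]; ring

/-- The joint density of `z + f` and `χ (z - f) + e` for a lattice Gaussian `z` and continuous
Gaussians `f` and `e`. -/
lemma tsum_gaussDensity_rotate_le {A B : ℝ} (hA : 0 < A) (hB : 0 < B) (χ g h : ℝ) :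
    ∑' z : ℤ, ENNReal.ofReal (gaussDensity A z) * (ENNReal.ofReal (gaussDensity A (g - z)) *
      ENNReal.ofReal (gaussDensity B (h - χ * (2 * z - g)))) ≤
    ENNReal.ofReal (theta (A * B / (2 * (χ ^ 2 * (2 * A) + B)))) *
      (ENNReal.ofReal (gaussDensity (2 * A) g) *
        ENNReal.ofReal (gaussDensity (χ ^ 2 * (2 * A) + B) h)) := by
  have h2A : 0 < 2 * A := by positivity
  set T := χ ^ 2 * (2 * A) + B with hTdef
  have hT : 0 < T := by positivity
  have : ∀ z : ℤ, ENNReal.ofReal (gaussDensity A z) * (ENNReal.ofReal (gaussDensity A (g - z)) *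
      ENNReal.ofReal (gaussDensity B (h - χ * (2 * z - g)))) =
      (ENNReal.ofReal (gaussDensity (2 * A) g) * ENNReal.ofReal (gaussDensity T h)) *
        ENNReal.ofReal (gaussDensity (A * B / (2 * T))
          (z + (-((g + χ * (2 * A) * h / T) / 2)))) := by
    intro z
    rw [← mul_assoc, ← ENNReal.ofReal_mul (gaussDensity_nonneg _ _), gaussDensity_add_sub hA,
      ← ENNReal.ofReal_mul (mul_nonneg (gaussDensity_nonneg _ _)
        (mul_nonneg zero_le_two (gaussDensity_nonneg _ _))),
      ← ENNReal.ofReal_mul (gaussDensity_nonneg _ _),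
      ← ENNReal.ofReal_mul (mul_nonneg (gaussDensity_nonneg _ _) (gaussDensity_nonneg _ _))]
    congr 1
    have e := gaussDensity_mul h2A hB χ (2 * z - g) h
    rw [← hTdef] at e
    calc _ = gaussDensity (2 * A) g * (2 * (gaussDensity (2 * A) (2 * z - g) *
          gaussDensity B (h - χ * (2 * z - g)))) := by ring
      _ = gaussDensity (2 * A) g * gaussDensity T h *
          (2 * gaussDensity (2 * A * B / T) (2 * z - (g + χ * (2 * A) * h / T))) := by
        rw [e, sub_sub]; ring
      _ = _ := by
        rw [gaussDensity_two_mul, ← sub_eq_add_neg]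
        congr 2
        field_simp
        ring
  simp_rw [this]
  rw [ENNReal.tsum_mul_left, mul_comm]
  gcongr
  exact tsum_ofReal_gaussDensity_le (by positivity) _

/-! ### The discrete Gaussian -/

lemma rho_eq_gaussDensity {s : ℝ} (hs : 0 < s) (x : ℝ) :
    rho s x = s * gaussDensity (s ^ 2) x := by
  unfold rho gaussDensity
  rw [Real.sqrt_sq hs.le, div_pow, mul_div_assoc, mul_div_cancel₀ _ hs.ne']

lemma summable_rho {s : ℝ} (hs : 0 < s) : Summable fun z : ℤ => rho s z := by
  simp_rw [rho_eq_gaussDensity hs]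
  simpa using (summable_gaussDensity (pow_pos hs 2) 0).mul_left s

/-- Poisson summation turns the sum into s · `theta (s²)`, and a theta series is at least its term
at 0. -/
lemma le_tsum_rho {s : ℝ} (hs : 0 < s) : s ≤ ∑' z : ℤ, rho s z := by
  have h := Real.tsum_exp_neg_mul_int_sq (a := s ^ 2) (by positivity)
  have e : ∀ z : ℤ, rho s z = Real.exp (-Real.pi / s ^ 2 * (z : ℝ) ^ 2) := by
    intro z; unfold rho; congr 1; rw [div_pow]; ring
  have h1 := one_le_theta (pow_pos hs 2)
  rw [theta, h, ← Real.sqrt_eq_rpow, Real.sqrt_sq hs.le] at h1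
  simp_rw [e]
  rw [one_div, inv_mul_eq_div, le_div_iff₀ hs, one_mul] at h1
  exact h1

lemma lintegral_discreteGaussian (s : ℝ) (F : ℤ → ℝ≥0∞) :
    ∫⁻ z, F z ∂discreteGaussian s =
      ∑' z : ℤ, ENNReal.ofReal (rho s z / ∑' y : ℤ, rho s y) * F z := by
  unfold discreteGaussian
  rw [lintegral_sum_measure]
  simp

lemma isProbabilityMeasure_discreteGaussian {s : ℝ} (hs : 0 < s) :
    IsProbabilityMeasure (discreteGaussian s) := by
  constructor
  have h := lintegral_discreteGaussian s (fun _ => 1)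
  rw [lintegral_const, one_mul] at h
  rw [h]
  simp only [mul_one]
  have hpos := hs.trans_le (le_tsum_rho hs)
  rw [← ENNReal.ofReal_tsum_of_nonneg
    (fun z => div_nonneg (by unfold rho; positivity) hpos.le) ((summable_rho hs).div_const _),
    tsum_div_const, div_self hpos.ne', ENNReal.ofReal_one]

/-- The normalizing sum is at least s, so the masses are bounded by the continuous density at the
integers. Only this side is needed, since domination is one-sided. -/
lemma discreteGaussian_weight_le {s : ℝ} (hs : 0 < s) (z : ℤ) :
    rho s z / ∑' y : ℤ, rho s y ≤ gaussDensity (s ^ 2) z := by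
  rw [rho_eq_gaussDensity hs, mul_div_right_comm]
  refine mul_le_of_le_one_left (gaussDensity_nonneg _ _) ?_
  rw [div_le_one (hs.trans_le (le_tsum_rho hs))]
  exact le_tsum_rho hs

/-! ### Domination of measures -/

/-- The measure `μ` is at most `c` times the measure `ν`, stated through lower integrals. -/
def Dom {α : Type*} [MeasurableSpace α] (c : ℝ≥0∞) (μ ν : Measure α) : Prop :=
  ∀ F : α → ℝ≥0∞, Measurable F → ∫⁻ x, F x ∂μ ≤ c * ∫⁻ x, F x ∂ν

section Dom

variable {α β : Type*} [MeasurableSpace α] [MeasurableSpace β]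

lemma Dom.prod {c d : ℝ≥0∞} {μ ν : Measure α} {μ' ν' : Measure β} [SFinite μ] [SFinite ν]
    [SFinite μ'] [SFinite ν'] (h : Dom c μ ν) (h' : Dom d μ' ν') :
    Dom (c * d) (μ.prod μ') (ν.prod ν') := by
  intro F hF
  rw [lintegral_prod _ hF.aemeasurable, lintegral_prod _ hF.aemeasurable]
  calc ∫⁻ x, ∫⁻ y, F (x, y) ∂μ' ∂μ ≤ ∫⁻ x, d * ∫⁻ y, F (x, y) ∂ν' ∂μ :=
        lintegral_mono fun x => h' _ (hF.comp measurable_prodMk_left)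
    _ ≤ c * ∫⁻ x, d * ∫⁻ y, F (x, y) ∂ν' ∂ν := h _ (hF.lintegral_prod_right'.const_mul d)
    _ = _ := by
      rw [lintegral_const_mul _ hF.lintegral_prod_right', mul_assoc]

lemma lintegral_pi_succ {n : ℕ} (μ : Measure α) [SigmaFinite μ]
    {F : (Fin (n + 1) → α) → ℝ≥0∞} (hF : Measurable F) :
    ∫⁻ ω, F ω ∂(Measure.pi fun _ => μ) =
      ∫⁻ a, ∫⁻ ω, F (Fin.cons a ω) ∂(Measure.pi fun _ : Fin n => μ) ∂μ := by
  have h := (measurePreserving_piFinSuccAbove (fun _ : Fin (n + 1) => μ) 0).symm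
  rw [← h.lintegral_comp hF, lintegral_prod]
  · refine lintegral_congr fun a => lintegral_congr fun ω => ?_
    congr 1
    exact Fin.insertNth_zero' _ _
  · exact (hF.comp (MeasurableEquiv.measurable _)).aemeasurable

lemma measurable_finCons {n : ℕ} :
    Measurable fun p : α × (Fin n → α) => (Fin.cons p.1 p.2 : Fin (n + 1) → α) := by
  refine measurable_pi_lambda _ fun i => ?_
  refine Fin.cases ?_ (fun j => ?_) i
  · simpa using measurable_fst
  · simp only [Fin.cons_succ]
    fun_prop

/-- The constants multiply, so n coordinates cost a power of the constant for one coordinate. -/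
lemma Dom.pi {c : ℝ≥0∞} {μ ν : Measure α} [SigmaFinite μ] [SigmaFinite ν] (h : Dom c μ ν) (n : ℕ) :
    Dom (c ^ n) (Measure.pi fun _ : Fin n => μ) (Measure.pi fun _ : Fin n => ν) := by
  induction n with
  | zero =>
    intro F hF
    rw [Measure.pi_of_empty, Measure.pi_of_empty, pow_zero, one_mul]
  | succ n ih =>
    intro F hF
    rw [lintegral_pi_succ _ hF, lintegral_pi_succ _ hF]
    have hm : Measurable fun p : α × (Fin n → α) => F (Fin.cons p.1 p.2) :=
      hF.comp measurable_finCons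
    have := h.prod ih _ hm
    rw [lintegral_prod _ hm.aemeasurable, lintegral_prod _ hm.aemeasurable] at this
    rwa [pow_succ']

/-- A product of copies of `P`, together with a Gaussian noise that absorbs one term for each
copy, is dominated by a product of copies of `Q` and an independent Gaussian, if this holds for
one copy. -/
lemma lintegral_pi_absorb_le {P : Measure α} [SigmaFinite P] {Q : Measure β} [SigmaFinite Q]
    {a : α → β} {b : α → ℝ} (ha : Measurable a) (hb : Measurable b) {K : ℝ≥0∞} {X : Set ℝ}
    {V₀ W : ℝ} (hW : 0 ≤ W)
    (h : ∀ V, V₀ ≤ V → ∀ χ ∈ X, ∀ F : β × ℝ → ℝ≥0∞, Measurable F →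
      ∫⁻ ω, ∫⁻ e, F (a ω, χ * b ω + e) ∂gaussV V ∂P ≤
        K * ∫⁻ g, ∫⁻ e, F (g, e) ∂gaussV (χ ^ 2 * W + V) ∂Q)
    {n : ℕ} (χ : Fin n → ℝ) (hχ : ∀ i, χ i ∈ X) {V : ℝ} (hV : V₀ ≤ V)
    {F : (Fin n → β) × ℝ → ℝ≥0∞} (hF : Measurable F) :
    ∫⁻ ω, ∫⁻ e, F (fun i => a (ω i), ∑ i, χ i * b (ω i) + e) ∂gaussV V ∂(Measure.pi fun _ => P) ≤
      K ^ n * ∫⁻ g, ∫⁻ e, F (g, e) ∂gaussV ((∑ i, χ i ^ 2) * W + V)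
        ∂(Measure.pi fun _ => Q) := by
  induction n with
  | zero =>
    rw [Measure.pi_of_empty, Measure.pi_of_empty]
    simp only [lintegral_dirac, Finset.univ_eq_empty, Finset.sum_empty, zero_add, zero_mul,
      pow_zero, one_mul]
    exact le_of_eq (lintegral_congr fun e => by
      congr 2; exact Subsingleton.elim _ _)
  | succ n ih =>
    -- The tail is absorbed first, which only enlarges the noise seen by coordinate 0; the threshold
    -- `V₀` therefore survives the induction.
    have hV' : V₀ ≤ (∑ i : Fin n, χ i.succ ^ 2) * W + V := by
      have : 0 ≤ (∑ i : Fin n, χ i.succ ^ 2) * W := by positivity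
      linarith
    have hc : Measurable fun p : (α × (Fin n → β)) × ℝ =>
        F (Fin.cons (a p.1.1) p.1.2, χ 0 * b p.1.1 + p.2) := by
      refine hF.comp (Measurable.prodMk ?_ (by fun_prop))
      exact measurable_finCons.comp ((ha.comp (by fun_prop)).prodMk (by fun_prop))
    have hd : Measurable fun p : ((Fin n → β) × β) × ℝ => F (Fin.cons p.1.2 p.1.1, p.2) := by
      refine hF.comp (Measurable.prodMk ?_ (by fun_prop))
      exact measurable_finCons.comp ((by fun_prop : Measurable fun p : ((Fin n → β) × β) × ℝ =>
        p.1.2).prodMk (by fun_prop))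
    rw [lintegral_pi_succ, lintegral_pi_succ]
    · calc _ ≤ ∫⁻ ω₀, K ^ n * ∫⁻ g, ∫⁻ e, F (Fin.cons (a ω₀) g, χ 0 * b ω₀ + e)
            ∂gaussV ((∑ i : Fin n, χ i.succ ^ 2) * W + V) ∂(Measure.pi fun _ => Q) ∂P := by
            refine lintegral_mono fun ω₀ => ?_
            have := ih (fun i => χ i.succ) (fun i => hχ _)
              (F := fun p => F (Fin.cons (a ω₀) p.1, χ 0 * b ω₀ + p.2)) (by
                refine hF.comp (Measurable.prodMk ?_ (by fun_prop))
                exact measurable_finCons.comp (measurable_const.prodMk measurable_fst))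
            refine le_trans (le_of_eq ?_) this
            refine lintegral_congr fun ω => lintegral_congr fun e => ?_
            congr 1
            ext i
            · refine Fin.cases ?_ (fun j => ?_) i <;> simp
            · simp [Fin.sum_univ_succ, add_assoc]
        _ = K ^ n * ∫⁻ g, ∫⁻ ω₀, ∫⁻ e, F (Fin.cons (a ω₀) g, χ 0 * b ω₀ + e)
            ∂gaussV ((∑ i : Fin n, χ i.succ ^ 2) * W + V) ∂P ∂(Measure.pi fun _ => Q) := by
            rw [lintegral_const_mul, lintegral_lintegral_swap]
            · exact hc.lintegral_prod_right'.aemeasurable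
            · exact hc.lintegral_prod_right'.lintegral_prod_right'
        _ ≤ K ^ n * ∫⁻ g, K * ∫⁻ g₀, ∫⁻ e, F (Fin.cons g₀ g, e)
            ∂gaussV (χ 0 ^ 2 * W + ((∑ i : Fin n, χ i.succ ^ 2) * W + V)) ∂Q
            ∂(Measure.pi fun _ => Q) := by
            gcongr with g
            exact h _ hV' _ (hχ 0) (fun p => F (Fin.cons p.1 g, p.2)) (by
              refine hF.comp (Measurable.prodMk ?_ measurable_snd)
              exact measurable_finCons.comp (measurable_fst.prodMk measurable_const))
        _ = _ := by
            rw [lintegral_const_mul, ← mul_assoc, ← pow_succ, lintegral_lintegral_swap]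
            · simp_rw [Fin.sum_univ_succ, add_mul, add_assoc]
            · exact hd.lintegral_prod_right'.aemeasurable
            · exact hd.lintegral_prod_right'.lintegral_prod_right'
    · exact hF.lintegral_prod_right'
    · refine Measurable.lintegral_prod_right' (f := fun p : (Fin (n + 1) → α) × ℝ =>
        F (fun i => a (p.1 i), ∑ i, χ i * b (p.1 i) + p.2)) ?_
      exact hF.comp (by fun_prop)

end Dom

/-! ### Uniform distributions on finite types -/

/-- The uniform distribution on a finite type. -/
def unif (α : Type*) [Fintype α] [MeasurableSpace α] : Measure α :=
  (Fintype.card α : ℝ≥0∞)⁻¹ • Measure.count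

section Unif

variable {α β : Type*} [Fintype α] [MeasurableSpace α] [MeasurableSingletonClass α]
  [Fintype β] [MeasurableSpace β] [MeasurableSingletonClass β]

lemma lintegral_unif (F : α → ℝ≥0∞) :
    ∫⁻ a, F a ∂unif α = (Fintype.card α : ℝ≥0∞)⁻¹ * ∑ a, F a := by
  rw [unif, lintegral_smul_measure, lintegral_count, tsum_fintype, smul_eq_mul]

instance [Nonempty α] : IsProbabilityMeasure (unif α) := by
  constructor
  have h := lintegral_unif (α := α) (fun _ => 1)
  rw [lintegral_const, one_mul] at h
  rw [h, Finset.sum_const, Finset.card_univ, nsmul_eq_mul, mul_one]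
  exact ENNReal.inv_mul_cancel (by simp) (by simp)

lemma lintegral_unif_equiv (e : α ≃ β) (F : β → ℝ≥0∞) :
    ∫⁻ a, F (e a) ∂unif α = ∫⁻ b, F b ∂unif β := by
  rw [lintegral_unif, lintegral_unif, Fintype.card_congr e, e.sum_comp]

lemma unif_prod : (unif α).prod (unif β) = unif (α × β) := by
  refine Measure.ext_of_lintegral _ fun F hF => ?_
  rw [lintegral_prod _ hF.aemeasurable, lintegral_unif, lintegral_unif, Fintype.sum_prod_type,
    Fintype.card_prod]
  simp_rw [lintegral_unif]
  rw [← Finset.mul_sum, ← mul_assoc, Nat.cast_mul, ENNReal.mul_inv (by simp) (by simp)]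

lemma unif_pi (n : ℕ) [Nonempty α] : Measure.pi (fun _ : Fin n => unif α) = unif (Fin n → α) := by
  refine Measure.ext_of_singleton fun f => ?_
  rw [Measure.pi_singleton, unif, unif]
  simp [ENNReal.inv_pow]

end Unif

/-- The representative in `{0, …, q - 1}` of a residue class, as a real number. -/
def zval {q : ℕ} (y : ZMod q) : ℝ := (y.val : ℝ)

@[fun_prop]
lemma measurable_zval {q : ℕ} : Measurable (zval : ZMod q → ℝ) := fun _ _ => trivial

/-- Real numbers that are congruent modulo `q` have the same fractional part after division
by `q`. -/
lemma fract_div_congr {q : ℕ} [NeZero q] {a b : ℤ} (h : (a : ZMod q) = b) (x : ℝ) :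
    Int.fract (((a : ℝ) + x) / q) = Int.fract (((b : ℝ) + x) / q) := by
  have hq : (q : ℝ) ≠ 0 := Nat.cast_ne_zero.mpr (NeZero.ne q)
  obtain ⟨k, hk⟩ := (ZMod.intCast_eq_intCast_iff_dvd_sub a b q).mp h
  have : (b : ℝ) = a + q * k := by
    have : (b : ℝ) - a = q * k := by exact_mod_cast hk
    linarith
  rw [this, show ((a : ℝ) + q * k + x) / q = (a + x) / q + k by field_simp; ring,
    Int.fract_add_intCast]

lemma zval_eq {q : ℕ} (y : ZMod q) : zval y = ((y.val : ℤ) : ℝ) := by simp [zval]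

lemma fract_zval_congr {q : ℕ} [NeZero q] {y : ZMod q} {b : ℤ} (h : y = b) (x : ℝ) :
    Int.fract ((zval y + x) / q) = Int.fract (((b : ℝ) + x) / q) := by
  rw [zval_eq]
  exact fract_div_congr (by simpa using h) x

/-! ### Periodization -/

instance : IsProbabilityMeasure uniformTorus := ⟨by simp [uniformTorus]⟩

lemma lintegral_eq_lintegral_tsum {F : ℝ → ℝ≥0∞} (hF : Measurable F) :
    ∫⁻ x, F x = ∫⁻ φ, ∑' z : ℤ, F (z + φ) ∂uniformTorus := by
  rw [lintegral_tsum (fun z => by fun_prop), ← setLIntegral_univ,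
    ← iUnion_Ico_intCast ℝ, lintegral_iUnion (fun _ => measurableSet_Ico)
      (Set.pairwise_disjoint_Ico_intCast ℝ)]
  congr 1
  ext z
  have h := (measurePreserving_add_left (volume : Measure ℝ) (z : ℝ)).setLIntegral_comp_preimage
    (measurableSet_Ico (a := (z : ℝ)) (b := z + 1)) hF
  rw [← h, uniformTorus]
  congr 2
  ext x
  simp

/-- For `y` uniform in {0, …, q-1} and `φ` uniform in [0,1), the sum `y + φ` is uniform in [0,q):
the unit intervals tile [0,q), and dividing by q rescales it to [0,1). -/
lemma lintegral_uniformTorus_eq_unif {q : ℕ} [NeZero q] {G : ℝ → ℝ≥0∞} (hG : Measurable G) :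
    ∫⁻ φ, ∫⁻ y : ZMod q, G ((zval y + φ) / q) ∂unif _ ∂uniformTorus = ∫⁻ p, G p ∂uniformTorus := by
  have hq : (0 : ℝ) < q := Nat.cast_pos.mpr (NeZero.pos q)
  have h1 : ∀ k : ℕ, ∑ y ∈ Finset.range k, ∫⁻ φ, G ((y + φ) / q) ∂uniformTorus =
      ∫⁻ x in Set.Ico (0 : ℝ) k, G (x / q) := by
    intro k
    induction k with
    | zero => simp
    | succ k ih =>
      rw [Finset.sum_range_succ, ih]
      have hu : Set.Ico (0 : ℝ) ((k + 1 : ℕ) : ℝ) = Set.Ico (0 : ℝ) k ∪ Set.Ico (k : ℝ) (k + 1) := by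
        rw [Set.Ico_union_Ico_eq_Ico (by positivity) (by linarith)]; push_cast; rfl
      rw [hu, lintegral_union measurableSet_Ico (Set.Ico_disjoint_Ico_same)]
      congr 1
      have h := (measurePreserving_add_left (volume : Measure ℝ) (k : ℝ)).setLIntegral_comp_preimage
        (measurableSet_Ico (a := (k : ℝ)) (b := k + 1)) (f := fun x => G (x / q))
        (hG.comp (by fun_prop))
      rw [← h, uniformTorus]
      congr 2
      ext x
      simp
  have h2 : ∑ y : ZMod q, ∫⁻ φ, G ((zval y + φ) / q) ∂uniformTorus =
      ∑ y ∈ Finset.range q, ∫⁻ φ, G ((y + φ) / q) ∂uniformTorus := by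
    obtain ⟨k, rfl⟩ := Nat.exists_eq_succ_of_ne_zero (NeZero.ne q)
    exact Fin.sum_univ_eq_sum_range (fun y : ℕ => ∫⁻ φ, G (((y : ℝ) + φ) / (k + 1 : ℕ))
      ∂uniformTorus) (k + 1)
  simp_rw [lintegral_unif]
  rw [lintegral_const_mul _ (by fun_prop), lintegral_finsetSum _ (fun y _ => by fun_prop), h2, h1]
  have h3 : ∫⁻ p in Set.Ico (0 : ℝ) 1, G p =
      ∫⁻ p in Set.Ico (0 : ℝ) 1, G p ∂((ENNReal.ofReal |(q : ℝ)⁻¹|) •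
        Measure.map (fun x : ℝ => (q : ℝ)⁻¹ * x) volume) := by
    rw [Real.smul_map_volume_mul_left (inv_ne_zero hq.ne')]
  rw [uniformTorus, h3, Measure.restrict_smul, lintegral_smul_measure,
    setLIntegral_map measurableSet_Ico hG (by fun_prop), ZMod.card, smul_eq_mul]
  congr 1
  · rw [abs_of_pos (by positivity), ENNReal.ofReal_inv_of_pos hq, ENNReal.ofReal_natCast]
  · have : (fun x : ℝ => (q : ℝ)⁻¹ * x) ⁻¹' Set.Ico 0 1 = Set.Ico (0 : ℝ) q := by
      ext x
      simp only [Set.mem_preimage, Set.mem_Ico, inv_mul_lt_iff₀ hq, mul_one]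
      simp [hq]
    rw [this]
    simp_rw [div_eq_inv_mul]

/-- A nonnegative weight whose sums over the shifts of `ℤ` are at most `B` becomes at most `B`
times the uniform distribution, once a uniform element of `{0, …, q - 1}` is added and the sum is
taken modulo `q`. -/
lemma lintegral_unif_fract_le {q : ℕ} [NeZero q] {w G : ℝ → ℝ≥0∞} (hw : Measurable w)
    (hG : Measurable G) {B : ℝ≥0∞} (hB : ∀ φ, ∑' z : ℤ, w (z + φ) ≤ B) :
    ∫⁻ f, w f * ∫⁻ y : ZMod q, G (Int.fract ((zval y + f) / q)) ∂unif _ ≤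
      B * ∫⁻ p, G p ∂uniformTorus := by
  have hm : ∀ y : ZMod q, Measurable fun f : ℝ => G (Int.fract ((zval y + f) / q)) :=
    fun y => hG.comp (by fun_prop)
  have hm2 : Measurable fun f : ℝ => ∫⁻ y : ZMod q, G (Int.fract ((zval y + f) / q)) ∂unif _ := by
    simp_rw [lintegral_unif]
    exact (Finset.measurable_sum _ fun y _ => hm y).const_mul _
  -- An integer shift of `f` permutes ℤ_q, so the average over `y` depends only on `f` modulo 1 and
  -- the weight may be summed over ℤ first.
  have hper : ∀ (z : ℤ) (φ : ℝ),
      ∫⁻ y : ZMod q, G (Int.fract ((zval y + (z + φ)) / q)) ∂unif _ =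
        ∫⁻ y : ZMod q, G (Int.fract ((zval y + φ) / q)) ∂unif _ := by
    intro z φ
    rw [← lintegral_unif_equiv (Equiv.addRight (z : ZMod q))
      (fun y => G (Int.fract ((zval y + φ) / q)))]
    refine lintegral_congr fun y => ?_
    rw [Equiv.coe_addRight, fract_zval_congr (b := (y.val : ℤ) + z) (by simp) φ, zval_eq]
    push_cast
    rw [add_assoc]
  rw [lintegral_eq_lintegral_tsum (by fun_prop)]
  simp_rw [hper, ENNReal.tsum_mul_right]
  calc _ ≤ ∫⁻ φ, B * ∫⁻ y : ZMod q, G (Int.fract ((zval y + φ) / q)) ∂unif _ ∂uniformTorus := by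
        gcongr with φ
        exact hB φ
    _ = _ := by
      rw [lintegral_const_mul _ hm2,
        lintegral_uniformTorus_eq_unif (G := fun p => G (Int.fract p)) (hG.comp (by fun_prop))]
      congr 1
      refine setLIntegral_congr_fun measurableSet_Ico fun p hp => ?_
      rw [Int.fract_eq_self.mpr hp]

/-! ### Domination for one coordinate -/

lemma lintegral_gaussV_const_add {V : ℝ} (hV : 0 < V) {F : ℝ → ℝ≥0∞} (hF : Measurable F) (c : ℝ) :
    ∫⁻ e, F (c + e) ∂gaussV V = ∫⁻ h, ENNReal.ofReal (gaussDensity V (h - c)) * F h := by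
  rw [lintegral_gaussV hV (by fun_prop), ← lintegral_sub_right_eq_self _ c]
  simp

/-- The torus coordinate sees `f` only modulo 1. Summing the joint density of `f` and `h = χ f + e`
over the integer shifts of `f` leaves the marginal density of `h` times at most a theta value, so
the two outputs decouple. -/
lemma lintegral_unif_gaussV_le {q : ℕ} [NeZero q] {A B : ℝ} (hA : 0 < A) (hB : 0 < B) (χ : ℝ)
    {F : ℝ × ℝ → ℝ≥0∞} (hF : Measurable F) :
    ∫⁻ p, ∫⁻ e, F (Int.fract ((zval p.1 + p.2) / q), χ * p.2 + e) ∂gaussV B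
        ∂((unif (ZMod q)).prod (gaussV A)) ≤
      ENNReal.ofReal (theta (A * B / (χ ^ 2 * A + B))) *
        ∫⁻ u, ∫⁻ h, F (u, h) ∂gaussV (χ ^ 2 * A + B) ∂uniformTorus := by
  have hT : 0 < χ ^ 2 * A + B := by positivity
  have hm : Measurable fun p : ((ZMod q × ℝ) × ℝ) =>
      F (Int.fract ((zval p.1.1 + p.1.2) / q), χ * p.1.2 + p.2) := hF.comp (by fun_prop)
  have hy : Measurable fun p : ℝ × ℝ =>
      ∫⁻ y : ZMod q, F (Int.fract ((zval y + p.1) / q), p.2) ∂unif _ :=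
    Measurable.lintegral_prod_right' (f := fun p : (ℝ × ℝ) × ZMod q =>
      F (Int.fract ((zval p.2 + p.1.1) / q), p.1.2)) (by fun_prop)
  have hi : ∀ f : ℝ, ∫⁻ y : ZMod q, ∫⁻ e, F (Int.fract ((zval y + f) / q), χ * f + e) ∂gaussV B
      ∂unif _ = ∫⁻ h, ENNReal.ofReal (gaussDensity B (h - χ * f)) *
          ∫⁻ y : ZMod q, F (Int.fract ((zval y + f) / q), h) ∂unif _ := by
    intro f
    have h1 : ∀ y : ZMod q, ∫⁻ e, F (Int.fract ((zval y + f) / q), χ * f + e) ∂gaussV B =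
        ∫⁻ h, ENNReal.ofReal (gaussDensity B (h - χ * f)) *
          F (Int.fract ((zval y + f) / q), h) := fun y =>
      lintegral_gaussV_const_add hB (F := fun e => F (Int.fract ((zval y + f) / q), e))
        (by fun_prop) _
    simp_rw [h1]
    rw [lintegral_lintegral_swap (Measurable.aemeasurable (by fun_prop))]
    refine lintegral_congr fun h => ?_
    rw [lintegral_const_mul _ (by fun_prop)]
  calc _ = ∫⁻ f, ∫⁻ h, (ENNReal.ofReal (gaussDensity A f) *
        ENNReal.ofReal (gaussDensity B (h - χ * f))) *
          ∫⁻ y : ZMod q, F (Int.fract ((zval y + f) / q), h) ∂unif _ := by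
        rw [lintegral_prod_symm _ hm.lintegral_prod_right'.aemeasurable,
          lintegral_gaussV hA (Measurable.lintegral_prod_left' hm.lintegral_prod_right')]
        simp_rw [hi, mul_assoc]
        refine lintegral_congr fun f => ?_
        rw [lintegral_const_mul _ (by fun_prop)]
    _ = ∫⁻ h, ∫⁻ f, (ENNReal.ofReal (gaussDensity A f) *
        ENNReal.ofReal (gaussDensity B (h - χ * f))) *
          ∫⁻ y : ZMod q, F (Int.fract ((zval y + f) / q), h) ∂unif _ :=
        lintegral_lintegral_swap (Measurable.aemeasurable (by fun_prop))
    _ ≤ ∫⁻ h, ENNReal.ofReal (theta (A * B / (χ ^ 2 * A + B))) *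
          ENNReal.ofReal (gaussDensity (χ ^ 2 * A + B) h) * ∫⁻ u, F (u, h) ∂uniformTorus := by
        gcongr with h
        exact lintegral_unif_fract_le (by fun_prop) (G := fun u => F (u, h))
          (by fun_prop) (fun φ => tsum_gaussDensity_mul_le hA hB χ φ h)
    _ = _ := by
        simp_rw [mul_assoc]
        have hu : Measurable fun h => ∫⁻ u, F (u, h) ∂uniformTorus := hF.lintegral_prod_left'
        rw [lintegral_const_mul _ (by fun_prop), ← lintegral_gaussV hT hu,
          lintegral_lintegral_swap]
        exact (hF.comp measurable_swap).aemeasurable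

/-- The joint law of `z + f` and `χ (z - f) + e`, for a discrete Gaussian `z` and continuous
Gaussians `f` and `e`, is dominated by a product of Gaussians. -/
lemma lintegral_discreteGaussian_gaussV_le {s B : ℝ} (hs : 0 < s) (hB : 0 < B) (χ : ℝ)
    {F : ℝ × ℝ → ℝ≥0∞} (hF : Measurable F) :
    ∫⁻ p, ∫⁻ e, F (p.1 + p.2, χ * (p.1 - p.2) + e) ∂gaussV B
        ∂((discreteGaussian s).prod (gaussV (s ^ 2))) ≤
      ENNReal.ofReal (theta (s ^ 2 * B / (2 * (χ ^ 2 * (2 * s ^ 2) + B)))) *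
        ∫⁻ g, ∫⁻ h, F (g, h) ∂gaussV (χ ^ 2 * (2 * s ^ 2) + B) ∂gaussV (2 * s ^ 2) := by
  have hA : 0 < s ^ 2 := by positivity
  have hT : 0 < χ ^ 2 * (2 * s ^ 2) + B := by positivity
  have := isProbabilityMeasure_discreteGaussian hs
  have hcast : Measurable (fun z : ℤ => (z : ℝ)) := fun _ _ => trivial
  have hm : Measurable fun p : ((ℤ × ℝ) × ℝ) =>
      F (p.1.1 + p.1.2, χ * (p.1.1 - p.1.2) + p.2) := by fun_prop
  have hz : ∀ z : ℤ, ∫⁻ f, ∫⁻ e, F (z + f, χ * (z - f) + e) ∂gaussV B ∂gaussV (s ^ 2) =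
      ∫⁻ g, ∫⁻ h, (ENNReal.ofReal (gaussDensity (s ^ 2) (g - z)) *
        ENNReal.ofReal (gaussDensity B (h - χ * (2 * z - g)))) * F (g, h) := by
    intro z
    have h1 : Measurable fun g => ∫⁻ e, F (g, χ * (2 * z - g) + e) ∂gaussV B :=
      Measurable.lintegral_prod_right' (f := fun p : ℝ × ℝ => F (p.1, χ * (2 * z - p.1) + p.2))
        (by fun_prop)
    have e1 := lintegral_gaussV_const_add hA h1 (z : ℝ)
    simp_rw [show ∀ f : ℝ, (z : ℝ) - f = 2 * z - (z + f) by intro f; ring]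
    rw [e1]
    refine lintegral_congr fun g => ?_
    rw [lintegral_gaussV_const_add hB (F := fun h => F (g, h)) (by fun_prop),
      ← lintegral_const_mul _ (by fun_prop)]
    simp_rw [mul_assoc]
  calc _ = ∑' z : ℤ, ENNReal.ofReal (rho s z / ∑' y : ℤ, rho s y) * ∫⁻ g, ∫⁻ h,
          (ENNReal.ofReal (gaussDensity (s ^ 2) (g - z)) *
            ENNReal.ofReal (gaussDensity B (h - χ * (2 * z - g)))) * F (g, h) := by
        rw [lintegral_prod _ hm.lintegral_prod_right'.aemeasurable, lintegral_discreteGaussian]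
        simp_rw [hz]
    _ ≤ ∑' z : ℤ, ENNReal.ofReal (gaussDensity (s ^ 2) z) * ∫⁻ g, ∫⁻ h,
          (ENNReal.ofReal (gaussDensity (s ^ 2) (g - z)) *
            ENNReal.ofReal (gaussDensity B (h - χ * (2 * z - g)))) * F (g, h) := by
        gcongr with z
        exact discreteGaussian_weight_le hs z
    _ = ∫⁻ g, ∫⁻ h, (∑' z : ℤ, ENNReal.ofReal (gaussDensity (s ^ 2) z) *
          (ENNReal.ofReal (gaussDensity (s ^ 2) (g - z)) *
            ENNReal.ofReal (gaussDensity B (h - χ * (2 * z - g))))) * F (g, h) := by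
        simp_rw [← ENNReal.tsum_mul_right]
        have h2 : ∀ z : ℤ, Measurable fun p : ℝ × ℝ =>
            ENNReal.ofReal (gaussDensity (s ^ 2) z) * (ENNReal.ofReal
              (gaussDensity (s ^ 2) (p.1 - z)) * ENNReal.ofReal
              (gaussDensity B (p.2 - χ * (2 * z - p.1)))) * F p := fun z => by fun_prop
        have h3 : ∀ g, ∀ z : ℤ, Measurable fun h : ℝ =>
            ENNReal.ofReal (gaussDensity (s ^ 2) z) * (ENNReal.ofReal
              (gaussDensity (s ^ 2) (g - z)) * ENNReal.ofReal
              (gaussDensity B (h - χ * (2 * z - g)))) * F (g, h) := fun g z => by fun_prop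
        rw [lintegral_congr fun g => lintegral_tsum fun z => (h3 g z).aemeasurable]
        rw [lintegral_tsum (fun z => (h2 z).lintegral_prod_right'.aemeasurable)]
        congr 1
        ext z
        rw [← lintegral_const_mul _ (Measurable.lintegral_prod_right' (f := fun p : ℝ × ℝ =>
          (ENNReal.ofReal (gaussDensity (s ^ 2) (p.1 - z)) *
            ENNReal.ofReal (gaussDensity B (p.2 - χ * (2 * z - p.1)))) * F p) (by fun_prop))]
        refine lintegral_congr fun g => ?_
        rw [← lintegral_const_mul _ (by fun_prop)]
        simp_rw [mul_assoc]
    _ ≤ ∫⁻ g, ∫⁻ h, (ENNReal.ofReal (theta (s ^ 2 * B / (2 * (χ ^ 2 * (2 * s ^ 2) + B)))) *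
          (ENNReal.ofReal (gaussDensity (2 * s ^ 2) g) *
            ENNReal.ofReal (gaussDensity (χ ^ 2 * (2 * s ^ 2) + B) h))) * F (g, h) := by
        gcongr with g h
        exact tsum_gaussDensity_rotate_le hA hB χ g h
    _ = _ := by
        have h1 : Measurable fun g => ∫⁻ h, F (g, h) ∂gaussV (χ ^ 2 * (2 * s ^ 2) + B) :=
          hF.lintegral_prod_right'
        rw [lintegral_gaussV (by positivity) h1, ← lintegral_const_mul _ (by fun_prop)]
        refine lintegral_congr fun g => ?_
        rw [lintegral_gaussV hT (by fun_prop), ← lintegral_const_mul _ (by fun_prop),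
          ← lintegral_const_mul _ (by fun_prop)]
        simp_rw [mul_assoc]

/-! ### Closeness of expectations -/

/-- `a` and `b` differ by at most `δ`. -/
def Near (δ a b : ℝ≥0∞) : Prop := a ≤ b + δ ∧ b ≤ a + δ

lemma Near.symm {δ a b : ℝ≥0∞} (h : Near δ a b) : Near δ b a := ⟨h.2, h.1⟩

lemma Near.refl (a : ℝ≥0∞) : Near 0 a a := by simp [Near]

lemma Near.trans {δ η a b c : ℝ≥0∞} (h : Near δ a b) (h' : Near η b c) : Near (δ + η) a c := by
  refine ⟨h.1.trans ?_, h'.2.trans ?_⟩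
  · calc b + δ ≤ c + η + δ := by gcongr; exact h'.1
      _ = c + (δ + η) := by ring
  · calc b + η ≤ a + δ + η := by gcongr; exact h.2
      _ = a + (δ + η) := by ring

lemma Near.mono {δ η a b : ℝ≥0∞} (h : Near δ a b) (hδ : δ ≤ η) : Near η a b :=
  ⟨h.1.trans (by gcongr), h.2.trans (by gcongr)⟩

lemma Near.lintegral {α : Type*} [MeasurableSpace α] {μ : Measure α} [IsProbabilityMeasure μ]
    {δ : ℝ≥0∞} {f g : α → ℝ≥0∞} (h : ∀ x, Near δ (f x) (g x)) :
    Near δ (∫⁻ x, f x ∂μ) (∫⁻ x, g x ∂μ) := by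
  constructor
  · calc _ ≤ ∫⁻ x, (g x + δ) ∂μ := lintegral_mono fun x => (h x).1
      _ = _ := by rw [lintegral_add_right _ measurable_const]; simp
  · calc _ ≤ ∫⁻ x, (f x + δ) ∂μ := lintegral_mono fun x => (h x).2
      _ = _ := by rw [lintegral_add_right _ measurable_const]; simp

lemma lintegral_le_one {α : Type*} [MeasurableSpace α] {μ : Measure α} [IsProbabilityMeasure μ]
    {F : α → ℝ≥0∞} (hF : ∀ x, F x ≤ 1) : ∫⁻ x, F x ∂μ ≤ 1 :=
  (lintegral_mono hF).trans (by simp)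

/-- One direction is domination together with `F ≤ 1`. The other is the same bound for `1 - F`,
because both measures have total mass 1. -/
lemma Dom.near {α : Type*} [MeasurableSpace α] {μ ν : Measure α} [IsProbabilityMeasure μ]
    [IsProbabilityMeasure ν] {c : ℝ≥0∞} (hc : 1 ≤ c) (h : Dom c μ ν) {F : α → ℝ≥0∞}
    (hF : Measurable F) (hF1 : ∀ x, F x ≤ 1) :
    Near (c - 1) (∫⁻ x, F x ∂μ) (∫⁻ x, F x ∂ν) := by
  have key : ∀ G : α → ℝ≥0∞, Measurable G → (∀ x, G x ≤ 1) →
      ∫⁻ x, G x ∂μ ≤ ∫⁻ x, G x ∂ν + (c - 1) := by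
    intro G hG hG1
    calc _ ≤ c * ∫⁻ x, G x ∂ν := h G hG
      _ = (1 + (c - 1)) * ∫⁻ x, G x ∂ν := by rw [add_tsub_cancel_of_le hc]
      _ ≤ _ := by
        rw [add_mul, one_mul]
        gcongr
        exact mul_le_of_le_one_right' (lintegral_le_one hG1)
  refine ⟨key F hF hF1, ?_⟩
  have h1 := key (fun x => 1 - F x) (by fun_prop) (fun x => tsub_le_self)
  have fin : ∀ (κ : Measure α) [IsProbabilityMeasure κ], ∫⁻ x, F x ∂κ ≠ ∞ := fun κ _ =>
    ne_top_of_le_ne_top ENNReal.one_ne_top (lintegral_le_one hF1)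
  rw [lintegral_sub hF (fin μ) (.of_forall hF1), lintegral_sub hF (fin ν) (.of_forall hF1)] at h1
  simp only [lintegral_const, measure_univ, mul_one] at h1
  have hν : ∫⁻ x, F x ∂ν ≤ 1 := lintegral_le_one hF1
  have hμ : ∫⁻ x, F x ∂μ ≤ 1 := lintegral_le_one hF1
  calc _ = ∫⁻ x, F x ∂ν + (1 - ∫⁻ x, F x ∂μ) + ∫⁻ x, F x ∂μ - 1 := by
        rw [add_assoc, tsub_add_cancel_of_le hμ, ENNReal.add_sub_cancel_right ENNReal.one_ne_top]
    _ ≤ ∫⁻ x, F x ∂ν + (1 - ∫⁻ x, F x ∂ν + (c - 1)) + ∫⁻ x, F x ∂μ - 1 := by gcongr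
    _ = (∫⁻ x, F x ∂μ + (c - 1)) + 1 - 1 := by
        rw [← add_assoc, add_tsub_cancel_of_le hν]; ring_nf
    _ = _ := ENNReal.add_sub_cancel_right ENNReal.one_ne_top

/-! ### Resampling one coordinate and the hybrid argument -/

section Hybrid

variable {α β : Type*} [MeasurableSpace α] [MeasurableSpace β]

lemma lintegral_pi_resample {m : ℕ} (μ : Measure α) [IsProbabilityMeasure μ] (i : Fin m)
    {F : (Fin m → α) → ℝ≥0∞} (hF : Measurable F) :
    ∫⁻ ω, F ω ∂(Measure.pi fun _ => μ) =
      ∫⁻ ω, ∫⁻ a, F (Function.update ω i a) ∂μ ∂(Measure.pi fun _ => μ) := by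
  obtain ⟨a₀⟩ := nonempty_of_isProbabilityMeasure μ
  have hg : Measurable fun ω : Fin m → α => ∫⁻ a, F (Function.update ω i a) ∂μ := by
    have := hF.lmarginal (fun _ : Fin m => μ) (s := {i})
    rwa [lmarginal_singleton] at this
  rw [lintegral_eq_lmarginal_univ (μ := fun _ : Fin m => μ) (fun _ => a₀),
    lintegral_eq_lmarginal_univ (μ := fun _ : Fin m => μ) (fun _ => a₀),
    lmarginal_erase' _ hF (Finset.mem_univ i), lmarginal_erase' _ hg (Finset.mem_univ i)]
  simp

lemma lintegral_pi_prod {m : ℕ} (μ : Measure α) (ν : Measure β) [SigmaFinite μ] [SigmaFinite ν]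
    {F : (Fin m → α × β) → ℝ≥0∞} (hF : Measurable F) :
    ∫⁻ ω, F ω ∂(Measure.pi fun _ => μ.prod ν) =
      ∫⁻ a, ∫⁻ b, F (fun i => (a i, b i)) ∂(Measure.pi fun _ => ν) ∂(Measure.pi fun _ => μ) := by
  have h := (measurePreserving_arrowProdEquivProdArrow α β (Fin m) (fun _ => μ) (fun _ => ν)).symm
  rw [← h.lintegral_comp hF, lintegral_prod]
  · rfl
  · exact (hF.comp (MeasurableEquiv.measurable _)).aemeasurable

/-- The hybrid argument: rows that depend on a common parameter are replaced one by one. -/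
lemma near_hybrid {Γ Ω ρ : Type*} [MeasurableSpace Γ] [MeasurableSpace Ω] [MeasurableSpace ρ]
    {G : Measure Γ} [IsProbabilityMeasure G] {P : Measure Ω} [IsProbabilityMeasure P] {m : ℕ}
    {r₀ r₁ : Γ → Ω → ρ} (h₀ : Measurable r₀.uncurry) (h₁ : Measurable r₁.uncurry)
    {F : (Fin m → ρ) → ℝ≥0∞} (hF : Measurable F) {ε : ℝ≥0∞}
    (h : ∀ (i : Fin m) (ω : Fin m → Ω),
      Near ε
        (∫⁻ γ, ∫⁻ a, F (fun j => if j < i then r₁ γ (ω j) else if j = i then r₁ γ a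
          else r₀ γ (ω j)) ∂P ∂G)
        (∫⁻ γ, ∫⁻ a, F (fun j => if j < i then r₁ γ (ω j) else if j = i then r₀ γ a
          else r₀ γ (ω j)) ∂P ∂G)) :
    Near (m * ε) (∫⁻ γ, ∫⁻ ω, F (fun j => r₁ γ (ω j)) ∂(Measure.pi fun _ => P) ∂G)
      (∫⁻ γ, ∫⁻ ω, F (fun j => r₀ γ (ω j)) ∂(Measure.pi fun _ => P) ∂G) := by
  set H : ℕ → ℝ≥0∞ := fun t => ∫⁻ γ, ∫⁻ ω, F (fun j => if (j : ℕ) < t then r₁ γ (ω j)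
    else r₀ γ (ω j)) ∂(Measure.pi fun _ => P) ∂G with hH
  have hmeas : ∀ t : ℕ, Measurable fun p : Γ × (Fin m → Ω) =>
      F (fun j => if (j : ℕ) < t then r₁ p.1 (p.2 j) else r₀ p.1 (p.2 j)) := by
    intro t
    refine hF.comp (measurable_pi_lambda _ fun j => ?_)
    have e : Measurable fun p : Γ × (Fin m → Ω) => (p.1, p.2 j) := by fun_prop
    split_ifs
    · exact h₁.comp e
    · exact h₀.comp e
  have step : ∀ t (ht : t < m), Near ε (H (t + 1)) (H t) := by
    intro t ht
    -- Resample row `t` and move its integral, with that of the common parameter, inside. All other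
    -- seeds are then fixed, which is the form of the one-row hypothesis.
    have hsw : ∀ t' : ℕ, H t' = ∫⁻ ω, ∫⁻ γ, ∫⁻ a, F (fun j => if (j : ℕ) < t' then
        r₁ γ (Function.update ω ⟨t, ht⟩ a j) else r₀ γ (Function.update ω ⟨t, ht⟩ a j)) ∂P ∂G
        ∂(Measure.pi fun _ => P) := by
      intro t'
      rw [lintegral_lintegral_swap]
      · refine lintegral_congr fun γ => ?_
        exact lintegral_pi_resample P ⟨t, ht⟩ ((hmeas t').comp measurable_prodMk_left)
      · refine Measurable.aemeasurable (Measurable.lintegral_prod_right'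
          (f := fun p : ((Fin m → Ω) × Γ) × Ω => F (fun j => if (j : ℕ) < t' then
            r₁ p.1.2 (Function.update p.1.1 ⟨t, ht⟩ p.2 j)
            else r₀ p.1.2 (Function.update p.1.1 ⟨t, ht⟩ p.2 j))) ?_)
        refine (hmeas t').comp (g := fun p : Γ × (Fin m → Ω) => F (fun j =>
          if (j : ℕ) < t' then r₁ p.1 (p.2 j) else r₀ p.1 (p.2 j)))
          (f := fun p : ((Fin m → Ω) × Γ) × Ω => (p.1.2, Function.update p.1.1 ⟨t, ht⟩ p.2)) ?_
        refine Measurable.prodMk (by fun_prop) ?_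
        exact measurable_update'.comp (by fun_prop : Measurable fun p : ((Fin m → Ω) × Γ) × Ω =>
          (p.1.1, p.2))
    rw [hsw, hsw]
    refine Near.lintegral fun ω => ?_
    convert h ⟨t, ht⟩ ω using 7 with γ a j γ a j
    · rcases lt_trichotomy j ⟨t, ht⟩ with hj | rfl | hj
      · have : (j : ℕ) < t := hj
        simp [hj, hj.ne, this.trans (Nat.lt_succ_self t)]
      · simp
      · have : t < (j : ℕ) := hj
        have h1 : ¬ (j : ℕ) < t + 1 := by omega
        simp [hj.not_gt, hj.ne', h1]
    · rcases lt_trichotomy j ⟨t, ht⟩ with hj | rfl | hj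
      · have : (j : ℕ) < t := hj
        simp [hj, hj.ne, this]
      · simp
      · have : t < (j : ℕ) := hj
        have h1 : ¬ (j : ℕ) < t := by omega
        simp [hj.not_gt, hj.ne', h1]
  have all : ∀ t ≤ m, Near (t * ε) (H t) (H 0) := by
    intro t
    induction t with
    | zero => intro _; simpa using Near.refl _
    | succ t ih =>
      intro ht
      have := (step t ht).trans (ih (by omega))
      convert this using 1
      push_cast; ring
  have := all m le_rfl
  simpa [hH] using this

end Hybrid

/-! ### Leftover hash lemma -/

/-- The leftover hash lemma for a family of functions in which all but a `p`-fraction of the pairs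
collide with probability exactly `1 / |V|`. -/
lemma leftover_hash {X M V : Type*} [Fintype M] [Fintype V] [DecidableEq V] [Nonempty M]
    [Nonempty V] (S : Finset X) (hS : S.Nonempty) (h : X → M → V) (bad : X → X → Prop)
    [∀ x x', Decidable (bad x x')] {p : ℝ}
    (hbad : ∀ x ∈ S, ((S.filter fun x' => bad x x').card : ℝ) ≤ S.card * p)
    (hgood : ∀ x ∈ S, ∀ x' ∈ S, ¬ bad x x' →
      (Finset.univ.filter fun C => h x C = h x' C).card * Fintype.card V = Fintype.card M)
    (G : M → V → ℝ) (hG0 : ∀ C v, 0 ≤ G C v) (hG1 : ∀ C v, G C v ≤ 1) :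
    |(S.card : ℝ)⁻¹ * ∑ x ∈ S, (Fintype.card M : ℝ)⁻¹ * ∑ C, G C (h x C) -
      (Fintype.card M : ℝ)⁻¹ * ∑ C, (Fintype.card V : ℝ)⁻¹ * ∑ v, G C v| ≤
      Real.sqrt (Fintype.card V * p) := by
  set N : ℝ := (S.card : ℝ)
  set a : ℝ := (Fintype.card M : ℝ)
  set b : ℝ := (Fintype.card V : ℝ)
  have hN : 0 < N := by simpa [N] using hS
  have ha : 0 < a := by simp [a, Fintype.card_pos]
  have hb : 0 < b := by simp [b, Fintype.card_pos]
  -- `P C` is the law of `h x C` for `x` uniform in `S`.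
  set P : M → V → ℝ := fun C v => N⁻¹ * ∑ x ∈ S, if h x C = v then 1 else 0 with hP
  have e1 : N⁻¹ * ∑ x ∈ S, a⁻¹ * ∑ C, G C (h x C) = a⁻¹ * ∑ C, ∑ v, P C v * G C v := by
    have : ∀ C, ∑ v, P C v * G C v = N⁻¹ * ∑ x ∈ S, G C (h x C) := by
      intro C
      simp only [hP, mul_assoc, ← Finset.mul_sum, Finset.sum_mul]
      rw [Finset.sum_comm]
      simp
    simp_rw [this, ← Finset.mul_sum]
    rw [Finset.sum_comm]
    ring
  have e2 : a⁻¹ * ∑ C, b⁻¹ * ∑ v, G C v = a⁻¹ * ∑ C, ∑ v, b⁻¹ * G C v := by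
    simp_rw [Finset.mul_sum]
  rw [e1, e2, ← mul_sub, ← Finset.sum_sub_distrib]
  simp_rw [← Finset.sum_sub_distrib, ← sub_mul]
  have hsumP : ∀ C, ∑ v, P C v = 1 := by
    intro C
    simp only [hP, ← Finset.mul_sum]
    rw [Finset.sum_comm]
    simp [N, hS.card_pos.ne']
  -- The sum over `v` of `P C v ^ 2` is the collision probability of two independent choices of `x`.
  -- Good pairs contribute `b⁻¹` on average over `C`; bad pairs, of proportion at most `p`, at most
  -- 1 each.
  have hcoll : ∑ C, ∑ v, P C v ^ 2 ≤ a * (b⁻¹ + p) := by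
    have e3 : ∀ C, ∑ v, P C v ^ 2 =
        N⁻¹ ^ 2 * ∑ x ∈ S, ∑ x' ∈ S, if h x C = h x' C then 1 else 0 := by
      intro C
      simp only [hP, mul_pow, ← Finset.mul_sum]
      congr 1
      simp_rw [pow_two, Finset.sum_mul_sum]
      rw [Finset.sum_comm]
      refine Finset.sum_congr rfl fun x _ => ?_
      rw [Finset.sum_comm]
      refine Finset.sum_congr rfl fun x' _ => ?_
      simp [eq_comm]
    simp_rw [e3, ← Finset.mul_sum]
    rw [Finset.sum_comm]
    have e4 : ∀ x ∈ S, ∑ C, ∑ x' ∈ S, (if h x C = h x' C then (1 : ℝ) else 0) ≤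
        N * (a * (b⁻¹ + p)) := by
      intro x hx
      rw [Finset.sum_comm]
      calc _ ≤ ∑ x' ∈ S, (a * b⁻¹ + if bad x x' then a else 0) := by
            refine Finset.sum_le_sum fun x' hx' => ?_
            rw [Finset.sum_boole]
            split_ifs with hbd
            · have : ((Finset.univ.filter fun C => h x C = h x' C).card : ℝ) ≤ a := by
                simpa [a] using Finset.card_le_univ _
              have : 0 ≤ a * b⁻¹ := by positivity
              linarith
            · have := hgood x hx x' hx' hbd
              rw [add_zero, ← div_eq_mul_inv, le_div_iff₀ hb]
              have h2 : (((Finset.univ.filter fun C => h x C = h x' C).card : ℕ) : ℝ) *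
                  (Fintype.card V : ℝ) = (Fintype.card M : ℝ) := by exact_mod_cast this
              exact h2.le
        _ = N * (a * b⁻¹) + (S.filter fun x' => bad x x').card * a := by
            rw [Finset.sum_add_distrib, ← Finset.sum_filter]
            simp [N]
        _ ≤ N * (a * b⁻¹) + (N * p) * a := by gcongr; exact hbad x hx
        _ = _ := by ring
    calc _ ≤ N⁻¹ ^ 2 * ∑ x ∈ S, N * (a * (b⁻¹ + p)) := by
          gcongr with x hx; exact e4 x hx
      _ = _ := by
          rw [Finset.sum_const, nsmul_eq_mul]
          change N⁻¹ ^ 2 * (N * (N * (a * (b⁻¹ + p)))) = _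
          field_simp
  refine Real.abs_le_sqrt ?_
  rw [mul_pow]
  -- Cauchy–Schwarz over all pairs `(C, v)`: the squared distance of `P` from uniform totals at most
  -- `a * p`, the squared test function at most `a * b`.
  have cs := Finset.sum_mul_sq_le_sq_mul_sq (Finset.univ : Finset (M × V))
    (fun y => P y.1 y.2 - b⁻¹) (fun y => G y.1 y.2)
  have g2 : ∑ y : M × V, G y.1 y.2 ^ 2 ≤ a * b := by
    calc _ ≤ ∑ y : M × V, (1 : ℝ) := Finset.sum_le_sum fun y _ => by
          have := hG0 y.1 y.2; have := hG1 y.1 y.2; nlinarith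
      _ = _ := by simp [a, b]
  have p2 : ∑ y : M × V, (P y.1 y.2 - b⁻¹) ^ 2 ≤ a * p := by
    have : ∀ C, ∑ v, (P C v - b⁻¹) ^ 2 = ∑ v, P C v ^ 2 - b⁻¹ := by
      intro C
      simp_rw [sub_sq, Finset.sum_add_distrib, Finset.sum_sub_distrib, ← Finset.sum_mul,
        ← Finset.mul_sum, hsumP]
      simp only [Finset.sum_const, Finset.card_univ, nsmul_eq_mul]
      change _ + b * _ = _
      field_simp
      ring
    rw [Fintype.sum_prod_type]
    simp_rw [this]
    rw [Finset.sum_sub_distrib]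
    simp only [Finset.sum_const, Finset.card_univ, nsmul_eq_mul]
    change _ - a * _ ≤ _
    nlinarith
  have nn : (0 : ℝ) ≤ ∑ y : M × V, G y.1 y.2 ^ 2 := by positivity
  have np : (0 : ℝ) ≤ ∑ y : M × V, (P y.1 y.2 - b⁻¹) ^ 2 := by positivity
  rw [Fintype.sum_prod_type] at cs
  calc _ ≤ a⁻¹ ^ 2 * ((a * p) * (a * b)) := by
        gcongr
        exact cs.trans (mul_le_mul p2 g2 nn (np.trans p2))
    _ = _ := by field_simp

/-! ### Sparse vectors -/

/-- The vectors in `{-1, 0, 1}ⁿ` with support `B`. -/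
def signVectors {n : ℕ} (B : Finset (Fin n)) : Finset (Fin n → ℤ) :=
  Fintype.piFinset fun i => if i ∈ B then {-1, 1} else {0}

lemma mem_signVectors {n : ℕ} {B : Finset (Fin n)} {x : Fin n → ℤ} :
    x ∈ signVectors B ↔ (∀ i, x i = -1 ∨ x i = 0 ∨ x i = 1) ∧
      (Finset.univ.filter fun i => x i ≠ 0) = B := by
  simp only [signVectors, Fintype.mem_piFinset]
  constructor
  · intro h
    refine ⟨fun i => ?_, ?_⟩
    · have := h i
      split_ifs at this <;> simp at this <;> omega
    · ext i
      have := h i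
      simp only [Finset.mem_filter, Finset.mem_univ, true_and]
      split_ifs at this with hi <;> simp at this <;> simp [hi] <;> omega
  · rintro ⟨h1, rfl⟩ i
    have := h1 i
    simp only [Finset.mem_filter, Finset.mem_univ, true_and]
    split_ifs with hi
    · simp; omega
    · simp; omega

lemma card_signVectors {n : ℕ} (B : Finset (Fin n)) : (signVectors B).card = 2 ^ B.card := by
  rw [signVectors, Fintype.card_piFinset]
  calc _ = ∏ i, (if i ∈ B then 2 else 1) := Finset.prod_congr rfl fun i _ => by
        split_ifs <;> rfl
    _ = _ := by rw [Finset.prod_ite_mem]; simp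

/-- The finite set of `k`-sparse vectors in `{-1, 0, 1}ⁿ`. -/
def sparseFinset (n k : ℕ) : Finset (Fin n → ℤ) :=
  (Finset.powersetCard k Finset.univ).biUnion signVectors

lemma mem_sparseFinset {n k : ℕ} {x : Fin n → ℤ} : x ∈ sparseFinset n k ↔
    (∀ i, x i = -1 ∨ x i = 0 ∨ x i = 1) ∧ (Finset.univ.filter fun i => x i ≠ 0).card = k := by
  simp only [sparseFinset, Finset.mem_biUnion, Finset.mem_powersetCard_univ, mem_signVectors]
  constructor
  · rintro ⟨B, hB, h1, rfl⟩; exact ⟨h1, hB⟩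
  · rintro ⟨h1, h2⟩; exact ⟨_, h2, h1, rfl⟩

lemma coe_sparseFinset (n k : ℕ) : (sparseFinset n k : Set (Fin n → ℤ)) = sparseVectors n k := by
  ext x; rw [Finset.mem_coe, mem_sparseFinset]; rfl

lemma card_sparseFinset (n k : ℕ) : (sparseFinset n k).card = n.choose k * 2 ^ k := by
  rw [sparseFinset, Finset.card_biUnion]
  · rw [Finset.sum_congr rfl fun B hB => by
      rw [card_signVectors, (Finset.mem_powersetCard_univ.mp hB)]]
    simp
  · intro B _ B' _ hBB
    rw [Function.onFun, Finset.disjoint_left]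
    intro x hx hx'
    exact hBB ((mem_signVectors.mp hx).2.symm.trans (mem_signVectors.mp hx').2)

lemma sparseFinset_nonempty {n k : ℕ} (h : k ≤ n) : (sparseFinset n k).Nonempty := by
  rw [← Finset.card_pos, card_sparseFinset]
  have := Nat.choose_pos h
  positivity

/-- The linear combination of the columns of `C` with integer coefficients `x`. -/
def comb {q n d : ℕ} (x : Fin n → ℤ) (C : Fin n → Fin d → ZMod q) : Fin d → ZMod q :=
  fun l => ∑ c, (x c : ZMod q) * C c l

/-- The difference of the two combinations is an additive map in `C`. It is onto, since the vector
at `c₀` alone, having a unit coefficient, reaches every value; hence its kernel has the expected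
cardinality. -/
lemma card_comb_eq {q n d : ℕ} [NeZero q] {x x' : Fin n → ℤ} {c₀ : Fin n}
    (hu : IsUnit ((x c₀ : ZMod q) - (x' c₀ : ZMod q))) :
    (Finset.univ.filter fun C : Fin n → Fin d → ZMod q => comb x C = comb x' C).card *
      Fintype.card (Fin d → ZMod q) = Fintype.card (Fin n → Fin d → ZMod q) := by
  obtain ⟨u, hu⟩ := hu
  let f : (Fin n → Fin d → ZMod q) →+ (Fin d → ZMod q) :=
    { toFun := fun C => comb x C - comb x' C
      map_zero' := by ext; simp [comb]
      map_add' := fun C D => by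
        ext l
        simp only [comb, Pi.add_apply, Pi.sub_apply, mul_add, Finset.sum_add_distrib]
        ring }
  have hsurj : Function.Surjective f := by
    intro v
    refine ⟨Pi.single c₀ fun l => (u⁻¹ : (ZMod q)ˣ) * v l, ?_⟩
    ext l
    change comb x _ l - comb x' _ l = v l
    simp only [comb]
    rw [Finset.sum_eq_single c₀ (by intro b _ hb; simp [Pi.single_eq_of_ne hb]) (by simp),
      Finset.sum_eq_single c₀ (by intro b _ hb; simp [Pi.single_eq_of_ne hb]) (by simp),
      ← sub_mul, ← hu, Pi.single_eq_same]
    simp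
  have h1 := AddSubgroup.card_eq_card_quotient_mul_card_addSubgroup f.ker
  rw [Nat.card_congr (QuotientAddGroup.quotientKerEquivOfSurjective f hsurj).toEquiv] at h1
  have h2 : Nat.card f.ker =
      (Finset.univ.filter fun C : Fin n → Fin d → ZMod q => comb x C = comb x' C).card := by
    refine Nat.subtype_card _ fun C => ?_
    rw [AddMonoidHom.mem_ker, Finset.mem_filter]
    exact ⟨fun h => sub_eq_zero.mpr h.2, fun h => ⟨Finset.mem_univ _, sub_eq_zero.mp h⟩⟩
  rw [h2, Nat.card_eq_fintype_card, Nat.card_eq_fintype_card] at h1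
  rw [h1, mul_comm]

/-- A pair is bad when the supports agree, which is one support in `n.choose k`. If the supports
differ, then at some coordinate exactly one entry vanishes, so the difference there is ±1, a unit
modulo every q; q need not be prime. -/
lemma leftover_hash_sparse {q n k d : ℕ} [NeZero q] (hk : k ≤ n)
    (G : (Fin n → Fin d → ZMod q) → (Fin d → ZMod q) → ℝ) (hG0 : ∀ C v, 0 ≤ G C v)
    (hG1 : ∀ C v, G C v ≤ 1) :
    |((sparseFinset n k).card : ℝ)⁻¹ * ∑ x ∈ sparseFinset n k,
        (Fintype.card (Fin n → Fin d → ZMod q) : ℝ)⁻¹ * ∑ C, G C (comb x C) -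
      (Fintype.card (Fin n → Fin d → ZMod q) : ℝ)⁻¹ * ∑ C,
        (Fintype.card (Fin d → ZMod q) : ℝ)⁻¹ * ∑ v, G C v| ≤
      Real.sqrt ((q : ℝ) ^ d / n.choose k) := by
  classical
  have hch : (0 : ℝ) < n.choose k := by exact_mod_cast Nat.choose_pos hk
  have := leftover_hash (sparseFinset n k) (sparseFinset_nonempty hk) comb
    (fun x x' => (Finset.univ.filter fun i => x i ≠ 0) = (Finset.univ.filter fun i => x' i ≠ 0))
    (p := (n.choose k : ℝ)⁻¹) ?_ ?_ G hG0 hG1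
  · simpa [div_eq_mul_inv] using this
  · intro x hx
    have hx' := mem_sparseFinset.mp hx
    have : (sparseFinset n k).filter (fun x' => (Finset.univ.filter fun i => x i ≠ 0) =
        (Finset.univ.filter fun i => x' i ≠ 0)) =
        signVectors (Finset.univ.filter fun i => x i ≠ 0) := by
      ext x'
      rw [Finset.mem_filter, mem_sparseFinset, mem_signVectors]
      constructor
      · rintro ⟨⟨h1, _⟩, h3⟩; exact ⟨h1, h3.symm⟩
      · rintro ⟨h1, h2⟩; exact ⟨⟨h1, h2 ▸ hx'.2⟩, h2.symm⟩
    rw [this, card_signVectors, hx'.2, card_sparseFinset]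
    push_cast
    field_simp
    exact le_rfl
  · intro x hx x' hx' hne
    obtain ⟨c₀, hc⟩ : ∃ c, ¬ (x c ≠ 0 ↔ x' c ≠ 0) := by
      by_contra hcon
      push Not at hcon
      exact hne (by ext i; simpa using hcon i)
    refine card_comb_eq (c₀ := c₀) ?_
    have h1 := (mem_sparseFinset.mp hx).1 c₀
    have h2 := (mem_sparseFinset.mp hx').1 c₀
    have : x c₀ - x' c₀ = 1 ∨ x c₀ - x' c₀ = -1 := by
      by_cases h3 : x c₀ = 0 <;> by_cases h4 : x' c₀ = 0 <;> simp [h3, h4] at hc h1 h2 ⊢ <;> omega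
    rw [← Int.cast_sub]
    rcases this with h | h <;> rw [h] <;> simp

/-! ### Primitive vectors -/

/-- The vector `v` is the first column of an invertible matrix, up to inversion. -/
def Completable {q d : ℕ} (v : Fin (d + 1) → ZMod q) : Prop :=
  ∃ U W : Matrix (Fin (d + 1)) (Fin (d + 1)) (ZMod q), U * W = 1 ∧ W * U = 1 ∧
    U.mulVec v = Pi.single 0 1

/-- Smith normal form of the submodule spanned by `v`, whose rank is at most one. -/
lemma exists_basis_smul {d : ℕ} (v : Fin (d + 1) → ℤ) :
    ∃ (b : Module.Basis (Fin (d + 1)) ℤ (Fin (d + 1) → ℤ)) (g : ℤ), v = g • b 0 := by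
  classical
  obtain ⟨r, s⟩ := Submodule.smithNormalForm (Pi.basisFun ℤ (Fin (d + 1))) (Submodule.span ℤ {v})
  have hr : r ≤ 1 := by
    have h1 := Module.finrank_eq_card_basis s.bN
    have h2 := finrank_span_le_card (R := ℤ) ({v} : Set (Fin (d + 1) → ℤ))
    rw [h1] at h2
    simpa using h2
  have hv : v ∈ Submodule.span ℤ {v} := Submodule.mem_span_singleton_self v
  have hsum := s.bN.sum_repr ⟨v, hv⟩
  have hsum' := congrArg (Submodule.subtype _) hsum
  rw [map_sum] at hsum'
  simp only [map_smul, Submodule.subtype_apply, s.snf] at hsum'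
  rcases Nat.le_one_iff_eq_zero_or_eq_one.mp hr with rfl | rfl
  · refine ⟨s.bM, 0, ?_⟩
    simpa using hsum'.symm
  -- The swap moves the basis vector selected by the normal form to position 0.
  · refine ⟨s.bM.reindex (Equiv.swap (s.f 0) 0), s.bN.repr ⟨v, hv⟩ 0 * s.a 0, ?_⟩
    rw [Fin.sum_univ_one, smul_smul] at hsum'
    refine hsum'.symm.trans ?_
    simp

/-- Lift `v` to integers and write it as `g` times the first vector of a basis of ℤ^(d+1). A prime
dividing both `g` and q would divide every entry, so `g` is a unit modulo q; the base-change matrix,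
rescaled by the inverse of `g`, does the job. -/
lemma completable_of_forall_prime {q d : ℕ} [NeZero q] {v : Fin (d + 1) → ZMod q}
    (h : ∀ p : ℕ, p.Prime → p ∣ q → ∃ i, ¬ p ∣ (v i).val) : Completable v := by
  obtain ⟨b, g, hv⟩ := exists_basis_smul fun i => ((v i).val : ℤ)
  have hg : IsUnit (g : ZMod q) := by
    rw [ZMod.coe_int_isUnit_iff_isCoprime, Int.isCoprime_iff_gcd_eq_one]
    by_contra hne
    obtain ⟨p, hp, hpd⟩ := Nat.exists_prime_and_dvd hne
    have hpq : p ∣ q := by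
      exact_mod_cast (Int.natCast_dvd_natCast.mpr hpd).trans (Int.gcd_dvd_left _ _)
    have hpg : (p : ℤ) ∣ g := (Int.natCast_dvd_natCast.mpr hpd).trans (Int.gcd_dvd_right _ _)
    obtain ⟨i, hi⟩ := h p hp hpq
    have hvi := congrFun hv i
    simp only [Pi.smul_apply, smul_eq_mul] at hvi
    exact hi (Int.natCast_dvd_natCast.mp (hvi ▸ hpg.mul_right _))
  obtain ⟨u, hu⟩ := hg
  let f : ℤ →+* ZMod q := Int.castRingHom (ZMod q)
  set U₀ := b.toMatrix (Pi.basisFun ℤ (Fin (d + 1))) with hU₀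
  set W₀ := (Pi.basisFun ℤ (Fin (d + 1))).toMatrix b with hW₀
  have h1 : U₀ * W₀ = 1 := b.toMatrix_mul_toMatrix_flip _
  have h2 : W₀ * U₀ = 1 := Module.Basis.toMatrix_mul_toMatrix_flip _ _
  have h3 : U₀.mulVec (fun i => ((v i).val : ℤ)) = Pi.single 0 g := by
    have := Module.Basis.toMatrix_mulVec_repr (Pi.basisFun ℤ (Fin (d + 1))) b
      (fun i => ((v i).val : ℤ))
    have e : ⇑((Pi.basisFun ℤ (Fin (d + 1))).repr fun i => ((v i).val : ℤ)) =
      fun i => ((v i).val : ℤ) := by ext i; simp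
    rw [e] at this
    rw [this, hv, map_smul, Module.Basis.repr_self]
    ext i
    simp [Pi.single_apply, Finsupp.single_apply, eq_comm]
  refine ⟨((u⁻¹ : (ZMod q)ˣ) : ZMod q) • U₀.map f, (u : ZMod q) • W₀.map f, ?_, ?_, ?_⟩
  · rw [Matrix.smul_mul, Matrix.mul_smul, smul_smul, Units.inv_mul, one_smul, ← Matrix.map_mul, h1]
    simp
  · rw [Matrix.smul_mul, Matrix.mul_smul, smul_smul, Units.mul_inv, one_smul, ← Matrix.map_mul, h2]
    simp
  · have h4 : (U₀.map f).mulVec v = Pi.single 0 (g : ZMod q) := by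
      have e : v = f ∘ fun i => ((v i).val : ℤ) := by ext i; simp [f]
      ext i
      rw [e, ← RingHom.map_mulVec, h3]
      by_cases hi : i = 0 <;> simp [f, hi]
    rw [Matrix.smul_mulVec, h4, ← hu]
    ext i
    simp [Pi.single_apply]

lemma two_pow_card_primeFactors_le {q : ℕ} (hq : q ≠ 0) : 2 ^ q.primeFactors.card ≤ q := by
  calc 2 ^ q.primeFactors.card ≤ ∏ p ∈ q.primeFactors, p :=
        Finset.pow_card_le_prod _ _ _ fun p hp => (Nat.prime_of_mem_primeFactors hp).two_le
    _ ≤ q := Nat.le_of_dvd (Nat.pos_of_ne_zero hq) (Nat.prod_primeFactors_dvd q)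

lemma card_filter_dvd_val {q p : ℕ} [NeZero q] (hpq : p ∣ q) :
    (Finset.univ.filter fun y : ZMod q => p ∣ y.val).card * p ≤ q := by
  have h : (Finset.univ.filter fun y : ZMod q => p ∣ y.val).card ≤ (Finset.range (q / p)).card := by
    refine Finset.card_le_card_of_injOn (fun y => y.val / p) (fun y _ => ?_) ?_
    · have := ZMod.val_lt y
      simpa using Nat.div_lt_div_of_lt_of_dvd hpq this
    · intro y hy z hz hyz
      simp only [Finset.coe_filter, Finset.mem_univ, true_and, Set.mem_ofPred_eq] at hy hz
      exact ZMod.val_injective q ((Nat.div_left_inj hy hz).mp hyz)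
  rw [Finset.card_range] at h
  exact (Nat.mul_le_mul_right p h).trans (Nat.div_mul_le_self q p)

/-- The proportion of vectors over `ℤ / q` that are not completable. -/
lemma card_not_completable_le {q d : ℕ} [NeZero q] [DecidablePred (@Completable q d)] :
    ((Finset.univ.filter fun v : Fin (d + 1) → ZMod q => ¬ Completable v).card : ℝ) ≤
      Fintype.card (Fin (d + 1) → ZMod q) * (Real.log q / 2 ^ d) := by
  have hq : q ≠ 0 := NeZero.ne q
  have hsub : (Finset.univ.filter fun v : Fin (d + 1) → ZMod q => ¬ Completable v) ⊆
      q.primeFactors.biUnion fun p => Fintype.piFinset fun _ =>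
        Finset.univ.filter fun y : ZMod q => p ∣ y.val := by
    intro v hv
    rw [Finset.mem_filter] at hv
    by_contra hcon
    refine hv.2 (completable_of_forall_prime fun p hp hpq => ?_)
    by_contra hall
    push Not at hall
    refine hcon (Finset.mem_biUnion.mpr ⟨p, ?_, ?_⟩)
    · exact Nat.mem_primeFactors.mpr ⟨hp, hpq, hq⟩
    · simpa [Fintype.mem_piFinset] using hall
  have hcard : ∀ p ∈ q.primeFactors, ((Fintype.piFinset fun _ : Fin (d + 1) =>
      Finset.univ.filter fun y : ZMod q => p ∣ y.val).card : ℝ) ≤ (q : ℝ) ^ (d + 1) / 2 ^ (d + 1) := by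
    intro p hp
    have hpp := Nat.prime_of_mem_primeFactors hp
    have h1 := card_filter_dvd_val (Nat.dvd_of_mem_primeFactors hp)
    rw [Fintype.card_piFinset_const, Nat.cast_pow, ← div_pow]
    gcongr
    rw [le_div_iff₀ two_pos]
    have : (Finset.univ.filter fun y : ZMod q => p ∣ y.val).card * 2 ≤ q := by
      calc _ ≤ (Finset.univ.filter fun y : ZMod q => p ∣ y.val).card * p :=
            Nat.mul_le_mul_left _ hpp.two_le
        _ ≤ q := h1
    exact_mod_cast this
  calc _ ≤ ((q.primeFactors.biUnion fun p => Fintype.piFinset fun _ : Fin (d + 1) =>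
        Finset.univ.filter fun y : ZMod q => p ∣ y.val).card : ℝ) := by
        exact_mod_cast Finset.card_le_card hsub
    _ ≤ ∑ p ∈ q.primeFactors, ((Fintype.piFinset fun _ : Fin (d + 1) =>
        Finset.univ.filter fun y : ZMod q => p ∣ y.val).card : ℝ) := by
        exact_mod_cast Finset.card_biUnion_le
    _ ≤ ∑ p ∈ q.primeFactors, (q : ℝ) ^ (d + 1) / 2 ^ (d + 1) := Finset.sum_le_sum hcard
    _ = q.primeFactors.card * ((q : ℝ) ^ (d + 1) / 2 ^ (d + 1)) := by simp
    -- The number of prime divisors is at most log₂ q ≤ 2 log q. The factor 2 is why the final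
    -- exponent is d and not d + 1.
    _ ≤ (2 * Real.log q) * ((q : ℝ) ^ (d + 1) / 2 ^ (d + 1)) := by
        gcongr
        have h2 : ((2 : ℝ) ^ q.primeFactors.card) ≤ q := by
          exact_mod_cast two_pow_card_primeFactors_le hq
        have h3 := Real.log_le_log (by positivity) h2
        rw [Real.log_pow] at h3
        have := Real.log_two_gt_d9
        have h4 : (0 : ℝ) ≤ q.primeFactors.card := by positivity
        nlinarith
    _ = _ := by
        simp only [Fintype.card_pi, ZMod.card, Finset.prod_const, Finset.card_univ,
          Fintype.card_fin, Nat.cast_pow]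
        rw [pow_succ (2 : ℝ) d]
        field_simp

/-! ### Rows of samples on the torus -/

/-- One row of data: a vector on the torus and a label. -/
abbrev Row (n : ℕ) : Type := (Fin n → ℝ) × ℝ

/-- The row with vector `(w + κ) / q` modulo `1` and label `⟨x, (w + κ) / q mod 1⟩ + κ'`
modulo `1`. -/
def genRow {q n : ℕ} (x : Fin n → ℤ) (w : Fin n → ZMod q) (κ : Fin n → ℝ) (κ' : ℝ) : Row n :=
  (fun c => Int.fract ((zval (w c) + κ c) / q),
    Int.fract (∑ c, (x c : ℝ) * Int.fract ((zval (w c) + κ c) / q) + κ'))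

/-- The products of the secret `s` with the vectors `A c`. -/
def dotp {q n d : ℕ} (s : Fin d → ZMod q) (A : Fin n → Fin d → ZMod q) (c : Fin n) : ZMod q :=
  ∑ l, s l * A c l

/-- Replacing the errors of one row of LWE samples by uniform elements changes the expectation
of `F` by at most `ε`, for all ways to complete the samples to `m` rows. -/
def LWEClose {m n : ℕ} (q l : ℕ) [NeZero q] (σ : ℝ) (F : (Fin m → Row n) → ℝ≥0∞) (ε : ℝ≥0∞) :
    Prop :=
  ∀ (i : Fin m) (s : Fin m → Fin l → ZMod q) (x : Fin m → Fin n → ℤ) (κ : Fin m → Fin n → ℝ)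
    (κ' : Fin m → ℝ), (∀ j c, x j c = -1 ∨ x j c = 0 ∨ x j c = 1) →
    Near ε
      (∫⁻ A : Fin n → Fin l → ZMod q, ∫⁻ t : Fin l → ZMod q, ∫⁻ e : Fin n → ℤ,
        F (fun j => genRow (x j) (if j = i then fun c => dotp t A c + (e c : ZMod q)
          else dotp (s j) A) (κ j) (κ' j))
        ∂(Measure.pi fun _ => discreteGaussian σ) ∂unif _ ∂unif _)
      (∫⁻ A : Fin n → Fin l → ZMod q, ∫⁻ y : Fin n → ZMod q,
        F (fun j => genRow (x j) (if j = i then y else dotp (s j) A) (κ j) (κ' j))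
        ∂unif _ ∂unif _)

/-- The part of the randomness of a row that is kept fixed when LWE is applied: the first
coordinate of the secret, the continuous noise on the vector, the noise on the label. -/
abbrev FixSeed (q n : ℕ) : Type := ZMod q × ((Fin n → ℝ) × ℝ)

/-- The remaining randomness of a row: the rest of the secret, a uniform vector, the LWE errors. -/
abbrev VarSeed (q l n : ℕ) : Type := (Fin l → ZMod q) × ((Fin n → ZMod q) × (Fin n → ℤ))

/-- The distribution of the fixed part of the randomness. -/
def fixLaw (q n : ℕ) [NeZero q] (A V : ℝ) : Measure (FixSeed q n) :=
  (unif (ZMod q)).prod ((Measure.pi fun _ => gaussV A).prod (gaussV V))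

/-- The distribution of the remaining randomness. -/
def varLaw (q l n : ℕ) [NeZero q] (σ : ℝ) : Measure (VarSeed q l n) :=
  (unif (Fin l → ZMod q)).prod ((unif (Fin n → ZMod q)).prod
    (Measure.pi fun _ => discreteGaussian σ))

/-- A row with a uniform vector. -/
def unifRow {q l n : ℕ} (x : Fin n → ℤ) (φ : FixSeed q n → ℝ) (ω : FixSeed q n × VarSeed q l n) :
    Row n :=
  genRow x ω.2.2.1 ω.1.2.1 (φ ω.1)

/-- A row of LWE samples with secret dimension `l + 1`. -/
def lweRow {q l n : ℕ} (x : Fin n → ℤ) (φ : FixSeed q n → ℝ) (C : Fin n → Fin (l + 1) → ZMod q)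
    (ω : FixSeed q n × VarSeed q l n) : Row n :=
  genRow x (fun c => dotp (Fin.cons ω.1.1 ω.2.1 : Fin (l + 1) → ZMod q) C c + (ω.2.2.2 c : ZMod q))
    ω.1.2.1 (φ ω.1)

instance (q n : ℕ) [NeZero q] (A V : ℝ) : IsProbabilityMeasure (fixLaw q n A V) := by
  unfold fixLaw; infer_instance

lemma isProbabilityMeasure_varLaw (q l n : ℕ) [NeZero q] {σ : ℝ} (hσ : 0 < σ) :
    IsProbabilityMeasure (varLaw q l n σ) := by
  have := isProbabilityMeasure_discreteGaussian hσ
  unfold varLaw; infer_instance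

@[fun_prop]
lemma measurable_genRow {q n : ℕ} {α : Type*} [MeasurableSpace α] (x : Fin n → ℤ)
    {w : α → Fin n → ZMod q} (hw : Measurable w) {κ : α → Fin n → ℝ} (hκ : Measurable κ)
    {κ' : α → ℝ} (hκ' : Measurable κ') : Measurable fun a => genRow x (w a) (κ a) (κ' a) := by
  unfold genRow
  fun_prop

@[fun_prop]
lemma measurable_dotp {q n d : ℕ} [NeZero q] {α : Type*} [MeasurableSpace α]
    {s : α → Fin d → ZMod q} (hs : Measurable s) {A : α → Fin n → Fin d → ZMod q}
    (hA : Measurable A) : Measurable fun a => dotp (s a) (A a) := by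
  have : Measurable fun p : (Fin d → ZMod q) × (Fin n → Fin d → ZMod q) => dotp p.1 p.2 :=
    measurable_of_countable _
  exact this.comp (hs.prodMk hA)

/-- Integers can be moved between the ℤ_q part and the real noise. This lets a simulated row carry
known integer terms inside its real constants. -/
lemma genRow_congr {q n : ℕ} [NeZero q] (x : Fin n → ℤ) {w w' : Fin n → ZMod q} {κ κ' : Fin n → ℝ}
    (b : ℝ) (h : ∀ c, ∃ z : ℤ, w c = w' c + z ∧ κ' c = κ c + z) :
    genRow x w κ b = genRow x w' κ' b := by
  have : ∀ c, Int.fract ((zval (w c) + κ c) / q) = Int.fract ((zval (w' c) + κ' c) / q) := by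
    intro c
    obtain ⟨z, hz, hz'⟩ := h c
    rw [fract_zval_congr (b := (w' c).val + z) (by simp [hz]), hz', zval_eq]
    push_cast
    ring_nf
  simp [genRow, this]

lemma measurable_intCast_zmod {q n : ℕ} [NeZero q] :
    Measurable fun p : (Fin n → ZMod q) × (Fin n → ℤ) => fun c => p.1 c + (p.2 c : ZMod q) :=
  measurable_of_countable _

lemma measurable_unifRow {q l n : ℕ} [NeZero q] (x : Fin n → ℤ) {φ : FixSeed q n → ℝ}
    (hφ : Measurable φ) : Measurable (unifRow (l := l) x φ) := by
  unfold unifRow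
  fun_prop

lemma measurable_lweRow {q l n : ℕ} [NeZero q] (x : Fin n → ℤ) {φ : FixSeed q n → ℝ}
    (hφ : Measurable φ) : Measurable (lweRow (l := l) x φ).uncurry := by
  unfold lweRow
  refine measurable_genRow x ?_ (by fun_prop) (by fun_prop)
  have h1 : Measurable fun p : (Fin n → Fin (l + 1) → ZMod q) × (FixSeed q n × VarSeed q l n) =>
      (Fin.cons p.2.1.1 p.2.2.1 : Fin (l + 1) → ZMod q) :=
    measurable_finCons.comp (by fun_prop : Measurable fun p : (Fin n → Fin (l + 1) → ZMod q) ×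
      (FixSeed q n × VarSeed q l n) => (p.2.1.1, p.2.2.1))
  exact measurable_intCast_zmod.comp ((measurable_dotp h1 measurable_fst).prodMk (by fun_prop))

/-- Separate the first coordinate of the vectors. -/
def consCols (q n l : ℕ) :
    (Fin n → ZMod q) × (Fin n → Fin l → ZMod q) ≃ (Fin n → Fin (l + 1) → ZMod q) where
  toFun p c := Fin.cons (p.1 c) (p.2 c)
  invFun C := (fun c => C c 0, fun c => Fin.tail (C c))
  left_inv p := by ext <;> simp
  right_inv C := by ext; simp

lemma dotp_cons {q n l : ℕ} (s₀ : ZMod q) (t : Fin l → ZMod q)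
    (p : (Fin n → ZMod q) × (Fin n → Fin l → ZMod q)) (c : Fin n) :
    dotp (Fin.cons s₀ t : Fin (l + 1) → ZMod q) (consCols q n l p) c =
      s₀ * p.1 c + dotp t p.2 c := by
  simp [dotp, consCols, Fin.sum_univ_succ]

/-- Puts the first coordinates `c₀` of the matrix and the fixed seed outermost, so that the inner
integral is an LWE experiment in dimension `l`. -/
lemma lintegral_consCols {q n l : ℕ} [NeZero q] {Θ Ξ : Type*} [MeasurableSpace Θ]
    [MeasurableSpace Ξ] (μ : Measure Θ) (ν : Measure Ξ) [IsProbabilityMeasure μ]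
    [IsProbabilityMeasure ν] {H : (Fin n → Fin (l + 1) → ZMod q) → Θ × Ξ → ℝ≥0∞}
    (hH : Measurable H.uncurry) :
    ∫⁻ C, ∫⁻ a, H C a ∂(μ.prod ν) ∂unif _ =
      ∫⁻ c₀ : Fin n → ZMod q, ∫⁻ θ, ∫⁻ B : Fin n → Fin l → ZMod q, ∫⁻ ξ,
        H (consCols q n l (c₀, B)) (θ, ξ) ∂ν ∂unif _ ∂μ ∂unif _ := by
  rw [← lintegral_unif_equiv (consCols q n l) (fun C => ∫⁻ a, H C a ∂(μ.prod ν)), ← unif_prod,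
    lintegral_prod _ (measurable_of_countable _).aemeasurable]
  refine lintegral_congr fun c₀ => ?_
  have hcc : Measurable fun p : (Θ × (Fin n → Fin l → ZMod q)) × Ξ =>
      (consCols q n l (c₀, p.1.2), (p.1.1, p.2)) := by
    refine Measurable.prodMk ?_ (by fun_prop)
    exact (measurable_of_countable fun B => consCols q n l (c₀, B)).comp (by fun_prop)
  have h1 : ∀ C, ∫⁻ a, H C a ∂(μ.prod ν) = ∫⁻ θ, ∫⁻ ξ, H C (θ, ξ) ∂ν ∂μ := fun C =>
    lintegral_prod _ (hH.comp measurable_prodMk_left).aemeasurable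
  simp_rw [h1]
  exact lintegral_lintegral_swap
    (f := fun B θ => ∫⁻ ξ, H (consCols q n l (c₀, B)) (θ, ξ) ∂ν)
    ((hH.comp hcc).lintegral_prod_right'.comp measurable_swap).aemeasurable

lemma measurable_hybrid_rows {Γ Ω ρ : Type*} [MeasurableSpace Γ] [MeasurableSpace Ω]
    [MeasurableSpace ρ] {m : ℕ} {r₀ r₁ r : Γ → Ω → ρ} (h₀ : Measurable r₀.uncurry)
    (h₁ : Measurable r₁.uncurry) (hr : Measurable r.uncurry) {F : (Fin m → ρ) → ℝ≥0∞}
    (hF : Measurable F) (i : Fin m) (ω : Fin m → Ω) :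
    Measurable (fun γ a => F (fun j => if j < i then r₁ γ (ω j) else if j = i then r γ a
      else r₀ γ (ω j))).uncurry := by
  refine hF.comp (measurable_pi_lambda _ fun j => ?_)
  have e : Measurable fun p : Γ × Ω => (p.1, ω j) := by fun_prop
  split_ifs
  · exact h₁.comp e
  · exact hr
  · exact h₀.comp e

/-- Rows of LWE samples are replaced by rows of uniform vectors. -/
lemma near_lweRow_unifRow {q l n m : ℕ} [NeZero q] {σ : ℝ} (hσ : 0 < σ) {A V : ℝ} {ε : ℝ≥0∞}
    {F : (Fin m → Row n) → ℝ≥0∞} (hF : Measurable F) (hclose : LWEClose q l σ F ε)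
    {x : Fin n → ℤ} (hx : ∀ c, x c = -1 ∨ x c = 0 ∨ x c = 1) {φ : FixSeed q n → ℝ}
    (hφ : Measurable φ) :
    Near (m * ε)
      (∫⁻ C, ∫⁻ ω, F (fun j => lweRow x φ C (ω j))
        ∂(Measure.pi fun _ => (fixLaw q n A V).prod (varLaw q l n σ)) ∂unif _)
      (∫⁻ _ : Fin n → Fin (l + 1) → ZMod q, ∫⁻ ω, F (fun j => unifRow x φ (ω j))
        ∂(Measure.pi fun _ => (fixLaw q n A V).prod (varLaw q l n σ)) ∂unif _) := by
  have := isProbabilityMeasure_discreteGaussian hσ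
  have := isProbabilityMeasure_varLaw q l n hσ
  have hm1 := measurable_lweRow (l := l) x hφ
  have hm0 := measurable_unifRow (l := l) x hφ
  refine near_hybrid (r₀ := fun _ => unifRow x φ) (r₁ := lweRow x φ) (hm0.comp measurable_snd)
    hm1 hF fun i ω => ?_
  have hmeas : ∀ r : (Fin n → Fin (l + 1) → ZMod q) → FixSeed q n × VarSeed q l n → Row n,
      Measurable r.uncurry → Measurable (fun C a => F (fun j => if j < i then
        lweRow x φ C (ω j) else if j = i then r C a else unifRow x φ (ω j))).uncurry :=
    fun r hr => measurable_hybrid_rows (r₀ := fun _ => unifRow x φ)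
      (hm0.comp measurable_snd) hm1 hr hF i ω
  rw [lintegral_consCols _ _ (hmeas _ hm1),
    lintegral_consCols _ _ (hmeas (fun _ => unifRow x φ) (hm0.comp measurable_snd))]
  refine Near.lintegral fun c₀ => Near.lintegral fun a => ?_
  -- Simulation of all rows from one LWE challenge with vectors `B`. Earlier rows use their known
  -- secrets, with known errors and first coordinates inside `κ`. Later rows use the secret 0, with
  -- their uniform vector inside `κ`. Row `i` is the challenge, shifted by the revealed contribution
  -- of `c₀`.
  have key := hclose i (fun j => if j < i then (ω j).2.1 else 0) (fun _ => x)
    (fun j c => if j < i then (((ω j).1.1 * c₀ c).val : ℝ) + (ω j).2.2.2 c + (ω j).1.2.1 c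
      else if j = i then ((a.1 * c₀ c).val : ℝ) + a.2.1 c
      else ((ω j).2.2.1 c).val + (ω j).1.2.1 c)
    (fun j => if j = i then φ a else φ (ω j).1) (fun _ => hx)
  have hrest : ∀ (B : Fin n → Fin l → ZMod q) (j : Fin m), j ≠ i →
      (if j < i then lweRow x φ (consCols q n l (c₀, B)) (ω j) else unifRow x φ (ω j)) =
      genRow x (dotp (if j < i then (ω j).2.1 else 0) B)
        (fun c => if j < i then (((ω j).1.1 * c₀ c).val : ℝ) + (ω j).2.2.2 c + (ω j).1.2.1 c
          else if j = i then ((a.1 * c₀ c).val : ℝ) + a.2.1 c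
          else ((ω j).2.2.1 c).val + (ω j).1.2.1 c) (φ (ω j).1) := by
    intro B j hj
    split_ifs with h1
    · refine genRow_congr x _ fun c => ⟨((ω j).1.1 * c₀ c).val + (ω j).2.2.2 c, ?_, ?_⟩
      · rw [dotp_cons]; push_cast; rw [ZMod.natCast_zmod_val]; ring
      · push_cast; ring
    · refine genRow_congr x _ fun c => ⟨((ω j).2.2.1 c).val, ?_, ?_⟩
      · simp [dotp]
      · push_cast; ring
  convert key using 1
  · refine lintegral_congr fun B => ?_
    have hcol : ∀ b : VarSeed q l n, (fun j => if j < i then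
        lweRow x φ (consCols q n l (c₀, B)) (ω j) else
        if j = i then lweRow x φ (consCols q n l (c₀, B)) (a, b) else unifRow x φ (ω j)) =
        fun j => genRow x (if j = i then fun c => dotp b.1 B c + (b.2.2 c : ZMod q)
          else dotp (if j < i then (ω j).2.1 else 0) B)
          (fun c => if j < i then (((ω j).1.1 * c₀ c).val : ℝ) + (ω j).2.2.2 c + (ω j).1.2.1 c
            else if j = i then ((a.1 * c₀ c).val : ℝ) + a.2.1 c
            else ((ω j).2.2.1 c).val + (ω j).1.2.1 c) (if j = i then φ a else φ (ω j).1) := by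
      intro b
      ext1 j
      by_cases hj : j = i
      · subst hj
        simp only [lt_irrefl, if_false, if_true]
        refine genRow_congr x _ fun c => ⟨(a.1 * c₀ c).val, ?_, ?_⟩
        · simp only [dotp_cons]; push_cast; rw [ZMod.natCast_zmod_val]; ring
        · push_cast; ring
      · rw [if_neg hj, if_neg hj, if_neg hj]
        exact hrest B j hj
    simp_rw [hcol]
    unfold varLaw
    rw [lintegral_prod]
    · refine lintegral_congr fun t => ?_
      rw [lintegral_prod]
      · simp
      · exact (measurable_of_countable _).aemeasurable
    · exact (measurable_of_countable _).aemeasurable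
  · refine lintegral_congr fun B => ?_
    have hcol : ∀ b : VarSeed q l n, (fun j => if j < i then
        lweRow x φ (consCols q n l (c₀, B)) (ω j) else
        if j = i then unifRow x φ (a, b) else unifRow x φ (ω j)) =
        fun j => genRow x (if j = i then b.2.1 - (fun c => a.1 * c₀ c)
          else dotp (if j < i then (ω j).2.1 else 0) B)
          (fun c => if j < i then (((ω j).1.1 * c₀ c).val : ℝ) + (ω j).2.2.2 c + (ω j).1.2.1 c
            else if j = i then ((a.1 * c₀ c).val : ℝ) + a.2.1 c
            else ((ω j).2.2.1 c).val + (ω j).1.2.1 c) (if j = i then φ a else φ (ω j).1) := by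
      intro b
      ext1 j
      by_cases hj : j = i
      · subst hj
        simp only [lt_irrefl, if_false, if_true]
        refine genRow_congr x _ fun c => ⟨(a.1 * c₀ c).val, ?_, ?_⟩
        · simp
        · push_cast; ring
      · rw [if_neg hj, if_neg hj, if_neg hj]
        exact hrest B j hj
    simp_rw [hcol]
    unfold varLaw
    rw [lintegral_prod]
    · simp only
      rw [lintegral_const, measure_univ, mul_one, lintegral_prod]
      · simp only [lintegral_const, measure_univ, mul_one]
        -- A uniform vector stays uniform after subtracting the revealed contribution of `c₀`.
        exact lintegral_unif_equiv (Equiv.subRight fun c => a.1 * c₀ c) (fun y => F (fun j =>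
          genRow x (if j = i then y else dotp (if j < i then (ω j).2.1 else 0) B)
          (fun c => if j < i then (((ω j).1.1 * c₀ c).val : ℝ) + (ω j).2.2.2 c + (ω j).1.2.1 c
            else if j = i then ((a.1 * c₀ c).val : ℝ) + a.2.1 c
            else ((ω j).2.2.1 c).val + (ω j).1.2.1 c) (if j = i then φ a else φ (ω j).1)))
      · exact (measurable_of_countable _).aemeasurable
    · exact (measurable_of_countable _).aemeasurable

/-! ### Domination for one row -/

/-- The domination constant for one coordinate. -/
def thetaConst (σ : ℝ) : ℝ≥0∞ := ENNReal.ofReal (theta (σ ^ 2 / 4))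

lemma one_le_thetaConst {σ : ℝ} (hσ : 0 < σ) : 1 ≤ thetaConst σ := by
  rw [thetaConst, ← ENNReal.ofReal_one]
  exact ENNReal.ofReal_le_ofReal (one_le_theta (by positivity))

lemma ofReal_theta_le {σ V : ℝ} (hσ : 0 < σ) (h : σ ^ 2 / 4 ≤ V) :
    ENNReal.ofReal (theta V) ≤ thetaConst σ :=
  ENNReal.ofReal_le_ofReal (theta_anti (by positivity) h)

section

variable {q l n : ℕ} [NeZero q] {σ V : ℝ}

/-- Coordinatewise absorption: the vector becomes uniform on the torus and each coordinate adds `χ c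
^ 2 * σ ^ 2` to the squared width of the label noise. The first coordinate of the secret passes
through untouched. -/
lemma lintegral_seed_unif_le (hσ : 0 < σ) (hV : 4 * σ ^ 2 ≤ V) (χ : Fin n → ℝ)
    (hχ : ∀ c, χ c ^ 2 ≤ 4) {Ψ : ZMod q × Row n → ℝ≥0∞} (hΨ : Measurable Ψ) :
    ∫⁻ ω, Ψ (ω.1.1, (fun c => Int.fract ((zval (ω.2.2.1 c) + ω.1.2.1 c) / q),
        ∑ c, χ c * ω.1.2.1 c + ω.1.2.2)) ∂((fixLaw q n (σ ^ 2) V).prod (varLaw q l n σ)) ≤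
      thetaConst σ ^ n * ∫⁻ p, Ψ p ∂((unif (ZMod q)).prod
        ((Measure.pi fun _ => uniformTorus).prod (gaussV ((∑ c, χ c ^ 2) * σ ^ 2 + V)))) := by
  have := isProbabilityMeasure_discreteGaussian hσ
  have := isProbabilityMeasure_varLaw q l n hσ
  have hm : Measurable fun p : (ZMod q × ((Fin n → ℝ) × ℝ)) × (Fin n → ZMod q) =>
      Ψ (p.1.1, (fun c => Int.fract ((zval (p.2 c) + p.1.2.1 c) / q),
        ∑ c, χ c * p.1.2.1 c + p.1.2.2)) := hΨ.comp (by fun_prop)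
  have hvar : ∀ G : (Fin n → ZMod q) → ℝ≥0∞, ∫⁻ ξ, G ξ.2.1 ∂varLaw q l n σ =
      ∫⁻ y, G y ∂(Measure.pi fun _ => unif (ZMod q)) := by
    intro G
    unfold varLaw
    rw [lintegral_prod _ (measurable_of_countable _).aemeasurable]
    simp only [lintegral_const, measure_univ, mul_one]
    rw [lintegral_prod _ (measurable_of_countable _).aemeasurable, unif_pi]
    simp
  rw [lintegral_prod _ (by
    refine Measurable.aemeasurable (hm.comp (g := fun p : (ZMod q × ((Fin n → ℝ) × ℝ)) ×
      (Fin n → ZMod q) => Ψ (p.1.1, (fun c => Int.fract ((zval (p.2 c) + p.1.2.1 c) / q),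
        ∑ c, χ c * p.1.2.1 c + p.1.2.2))) (f := fun ω : FixSeed q n × VarSeed q l n =>
          (ω.1, ω.2.2.1)) (by fun_prop)))]
  have h1 : ∀ a : FixSeed q n, ∫⁻ ξ, Ψ (a.1, (fun c => Int.fract ((zval (ξ.2.1 c) + a.2.1 c) / q),
        ∑ c, χ c * a.2.1 c + a.2.2)) ∂varLaw q l n σ = _ := fun a =>
    hvar (fun y => Ψ (a.1, (fun c => Int.fract ((zval (y c) + a.2.1 c) / q),
        ∑ c, χ c * a.2.1 c + a.2.2)))
  simp_rw [h1]
  unfold fixLaw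
  rw [lintegral_prod _ hm.lintegral_prod_right'.aemeasurable, lintegral_prod _ hΨ.aemeasurable,
    ← lintegral_const_mul _ hΨ.lintegral_prod_right']
  refine lintegral_mono fun s₀ => ?_
  rw [lintegral_lintegral_swap (by
    exact (hm.comp (by fun_prop : Measurable fun p : ((Fin n → ℝ) × ℝ) × (Fin n → ZMod q) =>
      ((s₀, p.1), p.2))).aemeasurable)]
  have key := lintegral_pi_absorb_le (P := (unif (ZMod q)).prod (gaussV (σ ^ 2)))
    (Q := uniformTorus) (a := fun p => Int.fract ((zval p.1 + p.2) / q)) (b := fun p => p.2)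
    (by fun_prop) (by fun_prop) (K := thetaConst σ) (X := {χ | χ ^ 2 ≤ 4}) (V₀ := 4 * σ ^ 2)
    (W := σ ^ 2) (by positivity) ?_ χ hχ hV (F := fun p => Ψ (s₀, p)) (by fun_prop)
  · rw [lintegral_prod _ (by exact (hΨ.comp (by fun_prop)).aemeasurable)]
    refine le_trans (le_of_eq ?_) key
    rw [lintegral_pi_prod]
    · refine lintegral_congr fun y => ?_
      rw [lintegral_prod]
      exact (hm.comp (by fun_prop : Measurable fun p : (Fin n → ℝ) × ℝ =>
        ((s₀, p), y))).aemeasurable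
    · exact Measurable.lintegral_prod_right' (f := fun p : (Fin n → ZMod q × ℝ) × ℝ =>
        Ψ (s₀, (fun c => Int.fract ((zval (p.1 c).1 + (p.1 c).2) / q),
        ∑ c, χ c * (p.1 c).2 + p.2))) (hΨ.comp (by fun_prop))
  · intro B hB χ hχ F hF
    have hA : 0 < σ ^ 2 := by positivity
    have hB0 : 0 < B := by linarith
    refine (lintegral_unif_gaussV_le hA hB0 χ hF).trans ?_
    gcongr
    -- With `χ² ≤ 4` and `B ≥ 4σ²`, the conditional squared width `σ²B / (χ²σ² + B)` is at least
    -- `σ²/2`, which exceeds the required `σ²/4`.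
    refine ofReal_theta_le hσ ?_
    have : χ ^ 2 ≤ 4 := hχ
    rw [le_div_iff₀ (by positivity)]
    nlinarith [mul_le_mul_of_nonneg_right this hA.le]

/-- The same absorption with the rotated pair: the sum of lattice error and continuous noise goes to
the vector, their difference to the label, each of squared width `2σ²` per coordinate before scaling
by `χ`. -/
lemma lintegral_seed_lwe_le (hσ : 0 < σ) (hV : 4 * σ ^ 2 ≤ V) (χ : Fin n → ℝ)
    (hχ : ∀ c, χ c ^ 2 ≤ 1) {Ψ : (Fin (l + 1) → ZMod q) × Row n → ℝ≥0∞} (hΨ : Measurable Ψ) :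
    ∫⁻ ω, Ψ (Fin.cons ω.1.1 ω.2.1, (fun c => (ω.2.2.2 c : ℝ) + ω.1.2.1 c,
        ∑ c, χ c * ((ω.2.2.2 c : ℝ) - ω.1.2.1 c) + ω.1.2.2))
        ∂((fixLaw q n (σ ^ 2) V).prod (varLaw q l n σ)) ≤
      thetaConst σ ^ n * ∫⁻ p, Ψ p ∂((unif (Fin (l + 1) → ZMod q)).prod
        ((Measure.pi fun _ => gaussV (2 * σ ^ 2)).prod
          (gaussV ((∑ c, χ c ^ 2) * (2 * σ ^ 2) + V)))) := by
  have := isProbabilityMeasure_discreteGaussian hσ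
  have := isProbabilityMeasure_varLaw q l n hσ
  have hcast : Measurable (fun z : ℤ => (z : ℝ)) := fun _ _ => trivial
  have hm : Measurable fun p : (ZMod q × ((Fin n → ℝ) × ℝ)) × ((Fin l → ZMod q) × (Fin n → ℤ)) =>
      Ψ (Fin.cons p.1.1 p.2.1, (fun c => (p.2.2 c : ℝ) + p.1.2.1 c,
        ∑ c, χ c * ((p.2.2 c : ℝ) - p.1.2.1 c) + p.1.2.2)) := by
    refine hΨ.comp (Measurable.prodMk ?_ (by fun_prop))
    exact measurable_finCons.comp (by fun_prop : Measurable fun p : (ZMod q × ((Fin n → ℝ) × ℝ)) ×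
      ((Fin l → ZMod q) × (Fin n → ℤ)) => (p.1.1, p.2.1))
  have hvar : ∀ G : (Fin l → ZMod q) × (Fin n → ℤ) → ℝ≥0∞, ∫⁻ ξ, G (ξ.1, ξ.2.2) ∂varLaw q l n σ =
      ∫⁻ ξ, G ξ ∂((unif _).prod (Measure.pi fun _ => discreteGaussian σ)) := by
    intro G
    unfold varLaw
    rw [lintegral_prod _ (measurable_of_countable _).aemeasurable,
      lintegral_prod _ (measurable_of_countable _).aemeasurable]
    refine lintegral_congr fun t => ?_
    rw [lintegral_prod _ (measurable_of_countable _).aemeasurable]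
    simp
  rw [lintegral_prod _ (by
    refine Measurable.aemeasurable (hm.comp (g := fun p : (ZMod q × ((Fin n → ℝ) × ℝ)) ×
      ((Fin l → ZMod q) × (Fin n → ℤ)) => Ψ (Fin.cons p.1.1 p.2.1, (fun c => (p.2.2 c : ℝ) +
        p.1.2.1 c, ∑ c, χ c * ((p.2.2 c : ℝ) - p.1.2.1 c) + p.1.2.2)))
      (f := fun ω : FixSeed q n × VarSeed q l n => (ω.1, (ω.2.1, ω.2.2.2))) (by fun_prop)))]
  have h1 : ∀ a : FixSeed q n, ∫⁻ ξ, Ψ (Fin.cons a.1 ξ.1, (fun c => (ξ.2.2 c : ℝ) + a.2.1 c,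
        ∑ c, χ c * ((ξ.2.2 c : ℝ) - a.2.1 c) + a.2.2)) ∂varLaw q l n σ = _ := fun a =>
    hvar (fun ξ => Ψ (Fin.cons a.1 ξ.1, (fun c => (ξ.2 c : ℝ) + a.2.1 c,
        ∑ c, χ c * ((ξ.2 c : ℝ) - a.2.1 c) + a.2.2)))
  simp_rw [h1]
  unfold fixLaw
  have hcons : ∀ G : (Fin (l + 1) → ZMod q) → ℝ≥0∞, ∫⁻ s, G s ∂unif _ =
      ∫⁻ s₀, ∫⁻ t, G (Fin.cons s₀ t) ∂unif (Fin l → ZMod q) ∂unif (ZMod q) := by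
    intro G
    rw [← unif_pi, lintegral_pi_succ _ (measurable_of_countable _), unif_pi]
  rw [lintegral_prod _ hm.lintegral_prod_right'.aemeasurable, lintegral_prod _ hΨ.aemeasurable,
    hcons, ← lintegral_const_mul _ (measurable_of_countable _)]
  refine lintegral_mono fun s₀ => ?_
  rw [lintegral_lintegral_swap (by
    exact (hm.comp (by fun_prop : Measurable fun p : ((Fin n → ℝ) × ℝ) × ((Fin l → ZMod q) ×
      (Fin n → ℤ)) => ((s₀, p.1), p.2))).aemeasurable),
    lintegral_prod _ (measurable_of_countable _).aemeasurable,
    ← lintegral_const_mul _ (measurable_of_countable _)]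
  refine lintegral_mono fun t => ?_
  have key := lintegral_pi_absorb_le (P := (discreteGaussian σ).prod (gaussV (σ ^ 2)))
    (Q := gaussV (2 * σ ^ 2)) (a := fun p => (p.1 : ℝ) + p.2) (b := fun p => (p.1 : ℝ) - p.2)
    (by fun_prop) (by fun_prop) (K := thetaConst σ) (X := {χ | χ ^ 2 ≤ 1}) (V₀ := 4 * σ ^ 2)
    (W := 2 * σ ^ 2) (by positivity) ?_ χ hχ hV (F := fun p => Ψ (Fin.cons s₀ t, p)) (by fun_prop)
  · rw [lintegral_prod _ (by exact (hΨ.comp (by fun_prop)).aemeasurable)]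
    refine le_trans (le_of_eq ?_) key
    rw [lintegral_pi_prod]
    · refine lintegral_congr fun e => ?_
      rw [lintegral_prod]
      exact (hm.comp (by fun_prop : Measurable fun p : (Fin n → ℝ) × ℝ =>
        ((s₀, p), (t, e)))).aemeasurable
    · exact Measurable.lintegral_prod_right' (f := fun p : (Fin n → ℤ × ℝ) × ℝ =>
        Ψ (Fin.cons s₀ t, (fun c => ((p.1 c).1 : ℝ) + (p.1 c).2,
        ∑ c, χ c * (((p.1 c).1 : ℝ) - (p.1 c).2) + p.2))) (hΨ.comp (by fun_prop))
  · intro B hB χ hχ F hF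
    have hA : 0 < σ ^ 2 := by positivity
    have hB0 : 0 < B := by linarith
    refine (lintegral_discreteGaussian_gaussV_le hσ hB0 χ hF).trans ?_
    gcongr
    -- With `χ² ≤ 1` and `B ≥ 4σ²`, the squared width `σ²B / (2(2χ²σ² + B))` is at least `σ²/3`.
    refine ofReal_theta_le hσ ?_
    have : χ ^ 2 ≤ 1 := hχ
    rw [le_div_iff₀ (by positivity)]
    nlinarith [mul_le_mul_of_nonneg_right this hA.le]

end

/-! ### Sparse secrets over the torus -/

/-- Turns a domination for one row into closeness for m independent rows. -/
lemma near_pi {Ω ρ : Type*} [MeasurableSpace Ω] [MeasurableSpace ρ] {P : Measure Ω} {Q : Measure ρ}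
    [IsProbabilityMeasure P] [IsProbabilityMeasure Q] {τ : Ω → ρ} (hτ : Measurable τ) {K : ℝ≥0∞}
    (hK : 1 ≤ K) (h : ∀ Ψ : ρ → ℝ≥0∞, Measurable Ψ → ∫⁻ ω, Ψ (τ ω) ∂P ≤ K * ∫⁻ p, Ψ p ∂Q) {m : ℕ}
    {F : (Fin m → ρ) → ℝ≥0∞} (hF : Measurable F) (hF1 : ∀ p, F p ≤ 1) :
    Near (K ^ m - 1) (∫⁻ ω, F (fun j => τ (ω j)) ∂(Measure.pi fun _ => P))
      (∫⁻ p, F p ∂(Measure.pi fun _ => Q)) := by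
  have := Measure.isProbabilityMeasure_map (μ := P) hτ.aemeasurable
  have hd : Dom K (P.map τ) Q := fun Ψ hΨ => by rw [lintegral_map hΨ hτ]; exact h Ψ hΨ
  have key := (hd.pi m).near (one_le_pow₀ hK) hF hF1
  rwa [← Measure.pi_map_pi (fun _ => hτ.aemeasurable), lintegral_map hF (by fun_prop)] at key

lemma near_of_abs_toReal {a b : ℝ≥0∞} (ha : a ≤ 1) (hb : b ≤ 1) {δ : ℝ}
    (h : |a.toReal - b.toReal| ≤ δ) : Near (ENNReal.ofReal δ) a b := by
  have ha' : a ≠ ∞ := ne_top_of_le_ne_top ENNReal.one_ne_top ha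
  have hb' : b ≠ ∞ := ne_top_of_le_ne_top ENNReal.one_ne_top hb
  have hδ : 0 ≤ δ := (abs_nonneg _).trans h
  rw [abs_le] at h
  rw [← ENNReal.ofReal_toReal ha', ← ENNReal.ofReal_toReal hb']
  constructor <;> rw [← ENNReal.ofReal_add ENNReal.toReal_nonneg hδ] <;>
    exact ENNReal.ofReal_le_ofReal (by linarith)

lemma toReal_lintegral_unif {α : Type*} [Fintype α] [MeasurableSpace α]
    [MeasurableSingletonClass α] {F : α → ℝ≥0∞} (hF : ∀ a, F a ≠ ∞) :
    (∫⁻ a, F a ∂unif α).toReal = (Fintype.card α : ℝ)⁻¹ * ∑ a, (F a).toReal := by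
  rw [lintegral_unif, ENNReal.toReal_mul, ENNReal.toReal_inv, ENNReal.toReal_natCast,
    ENNReal.toReal_sum fun a _ => hF a]

/-- The row with vector `u` and label `⟨x, u⟩ + h / q` modulo `1`. -/
def secretRow {n : ℕ} (q : ℕ) (x : Fin n → ℤ) (p : Row n) : Row n :=
  (p.1, Int.fract (∑ c, (x c : ℝ) * p.1 c + p.2 / q))

/-- The row with vector `(s C + g) / q` and label `(⟨s, v⟩ + h) / q` modulo `1`. -/
def contRow {q n d : ℕ} (C : Fin n → Fin d → ZMod q) (v : Fin d → ZMod q)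
    (p : (Fin d → ZMod q) × Row n) : Row n :=
  (fun c => Int.fract ((zval (dotp p.1 C c) + p.2.1 c) / q),
    Int.fract ((zval (∑ i, p.1 i * v i) + p.2.2) / q))

lemma measurable_secretRow {n : ℕ} (q : ℕ) (x : Fin n → ℤ) : Measurable (secretRow q x) := by
  unfold secretRow; fun_prop

lemma measurable_contRow {q n d : ℕ} [NeZero q] (C : Fin n → Fin d → ZMod q)
    (v : Fin d → ZMod q) : Measurable (contRow C v) := by
  unfold contRow
  have h : Measurable fun s : Fin d → ZMod q => ∑ i, s i * v i := measurable_of_countable _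
  have h' : Measurable fun s : Fin d → ZMod q => dotp s C := measurable_of_countable _
  have h1 : Measurable fun p : (Fin d → ZMod q) × Row n => ∑ i, p.1 i * v i :=
    h.comp measurable_fst
  have h2 : Measurable fun p : (Fin d → ZMod q) × Row n => dotp p.1 C := h'.comp measurable_fst
  fun_prop

/-- Lattice noise on the vector and on the label, of the two kinds used in the reduction. -/
def sparsePhase {q n : ℕ} (x : Fin n → ℤ) (a : FixSeed q n) : ℝ :=
  (∑ c, (-2 * x c : ℝ) * a.2.1 c + a.2.2) / q

def coordPhase {q n : ℕ} (a : FixSeed q n) : ℝ := (zval a.1 + a.2.2) / q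

lemma measurable_sparsePhase {q n : ℕ} (x : Fin n → ℤ) :
    Measurable (sparsePhase (q := q) x) := by
  unfold sparsePhase; fun_prop

lemma measurable_coordPhase {q n : ℕ} : Measurable (coordPhase (q := q) (n := n)) := by
  unfold coordPhase; fun_prop

section Rows

variable {q l n : ℕ} [NeZero q]

/-- Bilinearity gives ⟨x, sC⟩ = ⟨s, Cx⟩, and the phase `-2⟨x, f⟩` converts `⟨x, e + f⟩` into `⟨x, e
- f⟩`. Reductions modulo 1 of the vector change the label by integers because `x` is integral. -/
lemma lweRow_sparsePhase (x : Fin n → ℤ) (C : Fin n → Fin (l + 1) → ZMod q)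
    (ω : FixSeed q n × VarSeed q l n) :
    lweRow x (sparsePhase x) C ω = contRow C (comb x C) (Fin.cons ω.1.1 ω.2.1,
      (fun c => (ω.2.2.2 c : ℝ) + ω.1.2.1 c,
        ∑ c, (x c : ℝ) * ((ω.2.2.2 c : ℝ) - ω.1.2.1 c) + ω.1.2.2)) := by
  set s : Fin (l + 1) → ZMod q := Fin.cons ω.1.1 ω.2.1 with hs
  have hq : (q : ℝ) ≠ 0 := Nat.cast_ne_zero.mpr (NeZero.ne q)
  have hv : ∀ c, Int.fract ((zval (dotp s C c + (ω.2.2.2 c : ZMod q)) + ω.1.2.1 c) / q) =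
      Int.fract ((zval (dotp s C c) + ((ω.2.2.2 c : ℝ) + ω.1.2.1 c)) / q) := by
    intro c
    rw [fract_zval_congr (b := (dotp s C c).val + ω.2.2.2 c) (by simp), zval_eq]
    push_cast; ring_nf
  have hsum : ((∑ c, x c * ((dotp s C c).val : ℤ) : ℤ) : ZMod q) = ∑ i, s i * comb x C i := by
    push_cast
    simp_rw [ZMod.natCast_zmod_val, dotp, comb, Finset.mul_sum]
    rw [Finset.sum_comm]
    exact Finset.sum_congr rfl fun i _ => Finset.sum_congr rfl fun c _ => by ring
  unfold lweRow genRow contRow sparsePhase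
  simp only [← hs]
  refine Prod.ext (funext hv) ?_
  simp only
  rw [fract_zval_congr hsum.symm, Int.fract_eq_fract]
  refine ⟨- ∑ c, x c * ⌊(zval (dotp s C c) + ((ω.2.2.2 c : ℝ) + ω.1.2.1 c)) / q⌋, ?_⟩
  simp_rw [hv, ← Int.self_sub_floor]
  push_cast
  have e : ∀ c, (x c : ℝ) * ((zval (dotp s C c) + ((ω.2.2.2 c : ℝ) + ω.1.2.1 c)) / q -
      ⌊(zval (dotp s C c) + ((ω.2.2.2 c : ℝ) + ω.1.2.1 c)) / q⌋) + (-2 * x c : ℝ) * ω.1.2.1 c / q -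
        (x c * ((dotp s C c).val : ℝ) / q + x c * ((ω.2.2.2 c : ℝ) - ω.1.2.1 c) / q) =
      -(x c * ⌊(zval (dotp s C c) + ((ω.2.2.2 c : ℝ) + ω.1.2.1 c)) / q⌋) := by
    intro c
    rw [show ((dotp s C c).val : ℝ) = zval (dotp s C c) from rfl]
    field_simp; ring
  have e' := Finset.sum_congr (rfl : (Finset.univ : Finset (Fin n)) = _) fun c _ => e c
  rw [Finset.sum_sub_distrib, Finset.sum_add_distrib, Finset.sum_add_distrib,
    Finset.sum_neg_distrib, ← Finset.sum_div, ← Finset.sum_div, ← Finset.sum_div] at e'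
  rw [← e']
  ring

/-- The zero combination with the revealed coordinate as phase agrees with an LWE label whose vector
is the first unit vector. This is how the second use of LWE connects to the first. -/
lemma lweRow_coordPhase (C : Fin n → Fin (l + 1) → ZMod q) (ω : FixSeed q n × VarSeed q l n) :
    lweRow 0 coordPhase C ω = contRow C (Pi.single 0 1) (Fin.cons ω.1.1 ω.2.1,
      (fun c => (ω.2.2.2 c : ℝ) + ω.1.2.1 c, ω.1.2.2)) := by
  unfold lweRow genRow contRow coordPhase
  refine Prod.ext (funext fun c => ?_) ?_
  · simp only
    rw [fract_zval_congr (b := (dotp (Fin.cons ω.1.1 ω.2.1 : Fin (l + 1) → ZMod q) C c).val +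
      ω.2.2.2 c) (by simp), zval_eq]
    push_cast; ring_nf
  · simp [Pi.single_apply]

/-- An invertible change of the coordinates of the secret. -/
def vecMulEquiv {d : ℕ} {U W : Matrix (Fin d) (Fin d) (ZMod q)} (h : U * W = 1) (h' : W * U = 1) :
    (Fin d → ZMod q) ≃ (Fin d → ZMod q) where
  toFun s := Matrix.vecMul s U
  invFun s := Matrix.vecMul s W
  left_inv s := by simp [h]
  right_inv s := by simp [h']

def mulVecColsEquiv {d : ℕ} {U W : Matrix (Fin d) (Fin d) (ZMod q)} (h : U * W = 1)
    (h' : W * U = 1) : (Fin n → Fin d → ZMod q) ≃ (Fin n → Fin d → ZMod q) where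
  toFun C c := U.mulVec (C c)
  invFun C c := W.mulVec (C c)
  left_inv C := by simp [h']
  right_inv C := by simp [h]

end Rows

/-- An invertible change on `C` and `v` can be moved onto the secret, where it preserves the uniform
law. -/
lemma contRow_mulVec {q n d : ℕ} (U : Matrix (Fin d) (Fin d) (ZMod q)) (C : Fin n → Fin d → ZMod q)
    (v : Fin d → ZMod q) (p : (Fin d → ZMod q) × Row n) :
    contRow (fun c => U.mulVec (C c)) (U.mulVec v) p = contRow C v (Matrix.vecMul p.1 U, p.2) := by
  have h : ∀ w : Fin d → ZMod q, ∑ i, p.1 i * (U.mulVec w) i = ∑ i, (Matrix.vecMul p.1 U) i * w i :=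
    fun w => Matrix.dotProduct_mulVec p.1 U w
  simp only [contRow, dotp, h]

/-! ### The reduction from LWE to sparse secrets over the torus -/

section Torus

variable {q l n m : ℕ} [NeZero q] {σ : ℝ} {F : (Fin m → Row n) → ℝ≥0∞}

/-- Rows with secret `x`: a uniform vector and a label with Gaussian noise. -/
def secretExp (q : ℕ) (σ : ℝ) (V : ℝ) (F : (Fin m → Row n) → ℝ≥0∞) (x : Fin n → ℤ) : ℝ≥0∞ :=
  ∫⁻ p, F (fun j => secretRow q x (p j))
    ∂(Measure.pi fun _ => (Measure.pi fun _ : Fin n => uniformTorus).prod (gaussV (V * σ ^ 2)))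

/-- Rows of LWE samples with continuous noise, where the label is an LWE sample with vector `v`. -/
def contExp (σ : ℝ) (V : ℝ) (F : (Fin m → Row n) → ℝ≥0∞) {d : ℕ} (C : Fin n → Fin d → ZMod q)
    (v : Fin d → ZMod q) : ℝ≥0∞ :=
  ∫⁻ p, F (fun j => contRow C v (p j)) ∂(Measure.pi fun _ => (unif (Fin d → ZMod q)).prod
    ((Measure.pi fun _ : Fin n => gaussV (2 * σ ^ 2)).prod (gaussV (V * σ ^ 2))))

lemma contExp_le_one {V : ℝ} (hF1 : ∀ p, F p ≤ 1) {d : ℕ} (C : Fin n → Fin d → ZMod q)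
    (v : Fin d → ZMod q) : contExp σ V F C v ≤ 1 := lintegral_le_one fun _ => hF1 _

lemma sum_sq_sparse {k : ℕ} {x : Fin n → ℤ} (hx : x ∈ sparseFinset n k) :
    ∑ c, (x c : ℝ) ^ 2 = k := by
  obtain ⟨h1, h2⟩ := mem_sparseFinset.mp hx
  rw [← h2, Finset.card_filter, Nat.cast_sum]
  refine Finset.sum_congr rfl fun c _ => ?_
  rcases h1 c with h | h | h <;> simp [h]

lemma near_unifRow_secretExp (hσ : 0 < σ) (hF : Measurable F) (hF1 : ∀ p, F p ≤ 1) {k : ℕ}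
    (hk : 1 ≤ k) {x : Fin n → ℤ} (hx : x ∈ sparseFinset n k) :
    Near ((thetaConst σ ^ (n + 1)) ^ m - 1)
      (∫⁻ ω, F (fun j => unifRow x (sparsePhase x) (ω j)) ∂(Measure.pi fun _ =>
        (fixLaw q n (σ ^ 2) (5 * k * σ ^ 2)).prod (varLaw q l n σ)))
      (secretExp q σ (9 * k) F x) := by
  have := isProbabilityMeasure_varLaw q l n hσ
  have h1 := one_le_thetaConst hσ
  have hk' : (1 : ℝ) ≤ k := by exact_mod_cast hk
  have hσ2 : 0 < σ ^ 2 := by positivity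
  refine near_pi (τ := fun ω : FixSeed q n × VarSeed q l n => ((fun c => Int.fract
      ((zval (ω.2.2.1 c) + ω.1.2.1 c) / q), ∑ c, (-2 * x c : ℝ) * ω.1.2.1 c + ω.1.2.2) : Row n))
    (F := fun p => F (fun j => secretRow q x (p j))) (by fun_prop) (one_le_pow₀ h1)
    (fun Ψ hΨ => ?_) ?_ (fun _ => hF1 _)
  · refine (lintegral_seed_unif_le (l := l) hσ (V := 5 * k * σ ^ 2) (by nlinarith)
      (fun c => -2 * x c) (fun c => ?_) (hΨ.comp measurable_snd)).trans ?_
    · rcases (mem_sparseFinset.mp hx).1 c with h | h | h <;> norm_num [h]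
    -- The phase `-2⟨x, f⟩` contributes `4kσ²` to the `5kσ²` of the base noise.
    · have hs : (∑ c, (-2 * x c : ℝ) ^ 2) * σ ^ 2 + 5 * k * σ ^ 2 = 9 * k * σ ^ 2 := by
        simp_rw [mul_pow, ← Finset.mul_sum, sum_sq_sparse hx]
        ring
      rw [hs, lintegral_prod _ (hΨ.comp measurable_snd).aemeasurable]
      simp only [Function.comp_apply, lintegral_const, measure_univ, mul_one]
      gcongr
      exact Nat.le_succ n
  · have := measurable_secretRow q x
    fun_prop

/-- The decoupled label noise has squared width `2kσ² + 5kσ² = 7kσ²`, which is independent of `x`;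
after this step `x` enters only through `comb x C`. -/
lemma near_lweRow_contExp (hσ : 0 < σ) (hF : Measurable F) (hF1 : ∀ p, F p ≤ 1) {k : ℕ}
    (hk : 1 ≤ k) {x : Fin n → ℤ} (hx : x ∈ sparseFinset n k) (C : Fin n → Fin (l + 1) → ZMod q) :
    Near ((thetaConst σ ^ (n + 1)) ^ m - 1)
      (∫⁻ ω, F (fun j => lweRow x (sparsePhase x) C (ω j)) ∂(Measure.pi fun _ =>
        (fixLaw q n (σ ^ 2) (5 * k * σ ^ 2)).prod (varLaw q l n σ)))
      (contExp σ (7 * k) F C (comb x C)) := by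
  have := isProbabilityMeasure_varLaw q l n hσ
  have h1 := one_le_thetaConst hσ
  have hk' : (1 : ℝ) ≤ k := by exact_mod_cast hk
  have hσ2 : 0 < σ ^ 2 := by positivity
  have hcast : Measurable (fun z : ℤ => (z : ℝ)) := fun _ _ => trivial
  simp_rw [lweRow_sparsePhase]
  refine near_pi (τ := fun ω : FixSeed q n × VarSeed q l n => ((Fin.cons ω.1.1 ω.2.1,
      (fun c => (ω.2.2.2 c : ℝ) + ω.1.2.1 c,
        ∑ c, (x c : ℝ) * ((ω.2.2.2 c : ℝ) - ω.1.2.1 c) + ω.1.2.2)) :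
        (Fin (l + 1) → ZMod q) × Row n))
    (F := fun p => F (fun j => contRow C (comb x C) (p j))) ?_ (one_le_pow₀ h1)
    (fun Ψ hΨ => ?_) ?_ (fun _ => hF1 _)
  · refine Measurable.prodMk ?_ (by fun_prop)
    exact measurable_finCons.comp (by fun_prop : Measurable fun p : FixSeed q n × VarSeed q l n =>
      (p.1.1, p.2.1))
  · refine (lintegral_seed_lwe_le (l := l) hσ (V := 5 * k * σ ^ 2) (by nlinarith)
      (fun c => (x c : ℝ)) (fun c => ?_) hΨ).trans ?_
    · rcases (mem_sparseFinset.mp hx).1 c with h | h | h <;> norm_num [h]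
    · rw [sum_sq_sparse hx, show k * (2 * σ ^ 2) + 5 * k * σ ^ 2 = 7 * k * σ ^ 2 by ring]
      gcongr
      exact Nat.le_succ n
  · have := measurable_contRow C (comb x C)
    fun_prop

/-- With zero coefficients no coordinate feeds the label, so the base noise is taken to be `7kσ²`
from the start to match the sparse side. -/
lemma near_lweRow_coord_contExp (hσ : 0 < σ) (hF : Measurable F) (hF1 : ∀ p, F p ≤ 1) {k : ℕ}
    (hk : 1 ≤ k) (C : Fin n → Fin (l + 1) → ZMod q) :
    Near ((thetaConst σ ^ (n + 1)) ^ m - 1)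
      (∫⁻ ω, F (fun j => lweRow 0 coordPhase C (ω j)) ∂(Measure.pi fun _ =>
        (fixLaw q n (σ ^ 2) (7 * k * σ ^ 2)).prod (varLaw q l n σ)))
      (contExp σ (7 * k) F C (Pi.single 0 1)) := by
  have := isProbabilityMeasure_varLaw q l n hσ
  have h1 := one_le_thetaConst hσ
  have hk' : (1 : ℝ) ≤ k := by exact_mod_cast hk
  have hσ2 : 0 < σ ^ 2 := by positivity
  have hcast : Measurable (fun z : ℤ => (z : ℝ)) := fun _ _ => trivial
  simp_rw [lweRow_coordPhase]
  refine near_pi (τ := fun ω : FixSeed q n × VarSeed q l n => ((Fin.cons ω.1.1 ω.2.1,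
      (fun c => (ω.2.2.2 c : ℝ) + ω.1.2.1 c, ω.1.2.2)) : (Fin (l + 1) → ZMod q) × Row n))
    (F := fun p => F (fun j => contRow C (Pi.single 0 1) (p j))) ?_ (one_le_pow₀ h1)
    (fun Ψ hΨ => ?_) ?_ (fun _ => hF1 _)
  · refine Measurable.prodMk ?_ (by fun_prop)
    exact measurable_finCons.comp (by fun_prop : Measurable fun p : FixSeed q n × VarSeed q l n =>
      (p.1.1, p.2.1))
  · have key := lintegral_seed_lwe_le (l := l) hσ (V := 7 * k * σ ^ 2) (by nlinarith)
      (fun _ : Fin n => 0) (fun c => by norm_num) hΨ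
    simp only [zero_mul, Finset.sum_const_zero, zero_add, ne_eq, OfNat.ofNat_ne_zero,
      not_false_eq_true, zero_pow] at key
    refine key.trans ?_
    gcongr
    exact Nat.le_succ n
  · have := measurable_contRow C (Pi.single 0 1)
    fun_prop

/-- The vector is smoothed by the n coordinate noises, and the label by the uniform revealed
coordinate plus Gaussian noise. The label costs one more theta factor, whence the exponent `n + 1`.
-/
lemma near_unifRow_coord (hσ : 0 < σ) (hF : Measurable F) (hF1 : ∀ p, F p ≤ 1) {k : ℕ}
    (hk : 1 ≤ k) :
    Near ((thetaConst σ ^ (n + 1)) ^ m - 1)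
      (∫⁻ ω, F (fun j => unifRow 0 coordPhase (ω j)) ∂(Measure.pi fun _ =>
        (fixLaw q n (σ ^ 2) (7 * k * σ ^ 2)).prod (varLaw q l n σ)))
      (∫⁻ p, F p ∂(Measure.pi fun _ =>
        (Measure.pi fun _ : Fin n => uniformTorus).prod uniformTorus)) := by
  have := isProbabilityMeasure_varLaw q l n hσ
  have h1 := one_le_thetaConst hσ
  have hk' : (1 : ℝ) ≤ k := by exact_mod_cast hk
  have hσ2 : 0 < σ ^ 2 := by positivity
  have hV : 0 < 7 * k * σ ^ 2 := by positivity
  refine near_pi (τ := unifRow 0 coordPhase) (measurable_unifRow _ measurable_coordPhase)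
    (one_le_pow₀ h1) (fun Ψ hΨ => ?_) hF hF1
  have key := lintegral_seed_unif_le (l := l) hσ (V := 7 * k * σ ^ 2) (by nlinarith)
      (fun _ : Fin n => 0) (fun c => by norm_num)
      (Ψ := fun p : ZMod q × Row n => Ψ (p.2.1, Int.fract ((zval p.1 + p.2.2) / q)))
      (by fun_prop)
  simp only [zero_mul, Finset.sum_const_zero, zero_add, ne_eq, OfNat.ofNat_ne_zero,
    not_false_eq_true, zero_pow] at key
  refine (le_of_eq (lintegral_congr fun ω => ?_)).trans (key.trans ?_)
  · simp [unifRow, genRow, coordPhase]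
  · have hm : Measurable fun p : ((ZMod q) × ((Fin n → ℝ) × ℝ)) =>
        Ψ (p.2.1, Int.fract ((zval p.1 + p.2.2) / q)) := by fun_prop
    have hm2 : Measurable fun p : ((Fin n → ℝ) × (ZMod q × ℝ)) =>
        Ψ (p.1, Int.fract ((zval p.2.1 + p.2.2) / q)) := by fun_prop
    have hm3 : Measurable fun p : ((ZMod q × (Fin n → ℝ)) × ℝ) =>
        Ψ (p.1.2, Int.fract ((zval p.1.1 + p.2) / q)) := by fun_prop
    rw [pow_succ (thetaConst σ) n, mul_assoc (thetaConst σ ^ n)]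
    gcongr
    rw [lintegral_prod _ hm.aemeasurable, lintegral_prod _ hΨ.aemeasurable,
      ← lintegral_const_mul _ hΨ.lintegral_prod_right']
    have e : ∀ s₀ : ZMod q, ∫⁻ p, Ψ (p.1, Int.fract ((zval s₀ + p.2) / q))
        ∂((Measure.pi fun _ : Fin n => uniformTorus).prod (gaussV (7 * k * σ ^ 2))) =
        ∫⁻ u, ∫⁻ h, Ψ (u, Int.fract ((zval s₀ + h) / q)) ∂gaussV (7 * k * σ ^ 2)
          ∂(Measure.pi fun _ => uniformTorus) := fun s₀ =>
      lintegral_prod _ (by exact (hΨ.comp (by fun_prop)).aemeasurable)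
    simp_rw [e]
    rw [lintegral_lintegral_swap (by exact hm3.lintegral_prod_right'.aemeasurable)]
    refine lintegral_mono fun u => ?_
    rw [lintegral_lintegral_swap (by exact (hΨ.comp (by fun_prop)).aemeasurable),
      lintegral_gaussV hV (Measurable.lintegral_prod_right' (f := fun p : ℝ × ZMod q =>
        Ψ (u, Int.fract ((zval p.2 + p.1) / q))) (by fun_prop))]
    refine (lintegral_unif_fract_le (by fun_prop) (G := fun b => Ψ (u, b)) (by fun_prop)
      (fun φ => tsum_ofReal_gaussDensity_le hV φ)).trans ?_
    gcongr
    exact ofReal_theta_le hσ (by nlinarith)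

lemma near_contExp_comb (hF1 : ∀ p, F p ≤ 1) {k : ℕ} (hk : k ≤ n) (V : ℝ) :
    Near (ENNReal.ofReal (Real.sqrt ((q : ℝ) ^ (l + 1) / n.choose k)))
      (∫⁻ x : sparseFinset n k, ∫⁻ C : Fin n → Fin (l + 1) → ZMod q,
        contExp σ V F C (comb x C) ∂unif _ ∂unif _)
      (∫⁻ C : Fin n → Fin (l + 1) → ZMod q, ∫⁻ v, contExp σ V F C v ∂unif _ ∂unif _) := by
  have : Nonempty (sparseFinset n k) := (sparseFinset_nonempty hk).to_subtype
  have hfin : ∀ {a : ℝ≥0∞}, a ≤ 1 → a ≠ ∞ := fun h => ne_top_of_le_ne_top ENNReal.one_ne_top h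
  have hle := fun C v => contExp_le_one (σ := σ) (q := q) (V := V) hF1 (d := l + 1) C v
  refine near_of_abs_toReal (lintegral_le_one fun x => lintegral_le_one fun C => hle _ _)
    (lintegral_le_one fun x => lintegral_le_one fun C => hle _ _) ?_
  have key := leftover_hash_sparse (q := q) hk (fun C v => (contExp σ V F (d := l + 1) C v).toReal)
    (fun _ _ => ENNReal.toReal_nonneg) (fun C v => by
      simpa using ENNReal.toReal_mono ENNReal.one_ne_top (hle C v))
  rw [toReal_lintegral_unif fun x => hfin (lintegral_le_one fun C => hle _ _),
    toReal_lintegral_unif fun x => hfin (lintegral_le_one fun C => hle _ _)]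
  simp_rw [toReal_lintegral_unif fun _ => hfin (hle _ _)]
  rw [Finset.sum_coe_sort (sparseFinset n k) (fun x => (Fintype.card (Fin n → Fin (l + 1) →
    ZMod q) : ℝ)⁻¹ * ∑ C, (contExp σ V F C (comb x C)).toReal), Fintype.card_coe]
  exact key

/-- Change of variables `s ↦ s U` in every row. -/
lemma contExp_mulVec (hF : Measurable F) (V : ℝ) {d : ℕ} {U W : Matrix (Fin d) (Fin d) (ZMod q)}
    (h : U * W = 1) (h' : W * U = 1) (C : Fin n → Fin d → ZMod q) (v : Fin d → ZMod q) :
    contExp σ V F (mulVecColsEquiv h h' C) (U.mulVec v) = contExp σ V F C v := by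
  have hmp : MeasurePreserving (vecMulEquiv h h') (unif (Fin d → ZMod q)) (unif _) := by
    refine ⟨measurable_of_countable _, Measure.ext_of_lintegral _ fun G hG => ?_⟩
    rw [lintegral_map hG (measurable_of_countable _)]
    exact lintegral_unif_equiv _ _
  have hmp2 := hmp.prod (MeasurePreserving.id ((Measure.pi fun _ : Fin n =>
    gaussV (2 * σ ^ 2)).prod (gaussV (V * σ ^ 2))))
  have hmp3 := measurePreserving_pi (fun _ : Fin m => _) (fun _ => _) fun _ => hmp2
  have hc := measurable_contRow C v
  unfold contExp
  rw [← hmp3.lintegral_comp (f := fun p => F (fun j => contRow C v (p j))) (by fun_prop)]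
  refine lintegral_congr fun p => congrArg F (funext fun j => ?_)
  exact contRow_mulVec U C v (p j)

/-- For a completable `v`, an invertible change of `C` carries `v` to the first unit vector and
leaves the average over `C` unchanged. The remaining `v` are charged their total probability. -/
lemma near_contExp_single (hF : Measurable F) (hF1 : ∀ p, F p ≤ 1) (V : ℝ) :
    Near (ENNReal.ofReal (Real.log q / 2 ^ l))
      (∫⁻ C : Fin n → Fin (l + 1) → ZMod q, ∫⁻ v, contExp σ V F C v ∂unif _ ∂unif _)
      (∫⁻ C : Fin n → Fin (l + 1) → ZMod q, contExp σ V F C (Pi.single 0 1) ∂unif _) := by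
  classical
  set E := ∫⁻ C : Fin n → Fin (l + 1) → ZMod q, contExp σ V F C (Pi.single 0 1) ∂unif _ with hE
  have hE1 : E ≤ 1 := lintegral_le_one fun C => contExp_le_one hF1 _ _
  rw [lintegral_lintegral_swap (measurable_of_countable _).aemeasurable]
  have hv : ∀ v : Fin (l + 1) → ZMod q, Near (if Completable v then 0 else 1)
      (∫⁻ C : Fin n → Fin (l + 1) → ZMod q, contExp σ V F C v ∂unif _) E := by
    intro v
    split_ifs with h
    · obtain ⟨U, W, h1, h2, h3⟩ := h
      have : ∫⁻ C : Fin n → Fin (l + 1) → ZMod q, contExp σ V F C v ∂unif _ = E := by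
        rw [hE, ← lintegral_unif_equiv (mulVecColsEquiv h1 h2)
          (fun C => contExp σ V F C (Pi.single 0 1))]
        exact lintegral_congr fun C => by rw [← h3, contExp_mulVec hF]
      rw [this]
      exact Near.refl _
    · exact ⟨(lintegral_le_one fun C => contExp_le_one hF1 _ _).trans le_add_self,
        hE1.trans le_add_self⟩
  have hbad : ∫⁻ v : Fin (l + 1) → ZMod q, (if Completable v then 0 else 1) ∂unif _ ≤
      ENNReal.ofReal (Real.log q / 2 ^ l) := by
    rw [lintegral_unif, mul_comm, ← div_eq_mul_inv]
    refine ENNReal.div_le_of_le_mul ?_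
    have := card_not_completable_le (q := q) (d := l)
    rw [mul_comm] at this
    have h := ENNReal.ofReal_le_ofReal this
    rw [ENNReal.ofReal_natCast, ENNReal.ofReal_mul (by positivity), ENNReal.ofReal_natCast] at h
    refine le_trans (le_of_eq ?_) h
    rw [Finset.card_filter, Nat.cast_sum]
    refine Finset.sum_congr rfl fun v _ => ?_
    by_cases hc : Completable v <;> simp [hc]
  have hE' : E = ∫⁻ _ : Fin (l + 1) → ZMod q, E ∂unif _ := by simp
  constructor
  · calc _ ≤ ∫⁻ v : Fin (l + 1) → ZMod q, (E + if Completable v then 0 else 1) ∂unif _ :=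
          lintegral_mono fun v => (hv v).1
      _ = E + _ := by rw [lintegral_add_left measurable_const, ← hE']
      _ ≤ _ := by gcongr
  · calc E = ∫⁻ _ : Fin (l + 1) → ZMod q, E ∂unif _ := hE'
      _ ≤ ∫⁻ v : Fin (l + 1) → ZMod q, ((∫⁻ C : Fin n → Fin (l + 1) → ZMod q,
          contExp σ V F C v ∂unif _) + if Completable v then 0 else 1) ∂unif _ :=
          lintegral_mono fun v => (hv v).2
      _ = _ + _ := lintegral_add_left (measurable_of_countable _) _
      _ ≤ _ := by gcongr

/-- The reduction from LWE to sparse secrets over the torus. -/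
theorem near_secretExp {k : ℕ} {ε : ℝ≥0∞} (hσ : 0 < σ) (hF : Measurable F) (hF1 : ∀ p, F p ≤ 1)
    (hclose : LWEClose q l σ F ε) (hk : 1 ≤ k) (hkn : k ≤ n) :
    Near (2 * m * ε + (4 * ((thetaConst σ ^ (n + 1)) ^ m - 1) +
        ENNReal.ofReal (Real.sqrt ((q : ℝ) ^ (l + 1) / n.choose k)) +
        ENNReal.ofReal (Real.log q / 2 ^ l)))
      (∫⁻ x : sparseFinset n k, secretExp q σ (9 * k) F x ∂unif _)
      (∫⁻ p, F p ∂(Measure.pi fun _ =>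
        (Measure.pi fun _ : Fin n => uniformTorus).prod uniformTorus)) := by
  have : Nonempty (sparseFinset n k) := (sparseFinset_nonempty hkn).to_subtype
  have := isProbabilityMeasure_varLaw q l n hσ
  set δ := (thetaConst σ ^ (n + 1)) ^ m - 1
  -- For a fixed `x`: smooth the uniform rows, apply LWE in the row vectors, smooth the LWE rows.
  -- This and the coordinate branch below each cost `m * ε + 2δ`.
  have hA : ∀ x : sparseFinset n k, Near (δ + m * ε + δ) (secretExp q σ (9 * k) F x)
      (∫⁻ C : Fin n → Fin (l + 1) → ZMod q, contExp σ (7 * k) F C (comb x C) ∂unif _) := by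
    intro x
    have h1 := (near_unifRow_secretExp (q := q) (l := l) hσ hF hF1 hk x.2).symm
    have h2 := near_lweRow_unifRow hσ (A := σ ^ 2) (V := 5 * k * σ ^ 2) hF hclose
      (mem_sparseFinset.mp x.2).1 (measurable_sparsePhase (q := q) x)
    rw [lintegral_const, measure_univ, mul_one] at h2
    have h3 := Near.lintegral (μ := unif (Fin n → Fin (l + 1) → ZMod q)) fun C =>
      near_lweRow_contExp hσ hF hF1 hk x.2 C
    exact (h1.trans h2.symm).trans h3
  have hB := Near.lintegral (μ := unif (Fin n → Fin (l + 1) → ZMod q)) fun C =>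
    (near_lweRow_coord_contExp hσ hF hF1 hk C).symm
  have hC := near_lweRow_unifRow hσ (A := σ ^ 2) (V := 7 * k * σ ^ 2) hF hclose
      (x := 0) (fun _ => Or.inr (Or.inl rfl)) measurable_coordPhase
  rw [lintegral_const, measure_univ, mul_one] at hC
  have hD := near_unifRow_coord (q := q) (l := l) (m := m) (n := n) hσ hF hF1 hk
  have := ((((Near.lintegral (μ := unif (sparseFinset n k)) hA).trans
    (near_contExp_comb hF1 hkn _)).trans (near_contExp_single hF hF1 _)).trans
    hB).trans (hC.trans hD)
  refine this.mono (le_of_eq ?_)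
  ring

end Torus

/-! ### Lifting the torus to Gaussian vectors -/

/-- The mass of the coset `ℤ + y`. -/
def cosetMass (V y : ℝ) : ℝ := ∑' z : ℤ, gaussDensity V (z + y)

/-- The mass of the part of the coset `ℤ + y` up to `y`. -/
def lowerMass (V y : ℝ) : ℝ := ∑' z : ℤ, if z ≤ 0 then gaussDensity V (z + y) else 0

section Mass

variable {V : ℝ}

lemma gaussDensity_pos (hV : 0 < V) (x : ℝ) : 0 < gaussDensity V x := by
  unfold gaussDensity; positivity

lemma summable_lowerMass (hV : 0 < V) (y : ℝ) :
    Summable fun z : ℤ => if z ≤ 0 then gaussDensity V (z + y) else 0 :=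
  Summable.of_nonneg_of_le (fun z => by split_ifs <;> simp [gaussDensity_nonneg])
    (fun z => by split_ifs <;> simp [gaussDensity_nonneg]) (summable_gaussDensity hV y)

lemma cosetMass_pos (hV : 0 < V) (y : ℝ) : 0 < cosetMass V y :=
  (summable_gaussDensity hV y).tsum_pos (fun _ => gaussDensity_nonneg _ _) 0 (gaussDensity_pos hV _)

lemma cosetMass_sub_one (y : ℝ) : cosetMass V (y - 1) = cosetMass V y := by
  unfold cosetMass
  rw [← (Equiv.addRight (1 : ℤ)).tsum_eq]
  refine tsum_congr fun z => ?_
  simp only [Equiv.coe_addRight]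
  push_cast; ring_nf

lemma cosetMass_add_intCast (y : ℝ) (n : ℤ) : cosetMass V (n + y) = cosetMass V y := by
  unfold cosetMass
  rw [← (Equiv.addRight n).tsum_eq fun z : ℤ => gaussDensity V (z + y)]
  refine tsum_congr fun z => ?_
  simp only [Equiv.coe_addRight]
  push_cast; ring_nf

/-- Moving down by one removes exactly the point `y` from the lower part of the coset. The increment
over a unit interval is therefore the desired point mass. -/
lemma lowerMass_sub_one (hV : 0 < V) (y : ℝ) :
    lowerMass V (y - 1) = lowerMass V y - gaussDensity V y := by
  have h1 : lowerMass V (y - 1) = ∑' z : ℤ, if z ≤ -1 then gaussDensity V (z + y) else 0 := by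
    unfold lowerMass
    rw [← (Equiv.addRight (1 : ℤ)).tsum_eq]
    refine tsum_congr fun z => ?_
    simp only [Equiv.coe_addRight]
    have : z + 1 ≤ 0 ↔ z ≤ -1 := by omega
    simp only [this]
    push_cast; ring_nf
  have h2 := (summable_lowerMass hV y).tsum_eq_add_tsum_ite 0
  rw [h1, lowerMass, h2]
  simp only [le_refl, if_true, Int.cast_zero, zero_add, add_sub_cancel_left]
  refine tsum_congr fun z => ?_
  by_cases h : z = 0
  · simp [h]
  · have : z ≤ -1 ↔ z ≤ 0 := by omega
    simp [h, this]

/-- Total positivity of order two: the exponents differ by a multiple of (j - i)(y' - y). -/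
lemma gaussDensity_mul_le (hV : 0 < V) {i j y y' : ℝ} (hij : i ≤ j) (hy : y ≤ y') :
    gaussDensity V (i + y) * gaussDensity V (j + y') ≤
      gaussDensity V (i + y') * gaussDensity V (j + y) := by
  unfold gaussDensity
  rw [div_mul_div_comm, div_mul_div_comm, ← Real.exp_add, ← Real.exp_add]
  gcongr ?_ / _
  rw [Real.exp_le_exp, ← add_div, ← add_div]
  gcongr ?_ / _
  have h := mul_nonneg (mul_nonneg Real.pi_pos.le (sub_nonneg.mpr hij)) (sub_nonneg.mpr hy)
  nlinarith

/-- The common product of lower masses cancels, leaving sums over pairs `i ≤ 0 < j`, which are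
compared term by term. This is the monotonicity that makes the normalized lower mass a distribution
function. -/
lemma lowerMass_mul_le (hV : 0 < V) {y y' : ℝ} (hy : y ≤ y') :
    lowerMass V y * cosetMass V y' ≤ lowerMass V y' * cosetMass V y := by
  have hup : ∀ y, cosetMass V y - lowerMass V y =
      ∑' z : ℤ, if z ≤ 0 then 0 else gaussDensity V (z + y) := by
    intro y
    rw [cosetMass, lowerMass,
      ← (summable_gaussDensity hV y).tsum_sub (summable_lowerMass hV y)]
    refine tsum_congr fun z => ?_
    split_ifs <;> simp
  have hsum : ∀ y, Summable fun z : ℤ => if z ≤ 0 then 0 else gaussDensity V (z + y) := fun y =>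
    Summable.of_nonneg_of_le (fun z => by split_ifs <;> simp [gaussDensity_nonneg])
      (fun z => by split_ifs <;> simp [gaussDensity_nonneg]) (summable_gaussDensity hV y)
  have hj : ∀ j : ℤ, lowerMass V y * (if j ≤ 0 then 0 else gaussDensity V (j + y')) ≤
      lowerMass V y' * (if j ≤ 0 then 0 else gaussDensity V (j + y)) := by
    intro j
    split_ifs with h
    · simp
    · rw [lowerMass, lowerMass, ← tsum_mul_right, ← tsum_mul_right]
      refine ((summable_lowerMass hV y).mul_right _).tsum_le_tsum (fun i => ?_)
        ((summable_lowerMass hV y').mul_right _)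
      split_ifs with hi
      · exact gaussDensity_mul_le hV (by exact_mod_cast hi.trans (by omega)) hy
      · simp
  have key : lowerMass V y * (cosetMass V y' - lowerMass V y') ≤
      lowerMass V y' * (cosetMass V y - lowerMass V y) := by
    rw [hup, hup, ← tsum_mul_left, ← tsum_mul_left]
    exact ((hsum _).mul_left _).tsum_le_tsum hj ((hsum _).mul_left _)
  linarith

lemma continuous_tsum_gaussDensity (hV : 0 < V) (w : ℤ → ℝ) (h0 : ∀ z, 0 ≤ w z)
    (h1 : ∀ z, w z ≤ 1) : Continuous fun y : ℝ => ∑' z : ℤ, w z * gaussDensity V (z + y) := by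
  rw [continuous_iff_continuousAt]
  intro y₀
  have hs := (summable_theta (V := (2 * V)⁻¹) (by positivity)).mul_left
    (Real.exp (Real.pi * (|y₀| + 1) ^ 2 / V) / Real.sqrt V)
  have hc : ContinuousOn (fun y : ℝ => ∑' z : ℤ, w z * gaussDensity V (z + y))
      (Metric.ball y₀ 1) := by
    refine continuousOn_tsum (fun z => ?_) hs fun z y hy => ?_
    · unfold gaussDensity; fun_prop
    · rw [Real.norm_of_nonneg (mul_nonneg (h0 z) (gaussDensity_nonneg _ _))]
      refine (mul_le_of_le_one_left (gaussDensity_nonneg _ _) (h1 z)).trans ?_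
      refine (gaussDensity_add_le hV z y).trans ?_
      have hy' : |y| ≤ |y₀| + 1 := by
        have h2 := abs_sub_abs_le_abs_sub y y₀
        rw [Metric.mem_ball, Real.dist_eq] at hy
        linarith
      have : y ^ 2 ≤ (|y₀| + 1) ^ 2 := by rw [← sq_abs]; gcongr
      have hp := Real.pi_pos
      gcongr
  exact hc.continuousAt (Metric.ball_mem_nhds _ one_pos)

end Mass

/-- The conditional distribution function of the coset sampler. -/
def liftStieltjes {V : ℝ} (hV : 0 < V) : StieltjesFunction ℝ where
  toFun y := lowerMass V y / cosetMass V y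
  mono' y y' hy := by
    rw [div_le_div_iff₀ (cosetMass_pos hV _) (cosetMass_pos hV _)]
    exact lowerMass_mul_le hV hy
  right_continuous' y := by
    have h1 : Continuous (lowerMass V) := by
      have := continuous_tsum_gaussDensity hV (fun z => if z ≤ 0 then 1 else 0)
        (fun z => by split_ifs <;> simp) (fun z => by split_ifs <;> simp)
      simp only [ite_mul, one_mul, zero_mul] at this
      exact this
    have h2 : Continuous (cosetMass V) := by
      have := continuous_tsum_gaussDensity hV (fun _ => 1) (by simp) (by simp)
      simp only [one_mul] at this
      exact this
    exact (h1.div h2 fun y => (cosetMass_pos hV y).ne').continuousWithinAt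

/-- The element of the coset `ℤ + u` in `[Y, Y + 1)`. -/
def lift (Y u : ℝ) : ℝ := Y + Int.fract (u - Y)

lemma lift_eq (Y u : ℝ) (z : ℤ) (h : Y ∈ Set.Ioc ((z : ℝ) + u - 1) (z + u)) : lift Y u = z + u := by
  have : Int.fract (u - Y) = z + u - Y := by
    rw [Int.fract_eq_iff]
    exact ⟨by linarith [h.2], by linarith [h.1], -z, by push_cast; ring⟩
  rw [lift, this]; ring

lemma measurable_lift : Measurable fun p : ℝ × ℝ => lift p.1 p.2 := by unfold lift; fun_prop

/-- The distribution of the random shift in the coset sampler. -/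
def liftLaw {V : ℝ} (hV : 0 < V) : Measure ℝ := (liftStieltjes hV).measure

section Lift

variable {V : ℝ} (hV : 0 < V)

lemma liftLaw_Ioc (y : ℝ) : liftLaw hV (Set.Ioc (y - 1) y) =
    ENNReal.ofReal (gaussDensity V y / cosetMass V y) := by
  rw [liftLaw, StieltjesFunction.measure_Ioc]
  congr 1
  change lowerMass V y / cosetMass V y - lowerMass V (y - 1) / cosetMass V (y - 1) = _
  rw [cosetMass_sub_one, lowerMass_sub_one hV]
  ring

/-- The lift equals `z + u` exactly when `Y` lies in `(z + u - 1, z + u]`, and these intervals tile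
the line. Thus one law of `Y` samples correctly from every coset. -/
lemma lintegral_liftLaw (u : ℝ) {F : ℝ → ℝ≥0∞} : ∫⁻ Y, F (lift Y u) ∂liftLaw hV =
    ∑' z : ℤ, ENNReal.ofReal (gaussDensity V (z + u) / cosetMass V u) * F (z + u) := by
  have hU : (⋃ z : ℤ, Set.Ioc ((z : ℝ) + u - 1) (z + u)) = Set.univ := by
    rw [← iUnion_Ioc_add_intCast (u - 1)]
    refine Set.iUnion_congr fun z => ?_
    congr 1 <;> ring
  have hd : Pairwise (Function.onFun Disjoint fun z : ℤ => Set.Ioc ((z : ℝ) + u - 1) (z + u)) := by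
    have e : (fun z : ℤ => Set.Ioc ((z : ℝ) + u - 1) (z + u)) =
        fun z : ℤ => Set.Ioc (u - 1 + (z : ℝ)) (u - 1 + z + 1) := by
      funext z; congr 1 <;> ring
    rw [e]
    exact Set.pairwise_disjoint_Ioc_add_intCast (u - 1)
  rw [← setLIntegral_univ, ← hU, lintegral_iUnion (fun _ => measurableSet_Ioc) hd]
  refine tsum_congr fun z => ?_
  rw [setLIntegral_congr_fun (g := fun _ => F (z + u)) measurableSet_Ioc
    fun Y hY => by rw [lift_eq Y u z hY], setLIntegral_const, liftLaw_Ioc, cosetMass_add_intCast,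
    mul_comm]

instance : IsProbabilityMeasure (liftLaw hV) := by
  constructor
  have h := lintegral_liftLaw hV 0 (F := fun _ => 1)
  rw [lintegral_const, one_mul] at h
  rw [h]
  have h0 := cosetMass_pos hV 0
  simp only [mul_one]
  rw [← ENNReal.ofReal_tsum_of_nonneg (fun z => div_nonneg (gaussDensity_nonneg _ _) h0.le)
    ((summable_gaussDensity hV 0).div_const _), tsum_div_const]
  rw [← cosetMass, div_self h0.ne', ENNReal.ofReal_one]

/-- The true mass of each coset is at most `theta V`, so replacing it by the uniform weight on [0,1)
costs only that factor. -/
lemma lintegral_gaussV_le_lift {F : ℝ → ℝ≥0∞} (hF : Measurable F) :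
    ∫⁻ x, F x ∂gaussV V ≤
      ENNReal.ofReal (theta V) * ∫⁻ u, ∫⁻ Y, F (lift Y u) ∂liftLaw hV ∂uniformTorus := by
  rw [lintegral_gaussV hV hF, lintegral_eq_lintegral_tsum (by fun_prop)]
  have hm : Measurable fun u => ∫⁻ Y, F (lift Y u) ∂liftLaw hV :=
    Measurable.lintegral_prod_right' (f := fun p : ℝ × ℝ => F (lift p.2 p.1))
      (hF.comp (measurable_lift.comp measurable_swap))
  rw [← lintegral_const_mul _ hm]
  refine lintegral_mono fun u => ?_
  simp only
  rw [lintegral_liftLaw, ← ENNReal.tsum_mul_left]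
  refine ENNReal.tsum_le_tsum fun z => ?_
  rw [← mul_assoc, ← ENNReal.ofReal_mul (by linarith [one_le_theta hV])]
  gcongr
  rw [← mul_div_assoc, le_div_iff₀ (cosetMass_pos hV u), mul_comm]
  gcongr
  · exact gaussDensity_nonneg _ _
  · exact tsum_gaussDensity_le hV u

end Lift

/-! ### Rows with a Gaussian vector -/

/-- Lift the vector of a row, with the shifts `Y`, and scale it by `1 / r`. -/
def liftRow {n : ℕ} (r : ℝ) (Y : Fin n → ℝ) (p : Row n) : Row n :=
  (fun c => lift (Y c) (p.1 c) / r, p.2)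

/-- The row with vector `a` and label `r ⟨x, a⟩ + h / q` modulo `1`. -/
def clweRow {n : ℕ} (q : ℕ) (r : ℝ) (x : Fin n → ℤ) (p : Row n) : Row n :=
  (p.1, Int.fract (∑ c, (x c : ℝ) * (r * p.1 c) + p.2 / q))

/-- Lifting moves each coordinate by an integer and `x` is integral, so forming the label commutes
with lifting; the lift can be applied after the secret is hidden. -/
lemma clweRow_liftRow {n q : ℕ} {r : ℝ} (hr : r ≠ 0) (x : Fin n → ℤ) (Y : Fin n → ℝ) (p : Row n) :
    clweRow q r x (liftRow r Y p) = liftRow r Y (secretRow q x p) := by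
  refine Prod.ext rfl ?_
  simp only [clweRow, liftRow, secretRow, mul_div_cancel₀ _ hr]
  rw [Int.fract_eq_fract]
  refine ⟨-∑ c, x c * ⌊p.1 c - Y c⌋, ?_⟩
  push_cast
  rw [add_sub_add_right_eq_sub, ← Finset.sum_sub_distrib, ← Finset.sum_neg_distrib]
  refine Finset.sum_congr rfl fun c _ => ?_
  rw [lift, ← Int.self_sub_floor]
  ring

lemma measurable_liftRow {n : ℕ} (r : ℝ) :
    Measurable fun p : Row n × (Fin n → ℝ) => liftRow r p.2 p.1 := by
  unfold liftRow lift
  fun_prop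

lemma measurable_clweRow {n : ℕ} (q : ℕ) (r : ℝ) (x : Fin n → ℤ) : Measurable (clweRow q r x) := by
  unfold clweRow; fun_prop

section RowLift

variable {r : ℝ} (hr : 0 < r) {n m : ℕ}

lemma lintegral_gaussV_one_le {F : ℝ → ℝ≥0∞} (hF : Measurable F) :
    ∫⁻ a, F a ∂gaussV 1 ≤ ENNReal.ofReal (theta (r ^ 2)) *
      ∫⁻ p, F (lift p.2 p.1 / r) ∂(uniformTorus.prod (liftLaw (pow_pos hr 2))) := by
  have h1 : gaussV (r ^ 2) = (gaussV 1).map (fun a => r * a) := by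
    unfold gaussV
    rw [ProbabilityTheory.gaussianReal_map_const_mul, mul_zero]
    congr 1
    ext
    have := Real.pi_pos
    simp only [NNReal.coe_mul, NNReal.coe_mk]
    rw [Real.coe_toNNReal _ (by positivity), Real.coe_toNNReal _ (by positivity)]
    ring
  have h := lintegral_gaussV_le_lift (pow_pos hr 2) (F := fun x => F (x / r)) (by fun_prop)
  rw [h1, lintegral_map (by fun_prop) (by fun_prop)] at h
  simp only [mul_div_cancel_left₀ _ hr.ne'] at h
  rwa [lintegral_prod]
  exact (hF.comp ((measurable_lift.comp measurable_swap).div_const r)).aemeasurable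

lemma lintegral_row_le (ν : Measure ℝ) [IsProbabilityMeasure ν] {Ψ : Row n → ℝ≥0∞}
    (hΨ : Measurable Ψ) :
    ∫⁻ p, Ψ p ∂((Measure.pi fun _ => gaussV 1).prod ν) ≤ ENNReal.ofReal (theta (r ^ 2)) ^ n *
      ∫⁻ p, Ψ (liftRow r p.2 p.1) ∂(((Measure.pi fun _ => uniformTorus).prod ν).prod
        (Measure.pi fun _ => liftLaw (pow_pos hr 2))) := by
  set L := liftLaw (pow_pos hr 2)
  have hm : Measurable fun p : ℝ × ℝ => lift p.2 p.1 / r :=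
    (measurable_lift.comp measurable_swap).div_const r
  have := Measure.isProbabilityMeasure_map (μ := uniformTorus.prod L) hm.aemeasurable
  have hd : Dom (ENNReal.ofReal (theta (r ^ 2))) (gaussV 1) ((uniformTorus.prod L).map
      fun p => lift p.2 p.1 / r) := fun F hF => by
    rw [lintegral_map hF hm]; exact lintegral_gaussV_one_le hr hF
  have hl := measurable_liftRow (n := n) r
  have hm3 : Measurable fun p : ((Fin n → ℝ) × ℝ) × (Fin n → ℝ) => Ψ (liftRow r p.2 p.1) :=
    hΨ.comp hl
  have h4 : Measurable fun p : ℝ × (Fin n → ℝ) => ∫⁻ Y, Ψ (liftRow r Y (p.2, p.1))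
      ∂(Measure.pi fun _ : Fin n => L) :=
    Measurable.lintegral_prod_right' (f := fun p : (ℝ × (Fin n → ℝ)) × (Fin n → ℝ) =>
      Ψ (liftRow r p.2 (p.1.2, p.1.1))) (hm3.comp (by fun_prop :
        Measurable fun p : (ℝ × (Fin n → ℝ)) × (Fin n → ℝ) => ((p.1.2, p.1.1), p.2)))
  rw [lintegral_prod_symm _ hΨ.aemeasurable, lintegral_prod _ hm3.aemeasurable,
    lintegral_prod_symm _ hm3.lintegral_prod_right'.aemeasurable,
    ← lintegral_const_mul _ h4.lintegral_prod_right']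
  refine lintegral_mono fun e => ?_
  have hΨe : Measurable fun a => Ψ (a, e) := hΨ.comp (by fun_prop)
  have hm' : Measurable fun (w : Fin n → ℝ × ℝ) (i : Fin n) => lift (w i).2 (w i).1 / r := by
    unfold lift; fun_prop
  refine ((hd.pi n) _ hΨe).trans (le_of_eq ?_)
  congr 1
  rw [← Measure.pi_map_pi (fun _ => hm.aemeasurable), lintegral_map
    hΨe hm', lintegral_pi_prod]
  · rfl
  · have : Measurable fun w : Fin n → ℝ × ℝ => ((fun i => lift (w i).2 (w i).1 / r, e) : Row n) := by
      unfold lift; fun_prop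
    exact hΨ.comp this

/-- The shifts `Y` are integrated outermost, so that the torus reduction can be applied for each
fixed `Y`. -/
lemma near_lift (ν : Measure ℝ) [IsProbabilityMeasure ν] {F : (Fin m → Row n) → ℝ≥0∞}
    (hF : Measurable F) (hF1 : ∀ p, F p ≤ 1) :
    Near ((ENNReal.ofReal (theta (r ^ 2)) ^ n) ^ m - 1)
      (∫⁻ p, F p ∂(Measure.pi fun _ => (Measure.pi fun _ => gaussV 1).prod ν))
      (∫⁻ Y, ∫⁻ p, F (fun j => liftRow r (Y j) (p j))
        ∂(Measure.pi fun _ => (Measure.pi fun _ => uniformTorus).prod ν)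
        ∂(Measure.pi fun _ => Measure.pi fun _ => liftLaw (pow_pos hr 2))) := by
  have hl := measurable_liftRow (n := n) r
  set L := liftLaw (pow_pos hr 2)
  set P := ((Measure.pi fun _ : Fin n => uniformTorus).prod ν).prod (Measure.pi fun _ : Fin n => L)
  have := Measure.isProbabilityMeasure_map (μ := P) hl.aemeasurable
  have hK : 1 ≤ ENNReal.ofReal (theta (r ^ 2)) ^ n := by
    refine one_le_pow₀ ?_
    rw [← ENNReal.ofReal_one]
    exact ENNReal.ofReal_le_ofReal (one_le_theta (pow_pos hr 2))
  have hd : Dom (ENNReal.ofReal (theta (r ^ 2)) ^ n) ((Measure.pi fun _ => gaussV 1).prod ν)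
      (P.map fun p => liftRow r p.2 p.1) := fun Ψ hΨ => by
    rw [lintegral_map hΨ hl]; exact lintegral_row_le hr ν hΨ
  have key := (hd.pi m).near (one_le_pow₀ hK) hF hF1
  have hG₀ : Measurable fun (p : Fin m → Row n × (Fin n → ℝ)) j => liftRow r (p j).2 (p j).1 :=
    measurable_pi_lambda _ fun j => hl.comp (measurable_pi_apply j)
  have hG : Measurable fun p : Fin m → Row n × (Fin n → ℝ) =>
      F (fun j => liftRow r (p j).2 (p j).1) := hF.comp hG₀
  rw [← Measure.pi_map_pi (fun _ => hl.aemeasurable), lintegral_map hF hG₀,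
    lintegral_pi_prod _ _ hG, lintegral_lintegral_swap] at key
  · exact key
  · exact (hG.comp (by fun_prop : Measurable fun p : (Fin m → Row n) × (Fin m → Fin n → ℝ) =>
      fun j => (p.1 j, p.2 j))).aemeasurable

end RowLift

/-! ### Programs and their costs -/

section Machine

variable {m n c : ℕ}

/-- The list of values computed by a program. -/
def exec (x : Samples m n) (ω : Fin c → ℝ) (p : List (Instr m n c)) : List ℝ :=
  p.foldl (fun v I => v ++ [I.eval x ω v]) []

lemma exec_concat (x : Samples m n) (ω : Fin c → ℝ) (p : List (Instr m n c)) (I : Instr m n c) :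
    exec x ω (p ++ [I]) = exec x ω p ++ [I.eval x ω (exec x ω p)] := by
  simp [exec, List.foldl_append]

lemma length_exec (x : Samples m n) (ω : Fin c → ℝ) (p : List (Instr m n c)) :
    (exec x ω p).length = p.length := by
  induction p using List.reverseRecOn with
  | nil => rfl
  | append_singleton p I ih => rw [exec_concat]; simp [ih]

lemma exec_append (x : Samples m n) (ω : Fin c → ℝ) (p p' : List (Instr m n c)) :
    ∃ t, exec x ω (p ++ p') = exec x ω p ++ t := by
  induction p' using List.reverseRecOn with
  | nil => exact ⟨[], by simp⟩
  | append_singleton p' I ih =>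
    obtain ⟨t, ht⟩ := ih
    exact ⟨t ++ [I.eval x ω (exec x ω (p ++ p'))], by
      rw [← List.append_assoc, exec_concat, ht, List.append_assoc]⟩

variable {ι : Type*} (S : ι → Samples m n)

/-- The program `p` computes the value `f a` on the data `S a`. -/
def Computes (p : List (Instr m n c)) (f : ι → ℝ) : Prop :=
  ∃ i < p.length, ∀ a ω, (exec (S a) ω p).getD i 0 = f a

/-- The value `f a` is computed on the data `S a` by `N` additional instructions. -/
def Cost (c : ℕ) (N : ℕ) (f : ι → ℝ) : Prop :=
  ∀ p : List (Instr m n c), ∃ p', p'.length ≤ N ∧ Computes S (p ++ p') f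

variable {S} {p : List (Instr m n c)} {f g : ι → ℝ} {N M : ℕ}

lemma Computes.append (h : Computes S p f) (p' : List (Instr m n c)) :
    Computes S (p ++ p') f := by
  obtain ⟨i, hi, h⟩ := h
  refine ⟨i, by rw [List.length_append]; omega, fun a ω => ?_⟩
  obtain ⟨t, ht⟩ := exec_append (S a) ω p p'
  rw [ht, List.getD_append _ _ _ _ (by rwa [length_exec])]
  exact h a ω

lemma computes_concat (I : Instr m n c) (h : ∀ a ω, I.eval (S a) ω (exec (S a) ω p) = f a) :
    Computes S (p ++ [I]) f := by
  refine ⟨p.length, by simp, fun a ω => ?_⟩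
  rw [exec_concat, List.getD_append_right _ _ _ _ (by rw [length_exec]), length_exec]
  simpa using h a ω

lemma Cost.of_instr (I : Instr m n c) (h : ∀ a ω v, I.eval (S a) ω v = f a) : Cost S c 1 f :=
  fun _ => ⟨[I], le_rfl, computes_concat I fun a ω => h a ω _⟩

lemma Cost.const (r : ℝ) : Cost S c 1 fun _ => r := .of_instr (.const r) fun _ _ _ => rfl

lemma Cost.readA (i : Fin m) (j : Fin n) : Cost S c 1 fun a => (S a).1 i j :=
  .of_instr (.readA i j) fun _ _ _ => rfl

lemma Cost.readB (i : Fin m) : Cost S c 1 fun a => (S a).2 i :=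
  .of_instr (.readB i) fun _ _ _ => rfl

lemma Cost.mono (h : Cost S c N f) (hN : N ≤ M) : Cost S c M f := fun p =>
  let ⟨p', h1, h2⟩ := h p
  ⟨p', h1.trans hN, h2⟩

lemma Cost.bind (hf : Cost S c N f)
    (h : ∀ p : List (Instr m n c), Computes S p f → ∃ p', p'.length ≤ M ∧ Computes S (p ++ p') g) :
    Cost S c (N + M) g := by
  intro p
  obtain ⟨p₁, h1, h2⟩ := hf p
  obtain ⟨p₂, h3, h4⟩ := h _ h2
  exact ⟨p₁ ++ p₂, by rw [List.length_append]; omega, by rwa [← List.append_assoc]⟩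

lemma Cost.binary (hf : Cost S c N f) (hg : Cost S c M g) (op : ℝ → ℝ → ℝ)
    (I : ℕ → ℕ → Instr m n c)
    (hI : ∀ i j x ω v, (I i j).eval x ω v = op (v.getD i 0) (v.getD j 0)) :
    Cost S c (N + (M + 1)) fun a => op (f a) (g a) := by
  refine hf.bind fun p hp => ?_
  obtain ⟨p', h1, j, hj, h2⟩ := hg p
  obtain ⟨i, hi, h3⟩ := hp.append p'
  refine ⟨p' ++ [I i j], by simpa using h1, ?_⟩
  rw [← List.append_assoc]
  exact computes_concat _ fun a ω => by rw [hI, h2, h3]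

lemma Cost.add (hf : Cost S c N f) (hg : Cost S c M g) :
    Cost S c (N + (M + 1)) fun a => f a + g a :=
  hf.binary hg (· + ·) .add fun _ _ _ _ _ => rfl

lemma Cost.mul (hf : Cost S c N f) (hg : Cost S c M g) :
    Cost S c (N + (M + 1)) fun a => f a * g a :=
  hf.binary hg (· * ·) .mul fun _ _ _ _ _ => rfl

lemma Cost.sum {d : ℕ} {f : Fin d → ι → ℝ} (h : ∀ i, Cost S c N (f i)) :
    Cost S c (d * (N + 1) + 1) fun a => ∑ i, f i a := by
  induction d with
  | zero => simpa using Cost.const (S := S) (c := c) 0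
  | succ d ih =>
    simp_rw [Fin.sum_univ_castSucc]
    refine ((ih fun i => h i.castSucc).add (h (Fin.last d))).mono (le_of_eq ?_)
    ring

/-- The fractional part of a number in `[0, 2 ^ K)` by repeated subtraction. -/
lemma Computes.fract (K : ℕ) : ∀ {p : List (Instr m n c)} {f : ι → ℝ}, Computes S p f →
    (∀ a, 0 ≤ f a ∧ f a < 2 ^ K) →
    ∃ p', p'.length ≤ 3 * K ∧ Computes S (p ++ p') fun a => Int.fract (f a) := by
  induction K with
  | zero =>
    intro p f h hf
    refine ⟨[], le_rfl, ?_⟩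
    have : (fun a => Int.fract (f a)) = f := funext fun a =>
      Int.fract_eq_self.mpr ⟨(hf a).1, by simpa using (hf a).2⟩
    rw [this, List.append_nil]
    exact h
  | succ K ih =>
    intro p f h hf
    set p₁ := p ++ [.const ((2 : ℝ) ^ K)] with hp₁
    have h1 : Computes S p₁ fun _ => (2 : ℝ) ^ K := computes_concat _ fun _ _ => rfl
    have h0 : Computes S p₁ f := h.append _
    obtain ⟨i, -, hi⟩ := id h0
    obtain ⟨j, -, hj⟩ := id h1
    set p₂ := p₁ ++ [.sub i j] with hp₂
    have h2 : Computes S p₂ fun a => f a - 2 ^ K :=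
      computes_concat _ fun a ω => by rw [Instr.eval, hi, hj]
    obtain ⟨i', -, hi'⟩ := h0.append [.sub i j]
    obtain ⟨j', -, hj'⟩ := h1.append [.sub i j]
    obtain ⟨k, -, hk⟩ := h2
    have h3 : Computes S (p₂ ++ [.branch j' i' k i']) fun a =>
        if 2 ^ K ≤ f a then f a - 2 ^ K else f a :=
      computes_concat _ fun a ω => by rw [Instr.eval, hi', hj', hk]
    obtain ⟨p', hl, hp'⟩ := ih h3 fun a => by
      have := hf a
      rw [pow_succ] at this
      split_ifs <;> constructor <;> linarith
    -- One round: load `2 ^ K`, subtract it, and keep the difference if the value was at least `2 ^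
    -- K`. The range halves at the price of three instructions.
    refine ⟨[.const ((2 : ℝ) ^ K), .sub i j, .branch j' i' k i'] ++ p', ?_, ?_⟩
    · simp only [List.length_append, List.length_cons, List.length_nil]; omega
    · convert hp' using 1
      · simp [hp₂, hp₁]
      · funext a
        split_ifs
        · have := Int.fract_sub_intCast (f a) (2 ^ K)
          push_cast at this
          exact this.symm
        · rfl

lemma Cost.fract {K : ℕ} (h : Cost S c N f) (hf : ∀ a, 0 ≤ f a ∧ f a < 2 ^ K) :
    Cost S c (N + 3 * K) fun a => Int.fract (f a) :=
  h.bind fun _ hp => hp.fract K hf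

lemma Cost.forall {d : ℕ} {f : Fin d → ι → ℝ} (h : ∀ i, Cost S c N (f i))
    (p : List (Instr m n c)) : ∃ p', p'.length ≤ d * N ∧ ∀ i, Computes S (p ++ p') (f i) := by
  induction d with
  | zero => exact ⟨[], by simp, fun i => i.elim0⟩
  | succ d ih =>
    obtain ⟨p₁, h1, h2⟩ := ih fun i => h i.castSucc
    obtain ⟨p₂, h3, h4⟩ := h (Fin.last d) (p ++ p₁)
    refine ⟨p₁ ++ p₂, by rw [List.length_append, add_mul, one_mul]; omega, fun i => ?_⟩
    rw [← List.append_assoc]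
    exact Fin.lastCases h4 (fun i => (h2 i).append p₂) i

/-! ### Running a distinguisher on computed data -/

/-- The instruction `I` after `k` preliminary instructions, with the data at given positions. -/
def relocate {m' n' : ℕ} (k : ℕ) (pa : Fin m' → Fin n' → ℕ) (pb : Fin m' → ℕ) :
    Instr m' n' c → Instr m n c
  | .const r => .const r
  | .readA i j => .branch (pa i j) (pa i j) (pa i j) (pa i j)
  | .readB i => .branch (pb i) (pb i) (pb i) (pb i)
  | .coin i => .coin i
  | .add i j => .add (k + i) (k + j)
  | .sub i j => .sub (k + i) (k + j)
  | .mul i j => .mul (k + i) (k + j)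
  | .div i j => .div (k + i) (k + j)
  | .branch i j a b => .branch (k + i) (k + j) (k + a) (k + b)

/-- A read becomes a branch with four equal operands, that is, a one-step copy of a precomputed
value; hence the running time of the simulated program does not grow. -/
lemma eval_relocate {m' n' : ℕ} {pa : Fin m' → Fin n' → ℕ} {pb : Fin m' → ℕ} {x : Samples m n}
    {x' : Samples m' n'} {ω : Fin c → ℝ} {v₀ : List ℝ} (hpa : ∀ i j, pa i j < v₀.length)
    (hpb : ∀ i, pb i < v₀.length) (hxa : ∀ i j, v₀.getD (pa i j) 0 = x'.1 i j)
    (hxb : ∀ i, v₀.getD (pb i) 0 = x'.2 i) (v : List ℝ) (I : Instr m' n' c) :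
    (relocate (m := m) (n := n) v₀.length pa pb I).eval x ω (v₀ ++ v) = I.eval x' ω v := by
  have h : ∀ i, (v₀ ++ v).getD (v₀.length + i) 0 = v.getD i 0 := fun i => by
    rw [List.getD_append_right _ _ _ _ (by omega)]; simp
  cases I <;> simp only [relocate, Instr.eval, h, le_refl, if_true]
  · rw [List.getD_append _ _ _ _ (hpa _ _), hxa]
  · rw [List.getD_append _ _ _ _ (hpb _), hxb]

lemma exec_relocate {m' n' : ℕ} {pa : Fin m' → Fin n' → ℕ} {pb : Fin m' → ℕ} {x : Samples m n}
    {x' : Samples m' n'} {ω : Fin c → ℝ} {p₀ : List (Instr m n c)}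
    (hpa : ∀ i j, pa i j < p₀.length) (hpb : ∀ i, pb i < p₀.length)
    (hxa : ∀ i j, (exec x ω p₀).getD (pa i j) 0 = x'.1 i j)
    (hxb : ∀ i, (exec x ω p₀).getD (pb i) 0 = x'.2 i) (p : List (Instr m' n' c)) :
    exec x ω (p₀ ++ p.map (relocate p₀.length pa pb)) = exec x ω p₀ ++ exec x' ω p := by
  induction p using List.reverseRecOn with
  | nil => simp [exec]
  | append_singleton p I ih =>
    rw [List.map_append, List.map_singleton, ← List.append_assoc, exec_concat, ih, exec_concat,
      List.append_assoc]
    congr 3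
    have := eval_relocate (v₀ := exec x ω p₀) (x := x) (x' := x') (ω := ω) (pa := pa) (pb := pb)
      (by simpa [length_exec] using hpa) (by simpa [length_exec] using hpb) hxa hxb (exec x' ω p) I
    rwa [length_exec] at this

/-- If the data `T a` is computed from the data `S a`, then a distinguisher for `T a` yields a
distinguisher for `S a`. -/
lemma exists_relocated {m' n' Na Nb : ℕ} (D : Distinguisher m' n') (hD : D.code ≠ [])
    {T : ι → Samples m' n'} (ha : ∀ i j, Cost S D.coins Na fun a => (T a).1 i j)
    (hb : ∀ i, Cost S D.coins Nb fun a => (T a).2 i) :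
    ∃ code : List (Instr m n D.coins), code.length ≤ m' * (n' * Na) + m' * Nb + D.time ∧
      ∀ a ω, Distinguisher.output ⟨D.coins, code⟩ (S a) ω = D.output (T a) ω := by
  have hrow : ∀ (i : Fin m') (p : List (Instr m n D.coins)), ∃ p', p'.length ≤ n' * Na ∧
      ∀ j, Computes S (p ++ p') fun a => (T a).1 i j := fun i => Cost.forall (ha i)
  have hall : ∀ d (hd : d ≤ m'), ∃ p : List (Instr m n D.coins), p.length ≤ d * (n' * Na) ∧
      ∀ i : Fin m', (i : ℕ) < d → ∀ j, Computes S p fun a => (T a).1 i j := by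
    intro d
    induction d with
    | zero => exact fun _ => ⟨[], by simp, fun i hi => absurd hi (Nat.not_lt_zero _)⟩
    | succ d ih =>
      intro hd
      obtain ⟨p, h1, h2⟩ := ih (by omega)
      obtain ⟨p', h3, h4⟩ := hrow ⟨d, hd⟩ p
      refine ⟨p ++ p', by rw [List.length_append, add_mul, one_mul]; omega, fun i hi j => ?_⟩
      rcases Nat.lt_succ_iff_lt_or_eq.mp hi with h | h
      · exact (h2 i h j).append p'
      · obtain rfl : i = ⟨d, hd⟩ := Fin.ext h
        exact h4 j
  obtain ⟨p₁, h1, h2⟩ := hall m' le_rfl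
  obtain ⟨p₂, h3, h4⟩ := Cost.forall hb p₁
  have h5 : ∀ i j, Computes S (p₁ ++ p₂) fun a => (T a).1 i j := fun i j => (h2 i i.2 j).append p₂
  choose pa hpa hxa using h5
  choose pb hpb hxb using h4
  refine ⟨(p₁ ++ p₂) ++ D.code.map (relocate (p₁ ++ p₂).length pa pb), ?_, fun a ω => ?_⟩
  · rw [List.length_append, List.length_append, List.length_map, Distinguisher.time]
    omega
  · have key := exec_relocate (x := S a) (x' := T a) (ω := ω) hpa hpb (fun i j => hxa i j a ω)
      (fun i => hxb i a ω) D.code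
    have hne : exec (T a) ω D.code ≠ [] := by
      rw [← List.length_pos_iff, length_exec, List.length_pos_iff]; exact hD
    change (exec (S a) ω _).getLastD 0 = (exec (T a) ω D.code).getLastD 0
    rw [key, List.getLastD_eq_getLast?, List.getLastD_eq_getLast?, List.getLast?_append_of_ne_nil _ hne]

end Machine

/-! ### Acceptance probabilities -/

section Accept

variable {m n : ℕ}

lemma measurable_exec {c : ℕ} (p : List (Instr m n c)) (i : ℕ) :
    Measurable fun z : Samples m n × (Fin c → ℝ) => (exec z.1 z.2 p).getD i 0 := by
  induction p using List.reverseRecOn generalizing i with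
  | nil => simp [exec]
  | append_singleton p I ih =>
    simp_rw [exec_concat]
    rcases lt_trichotomy i p.length with h | h | h
    · have : ∀ z : Samples m n × (Fin c → ℝ),
          (exec z.1 z.2 p ++ [I.eval z.1 z.2 (exec z.1 z.2 p)]).getD i 0 =
            (exec z.1 z.2 p).getD i 0 := fun z =>
        List.getD_append _ _ _ _ (by rwa [length_exec])
      simp_rw [this]
      exact ih i
    · have : ∀ z : Samples m n × (Fin c → ℝ),
          (exec z.1 z.2 p ++ [I.eval z.1 z.2 (exec z.1 z.2 p)]).getD i 0 =
            I.eval z.1 z.2 (exec z.1 z.2 p) := fun z => by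
        rw [List.getD_append_right _ _ _ _ (by rw [length_exec, h]), length_exec, h]; simp
      simp_rw [this]
      cases I with
      | const r => exact measurable_const
      | readA i j => simp only [Instr.eval]; fun_prop
      | readB i => simp only [Instr.eval]; fun_prop
      | coin i => simp only [Instr.eval]; fun_prop
      | add i j => exact (ih i).add (ih j)
      | sub i j => exact (ih i).sub (ih j)
      | mul i j => exact (ih i).mul (ih j)
      | div i j => exact (ih i).div (ih j)
      | branch i j k l => exact Measurable.ite (measurableSet_le (ih i) (ih j)) (ih k) (ih l)
    · have : ∀ z : Samples m n × (Fin c → ℝ),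
          (exec z.1 z.2 p ++ [I.eval z.1 z.2 (exec z.1 z.2 p)]).getD i 0 = 0 := fun z =>
        List.getD_eq_default _ _ (by simp [length_exec]; omega)
      simp_rw [this]
      exact measurable_const

lemma measurable_output (D : Distinguisher m n) :
    Measurable fun z : Samples m n × (Fin D.coins → ℝ) => D.output z.1 z.2 := by
  have h : ∀ z : Samples m n × (Fin D.coins → ℝ), D.output z.1 z.2 =
      (exec z.1 z.2 D.code).getD (D.code.length - 1) 0 := fun z => by
    change (exec z.1 z.2 D.code).getLastD 0 = _
    rw [List.getLastD_eq_getLast?, List.getLast?_eq_getElem?, length_exec, List.getD_eq_getElem?_getD]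
  simp_rw [h]
  exact measurable_exec _ _

/-- The probability that `D` outputs `1` on the data `x`. -/
def accept (D : Distinguisher m n) (x : Samples m n) : ℝ≥0∞ :=
  (Measure.pi fun _ : Fin D.coins => uniformTorus) {ω | D.output x ω = 1}

lemma accept_le_one (D : Distinguisher m n) (x : Samples m n) : accept D x ≤ 1 := prob_le_one

lemma measurableSet_output (D : Distinguisher m n) :
    MeasurableSet {z : Samples m n × (Fin D.coins → ℝ) | D.output z.1 z.2 = 1} :=
  measurable_output D (measurableSet_singleton 1)

lemma measurable_accept (D : Distinguisher m n) : Measurable (accept D) :=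
  measurable_measure_prodMk_left (measurableSet_output D)

lemma acceptProb_eq (D : Distinguisher m n) (μ : Measure (Samples m n)) :
    D.acceptProb μ = (∫⁻ x, accept D x ∂μ).toReal := by
  rw [Distinguisher.acceptProb, Measure.real, Measure.prod_apply (measurableSet_output D)]
  rfl

end Accept

/-! ### The distributions of LWE -/

lemma lintegral_uniformOn {Ω : Type*} [MeasurableSpace Ω] [MeasurableSingletonClass Ω]
    (s : Finset Ω) (F : Ω → ℝ≥0∞) :
    ∫⁻ x, F x ∂ProbabilityTheory.uniformOn (s : Set Ω) = (s.card : ℝ≥0∞)⁻¹ * ∑ x ∈ s, F x := by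
  rw [ProbabilityTheory.uniformOn, ProbabilityTheory.cond, lintegral_smul_measure,
    lintegral_finset, Measure.count_apply_finset, smul_eq_mul]
  simp

section LWELaw

variable {q l n : ℕ} [NeZero q]

lemma uniformZq_eq : uniformZq q = (unif (ZMod q)).map fun y => (y.val : ℤ) := by
  refine Measure.ext_of_lintegral _ fun F hF => ?_
  have hI : (Set.Ico (0 : ℤ) q) = ((Finset.univ.image fun y : ZMod q => (y.val : ℤ) : Finset ℤ) :
      Set ℤ) := by
    ext z
    simp only [Set.mem_Ico, Finset.coe_image, Finset.coe_univ, Set.image_univ, Set.mem_range]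
    constructor
    · rintro ⟨h0, h1⟩
      obtain ⟨k, rfl⟩ := Int.eq_ofNat_of_zero_le h0
      exact ⟨k, by rw [ZMod.val_cast_of_lt (by exact_mod_cast h1)]⟩
    · rintro ⟨y, rfl⟩
      exact ⟨by positivity, by exact_mod_cast y.val_lt⟩
  have hinj : Function.Injective fun y : ZMod q => (y.val : ℤ) := fun a b h =>
    ZMod.val_injective q (Int.ofNat.inj h)
  rw [lintegral_map hF (measurable_of_countable _), lintegral_unif, uniformZq, hI,
    lintegral_uniformOn, Finset.card_image_of_injective _ hinj, Finset.sum_image hinj.injOn,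
    Finset.card_univ]

lemma uniformZqReal_eq : uniformZqReal q = (unif (ZMod q)).map zval := by
  rw [uniformZqReal, uniformZq_eq, Measure.map_map (measurable_of_countable _)
    (measurable_of_countable _)]
  congr 1

/-- The data with vectors `A` and labels `y`, in terms of real representatives. -/
def encode (a : (Fin n → Fin l → ZMod q) × (Fin n → ZMod q)) : Samples n l :=
  (fun c i => zval (a.1 c i), fun c => zval (a.2 c))

lemma pi_uniformZqReal : Measure.pi (fun _ : Fin n => uniformZqReal q) =
    (unif (Fin n → ZMod q)).map fun y c => zval (y c) := by
  rw [uniformZqReal_eq, ← unif_pi, Measure.pi_map_pi (fun _ => measurable_zval.aemeasurable)]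

lemma pi_pi_uniformZqReal :
    Measure.pi (fun _ : Fin n => Measure.pi fun _ : Fin l => uniformZqReal q) =
      (unif (Fin n → Fin l → ZMod q)).map fun A c i => zval (A c i) := by
  have hm : Measurable fun (y : Fin l → ZMod q) i => zval (y i) := measurable_of_countable _
  have := Measure.isProbabilityMeasure_map (μ := unif (Fin l → ZMod q)) hm.aemeasurable
  rw [pi_uniformZqReal, ← unif_pi (α := Fin l → ZMod q),
    Measure.pi_map_pi (fun _ => hm.aemeasurable)]

lemma lintegral_uniformSamples {H : Samples n l → ℝ≥0∞} (hH : Measurable H) :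
    ∫⁻ x, H x ∂uniformSamples q n l = ∫⁻ A, ∫⁻ y, H (encode (A, y)) ∂unif (Fin n → ZMod q)
      ∂unif (Fin n → Fin l → ZMod q) := by
  rw [uniformSamples, pi_pi_uniformZqReal, pi_uniformZqReal,
    Measure.map_prod_map _ _ (measurable_of_countable _) (measurable_of_countable _),
    lintegral_map hH (measurable_of_countable _),
    lintegral_prod _ (measurable_of_countable _).aemeasurable]
  rfl

lemma modQ_eq_zval (y : ZMod q) {z : ℤ} (h : y = z) : modQ q z = zval y := by
  have hq : (0 : ℝ) < q := Nat.cast_pos.mpr (NeZero.pos q)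
  have h1 := fract_zval_congr h 0
  rw [add_zero, add_zero] at h1
  rw [modQ, ← h1, Int.fract_eq_self.mpr, mul_div_cancel₀ _ hq.ne']
  exact ⟨div_nonneg (Nat.cast_nonneg _) hq.le, (div_lt_one hq).mpr (Nat.cast_lt.mpr y.val_lt)⟩

lemma lintegral_standardLWE {σ : ℝ} (hσ : 0 < σ) {H : Samples n l → ℝ≥0∞} (hH : Measurable H) :
    ∫⁻ x, H x ∂standardLWE q n l σ = ∫⁻ A, ∫⁻ t, ∫⁻ e,
      H (encode (A, fun c => dotp t A c + (e c : ZMod q)))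
        ∂(Measure.pi fun _ : Fin n => discreteGaussian σ) ∂unif (Fin l → ZMod q)
        ∂unif (Fin n → Fin l → ZMod q) := by
  have := isProbabilityMeasure_discreteGaussian hσ
  have hS : Measure.pi (fun _ : Fin l => uniformZq q) =
      (unif (Fin l → ZMod q)).map fun t i => ((t i).val : ℤ) := by
    have hv : Measurable fun y : ZMod q => (y.val : ℤ) := measurable_of_countable _
    have := Measure.isProbabilityMeasure_map (μ := unif (ZMod q)) hv.aemeasurable
    rw [uniformZq_eq, ← unif_pi, Measure.pi_map_pi (fun _ => hv.aemeasurable)]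
  have hE : Measure.pi (fun _ : Fin n => discreteGaussianReal σ) =
      (Measure.pi fun _ => discreteGaussian σ).map fun e c => (e c : ℝ) := by
    unfold discreteGaussianReal
    have := Measure.isProbabilityMeasure_map (μ := discreteGaussian σ)
      (f := fun z : ℤ => (z : ℝ)) (measurable_of_countable _).aemeasurable
    rw [Measure.pi_map_pi (fun _ => (measurable_of_countable _).aemeasurable)]
  have hG : Measurable fun p : (Fin l → ℤ) × ((Fin n → Fin l → ℝ) × (Fin n → ℝ)) =>
      ((p.2.1, fun i => modQ q (∑ j, (p.1 j : ℝ) * p.2.1 i j + p.2.2 i)) : Samples n l) := by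
    have hcast : Measurable (fun z : ℤ => (z : ℝ)) := fun _ _ => trivial
    unfold modQ
    fun_prop
  rw [standardLWE, LWE, lintegral_map hH hG, hS, pi_pi_uniformZqReal, hE,
    Measure.map_prod_map _ _ (measurable_of_countable _) (measurable_of_countable _),
    Measure.map_prod_map _ _ (measurable_of_countable _) (measurable_of_countable _),
    lintegral_map (f := fun p : (Fin l → ℤ) × ((Fin n → Fin l → ℝ) × (Fin n → ℝ)) =>
      H (p.2.1, fun i => modQ q (∑ j, (p.1 j : ℝ) * p.2.1 i j + p.2.2 i)))
      (hH.comp hG) (measurable_of_countable _),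
    lintegral_prod _ (measurable_of_countable _).aemeasurable]
  simp_rw [lintegral_prod _ (measurable_of_countable _).aemeasurable]
  rw [lintegral_lintegral_swap (measurable_of_countable _).aemeasurable]
  refine lintegral_congr fun A => lintegral_congr fun t => lintegral_congr fun e => ?_
  refine congrArg H (Prod.ext rfl (funext fun c => ?_))
  have h : dotp t A c + (e c : ZMod q) =
      ((∑ j, ((t j).val : ℤ) * ((A c j).val : ℤ) + e c : ℤ) : ZMod q) := by
    push_cast
    simp [dotp]
  simp only [Prod.map, encode]
  rw [← modQ_eq_zval _ h]
  push_cast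
  rfl

end LWELaw

/-! ### The program of the reduction -/

section Reduction

variable {q l n m c : ℕ}

lemma fract_add_fract_right (a b : ℝ) : Int.fract (a + Int.fract b) = Int.fract (a + b) := by
  rw [Int.fract_eq_fract]
  exact ⟨-⌊b⌋, by rw [← Int.self_sub_floor]; push_cast; ring⟩

/-- The constant κ/q is reduced modulo 1 in advance, so the argument of the fractional part is
nonnegative and its size is controlled by `f` alone. -/
lemma cost_fract_div {N K : ℕ} {f : (Fin n → Fin l → ZMod q) × (Fin n → ZMod q) → ℝ}
    (hf : Cost encode c N f) (h0 : ∀ a, 0 ≤ f a) (hK : ∀ a, f a / q + 1 ≤ 2 ^ K) (κ : ℝ) :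
    Cost encode c (N + 4 + 3 * K) fun a => Int.fract ((f a + κ) / q) := by
  have h := ((hf.mul (.const (q : ℝ)⁻¹)).add (.const (Int.fract (κ / q)))).fract (K := K) fun a => by
    have h1 := Int.fract_nonneg (κ / q)
    have h2 := Int.fract_lt_one (κ / q)
    have h3 := h0 a
    have h4 := hK a
    rw [div_eq_mul_inv] at h4
    exact ⟨by positivity, by linarith⟩
  refine Cost.mono ?_ (le_of_eq (by ring : N + (1 + 1) + (1 + 1) + 3 * K = N + 4 + 3 * K))
  convert h using 2 with a
  rw [fract_add_fract_right, add_div, div_eq_mul_inv (f a)]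

lemma zval_lt [NeZero q] (y : ZMod q) : zval y < q := Nat.cast_lt.mpr y.val_lt

lemma zval_nonneg (y : ZMod q) : 0 ≤ zval y := Nat.cast_nonneg _

lemma mul_le_two_pow (hl : l ≤ n ^ 2) :
    ((l : ℝ) + 1) * q ≤ 2 ^ (n ^ 2 + Nat.clog 2 q) := by
  have h1 : l + 1 ≤ 2 ^ n ^ 2 := (Nat.succ_le_succ hl).trans (Nat.lt_two_pow_self)
  have h2 : q ≤ 2 ^ Nat.clog 2 q := Nat.le_pow_clog one_lt_two q
  rw [pow_add]
  have h3 : ((l : ℝ) + 1) ≤ 2 ^ n ^ 2 := by exact_mod_cast h1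
  have h4 : (q : ℝ) ≤ 2 ^ Nat.clog 2 q := by exact_mod_cast h2
  gcongr

/-- Inner products are computed on representatives with no reduction modulo q; the final fractional
part removes the multiples of q. The value before reduction is at most `(l + 1) * q`, which fixes
the number of rounds. -/
lemma cost_coord [NeZero q] (hn : 1 ≤ n) (hl : l ≤ n ^ 2) (b : Prop) [Decidable b] (s : Fin l → ZMod q)
    (i : Fin n) (κ : ℝ) :
    Cost encode c (4 * l + 5 + 3 * (n ^ 2 + Nat.clog 2 q))
      fun a : (Fin n → Fin l → ZMod q) × (Fin n → ZMod q) =>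
        Int.fract ((zval ((if b then a.2 else dotp s a.1) i) + κ) / q) := by
  have hq : (1 : ℝ) ≤ q := by exact_mod_cast NeZero.one_le
  have hq0 : (0 : ℝ) < q := by linarith
  have hK := mul_le_two_pow (q := q) hl
  split_ifs with hb
  · refine (cost_fract_div (N := 1) (K := n ^ 2 + Nat.clog 2 q) (.readB i) (fun a => zval_nonneg _) (fun a => ?_) κ).mono
      (by omega)
    have h1 : zval (a.2 i) / q ≤ 1 := (div_le_one hq0).mpr (zval_lt _).le
    have h2 : (2 : ℝ) ≤ 2 ^ (n ^ 2 + Nat.clog 2 q) :=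
      le_self_pow₀ one_le_two (by positivity)
    exact (by linarith : zval (a.2 i) / q + 1 ≤ 2).trans h2
  · have hsum := Cost.sum (S := encode) (c := c) fun r : Fin l =>
      (Cost.const (S := encode (q := q) (l := l) (n := n)) (zval (s r))).mul (.readA i r)
    refine Cost.mono (M := 4 * l + 5 + 3 * (n ^ 2 + Nat.clog 2 q)) ?_ (le_refl _)
    refine Cost.mono (N := l * (1 + (1 + 1) + 1) + 1 + 4 + 3 * (n ^ 2 + Nat.clog 2 q)) ?_ (by omega)
    have h := cost_fract_div (K := n ^ 2 + Nat.clog 2 q) hsum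
      (fun a => Finset.sum_nonneg fun r _ => mul_nonneg (zval_nonneg _) (zval_nonneg _))
      (fun a => ?_) κ
    · convert h using 2 with a
      rw [fract_zval_congr (b := ∑ r, ((s r).val : ℤ) * ((a.1 i r).val : ℤ)) (by simp [dotp])]
      push_cast
      rfl
    · refine le_trans ?_ hK
      have h1 : ∑ r, zval (s r) * zval (a.1 i r) ≤ l * (q * q) := by
        calc _ ≤ ∑ _r : Fin l, (q : ℝ) * q := Finset.sum_le_sum fun r _ =>
              mul_le_mul (zval_lt _).le (zval_lt _).le (zval_nonneg _) hq0.le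
          _ = _ := by simp
      have h2 : (∑ r, zval (s r) * zval (a.1 i r)) / q ≤ l * q := by
        rw [div_le_iff₀ hq0]; linarith
      change (∑ r, zval (s r) * zval (a.1 i r)) / q + 1 ≤ _
      linarith

/-- Adding `1 - Int.fract Y` in place of `-Y` puts the argument in [0, 2), so one round of
subtraction suffices. -/
lemma Cost.lift {ι : Type*} {S : ι → Samples m n} {N : ℕ} {f : ι → ℝ} (hf : Cost S c N f)
    (h : ∀ a, 0 ≤ f a ∧ f a < 1) (Y r : ℝ) :
    Cost S c (N + 9) fun a => SparseCLWE.lift Y (f a) / r := by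
  have h1 := (((hf.add (.const (1 - Int.fract Y))).fract (K := 1) fun a => by
    have h2 := Int.fract_nonneg Y
    have h3 := Int.fract_lt_one Y
    have h4 := h a
    constructor <;> linarith).add (.const Y)).mul (.const r⁻¹)
  convert h1 using 2 with a
  rw [SparseCLWE.lift, div_eq_mul_inv, add_comm Y]
  congr 2
  rw [Int.fract_eq_fract]
  refine ⟨-⌊Y⌋ - 1, ?_⟩
  rw [← Int.self_sub_floor]
  push_cast
  ring

/-- The signed sum lies in [-d, d]; adding the integer `d` makes it nonnegative without changing its
fractional part. -/
lemma cost_inner {ι : Type*} {S : ι → Samples m n} {N d : ℕ} {f : Fin d → ι → ℝ}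
    (hf : ∀ i, Cost S c N (f i)) (h : ∀ i a, 0 ≤ f i a ∧ f i a < 1) {x : Fin d → ℤ}
    (hx : ∀ i, x i = -1 ∨ x i = 0 ∨ x i = 1) (κ : ℝ) :
    Cost S c (d * (N + 3) + 3 + 3 * (2 * d + 1)) fun a =>
      Int.fract (∑ i, (x i : ℝ) * f i a + κ) := by
  have h1 := ((Cost.sum fun i => (Cost.const (S := S) (c := c) (x i : ℝ)).mul (hf i)).add
    (.const (d + Int.fract κ))).fract (K := 2 * d + 1) fun a => by
      have h2 := Int.fract_nonneg κ
      have h3 := Int.fract_lt_one κ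
      have h4 : |∑ i, (x i : ℝ) * f i a| ≤ d := by
        calc _ ≤ ∑ i, |(x i : ℝ) * f i a| := Finset.abs_sum_le_sum_abs _ _
          _ ≤ ∑ _i : Fin d, (1 : ℝ) := Finset.sum_le_sum fun i _ => by
            have := h i a
            rw [abs_mul, abs_of_nonneg this.1]
            rcases hx i with e | e | e <;> rw [e] <;> norm_num <;> linarith
          _ = _ := by simp
      rw [abs_le] at h4
      have h5 : (2 * d + 1 : ℝ) ≤ 2 ^ (2 * d + 1) := by exact_mod_cast Nat.lt_two_pow_self.le
      constructor <;> linarith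
  refine Cost.mono ?_ (le_of_eq (by ring :
    d * (1 + (N + 1) + 1) + 1 + (1 + 1) + 3 * (2 * d + 1) = d * (N + 3) + 3 + 3 * (2 * d + 1)))
  convert h1 using 2 with a
  rw [Int.fract_eq_fract]
  refine ⟨⌊κ⌋ - d, ?_⟩
  rw [← Int.self_sub_floor]
  push_cast
  ring

/-- The data of a family of rows. -/
def toSamples (p : Fin m → Row n) : Samples m n := (fun j => (p j).1, fun j => (p j).2)

lemma measurable_toSamples : Measurable (toSamples (m := m) (n := n)) := by
  unfold toSamples; fun_prop

/-- The cost of the reduction. -/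
def reductionCost (n m q : ℕ) : ℕ := m * (2 * n * (7 * n ^ 2 + 3 * Nat.clog 2 q + 14) + 6)

lemma lweClose_of_not_distinguishable [NeZero q] {σ ε : ℝ} (hσ : 0 < σ) (hn : 1 ≤ n)
    (hl : q = 1 ∨ l ≤ n ^ 2) {T : ℕ} (r : ℝ)
    (h : ¬ Distinguishable (T + reductionCost n m q) ε (standardLWE q n l σ)
      (uniformSamples q n l)) (D : Distinguisher m n) (hD : D.time ≤ T) (Y : Fin m → Fin n → ℝ) :
    LWEClose q l σ (fun p => accept D (toSamples fun j => liftRow r (Y j) (p j)))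
      (ENNReal.ofReal ε) := by
  have := isProbabilityMeasure_discreteGaussian hσ
  intro i s x κ κ' hx
  -- For q = 1 the group ℤ_q is trivial and both sides agree; here the entropy condition gives no
  -- bound on `l`.
  by_cases hq : q = 1
  · subst hq
    have h2 : ∀ y : Fin n → ZMod 1, y = 0 := fun y => Subsingleton.elim _ _
    simp only [h2, lintegral_const, measure_univ, mul_one]
    exact (Near.refl _).mono zero_le
  replace hl := hl.resolve_left hq
  -- The empty program outputs 0, whereas with preliminary instructions added its last value would
  -- be one of theirs; it is treated separately.
  by_cases hcode : D.code = []
  · have : ∀ z, accept D z = 0 := fun z => by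
      have : ∀ ω, D.output z ω = 0 := fun ω => by simp [Distinguisher.output, Distinguisher.run, hcode]
      simp [accept, this]
    simp only [this, lintegral_zero]
    exact (Near.refl _).mono zero_le
  set T' : (Fin n → Fin l → ZMod q) × (Fin n → ZMod q) → Samples m n := fun a =>
    toSamples fun j => liftRow r (Y j) (genRow (x j) (if j = i then a.2 else dotp (s j) a.1)
      (κ j) (κ' j)) with hT'
  have hu := fun j c' => cost_coord (c := D.coins) hn hl (j = i) (s j) c' (κ j c')
  have hb : ∀ y : ℝ, 0 ≤ Int.fract y ∧ Int.fract y < 1 := fun y =>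
    ⟨Int.fract_nonneg y, Int.fract_lt_one y⟩
  obtain ⟨code, hlen, hout⟩ := exists_relocated (S := encode) (T := T') D hcode
    (fun j c' => (hu j c').lift (fun a => hb _) (Y j c') r)
    (fun j => cost_inner (fun c' => hu j c') (fun c' a => hb _) (hx j) (κ' j))
  set D' : Distinguisher n l := ⟨D.coins, code⟩ with hD'
  have hacc : ∀ a, accept D' (encode a) = accept D (T' a) := fun a => by
    unfold accept
    congr 1
    ext ω
    exact Eq.congr_left (hout a ω)
  have hadv : D'.advantage (standardLWE q n l σ) (uniformSamples q n l) < ε := by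
    by_contra hcon
    refine h ⟨D', ?_, not_lt.mp hcon⟩
    refine hlen.trans ?_
    rw [reductionCost]
    -- Label computations recompute all coordinates; `l ≤ n ^ 2` turns `4 * l + 3 * n ^ 2` into `7 *
    -- n ^ 2`.
    have : m * (n * (4 * l + 5 + 3 * (n ^ 2 + Nat.clog 2 q) + 9)) +
        m * (n * (4 * l + 5 + 3 * (n ^ 2 + Nat.clog 2 q) + 3) + 3 + 3 * (2 * n + 1)) ≤
        m * (2 * n * (7 * n ^ 2 + 3 * Nat.clog 2 q + 14) + 6) := by
      rw [← mul_add]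
      refine Nat.mul_le_mul_left _ ?_
      nlinarith
    omega
  rw [Distinguisher.advantage, acceptProb_eq, acceptProb_eq,
    lintegral_standardLWE hσ (measurable_accept D'), lintegral_uniformSamples (measurable_accept D')]
    at hadv
  simp_rw [hacc] at hadv
  refine near_of_abs_toReal (lintegral_le_one fun A => lintegral_le_one fun t =>
    lintegral_le_one fun e => accept_le_one _ _)
    (lintegral_le_one fun A => lintegral_le_one fun y => accept_le_one _ _) hadv.le

end Reduction

/-! ### The distributions of CLWE -/

section CLWELaw

variable {m n : ℕ}

instance (s : ℝ) : IsProbabilityMeasure (gaussian s) := by unfold gaussian; infer_instance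

lemma modQ_one (y : ℝ) : modQ 1 y = Int.fract y := by simp [modQ]

lemma lintegral_nullCLWE {H : Samples m n → ℝ≥0∞} (hH : Measurable H) :
    ∫⁻ z, H z ∂nullCLWE m n = ∫⁻ p, H (toSamples p)
      ∂(Measure.pi fun _ => (Measure.pi fun _ => gaussV 1).prod uniformTorus) := by
  have hHt : Measurable fun p : Fin m → Row n => H (toSamples p) := hH.comp measurable_toSamples
  rw [nullCLWE, gaussian_eq_gaussV, one_pow, lintegral_prod _ hH.aemeasurable,
    lintegral_pi_prod _ _ hHt]
  rfl

lemma gaussian_eq_map {q : ℕ} [NeZero q] (k σ : ℝ) (hk : 0 ≤ k) :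
    gaussian (3 * (σ * Real.sqrt k / q)) = (gaussV (9 * k * σ ^ 2)).map fun h : ℝ => h / (q : ℝ) := by
  have hpi := Real.pi_pos
  have hq : (0 : ℝ) < q := Nat.cast_pos.mpr (NeZero.pos q)
  rw [gaussian_eq_gaussV]
  unfold gaussV
  rw [ProbabilityTheory.gaussianReal_map_div_const, zero_div]
  congr 1
  ext
  simp only [NNReal.coe_div, NNReal.coe_mk]
  rw [Real.coe_toNNReal _ (by positivity), Real.coe_toNNReal _ (by positivity), mul_pow, div_pow,
    mul_pow, Real.sq_sqrt hk]
  field_simp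
  ring

lemma isProbabilityMeasure_scaledSparseSecret {k : ℕ} (hkn : k ≤ n) :
    IsProbabilityMeasure (scaledSparseSecret n k) := by
  unfold scaledSparseSecret
  rw [← coe_sparseFinset]
  have := ProbabilityTheory.isProbabilityMeasure_uniformOn (sparseFinset n k).finite_toSet
    (sparseFinset_nonempty hkn)
  exact Measure.isProbabilityMeasure_map (measurable_of_countable _).aemeasurable

lemma measurable_clweSamples (γ : ℝ) :
    Measurable fun p : (Fin n → ℝ) × ((Fin m → Fin n → ℝ) × (Fin m → ℝ)) =>
      ((p.2.1, fun i => modQ 1 (γ * (∑ j, p.2.1 i j * p.1 j) + p.2.2 i)) : Samples m n) := by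
  unfold modQ
  fun_prop

lemma isProbabilityMeasure_sparseCLWE {k : ℕ} (hkn : k ≤ n) (γ β : ℝ) :
    IsProbabilityMeasure (sparseCLWE m n k γ β) := by
  have := isProbabilityMeasure_scaledSparseSecret hkn
  exact Measure.isProbabilityMeasure_map (measurable_clweSamples γ).aemeasurable

instance : IsProbabilityMeasure (nullCLWE m n) := by unfold nullCLWE; infer_instance

/-- The factor √k in γ cancels the scaling of the secret, leaving integer coefficients times `r`. -/
lemma lintegral_sparseCLWE {q k : ℕ} [NeZero q] (hk : 1 ≤ k) (hkn : k ≤ n) (σ r : ℝ)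
    {H : Samples m n → ℝ≥0∞} (hH : Measurable H) :
    ∫⁻ z, H z ∂sparseCLWE m n k (Real.sqrt k * r) (3 * (σ * Real.sqrt k / q)) =
      ∫⁻ x : sparseFinset n k, ∫⁻ p, H (toSamples fun j => clweRow q r x (p j))
        ∂(Measure.pi fun _ => (Measure.pi fun _ => gaussV 1).prod (gaussV (9 * k * σ ^ 2)))
        ∂unif _ := by
  have hk0 : Real.sqrt k ≠ 0 := (Real.sqrt_pos.mpr (by exact_mod_cast hk)).ne'
  have hdiv : Measurable fun h : ℝ => h / q := by fun_prop
  have := Measure.isProbabilityMeasure_map (μ := gaussV (9 * k * σ ^ 2)) hdiv.aemeasurable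
  have hG := measurable_clweSamples (m := m) (n := n) (Real.sqrt k * r)
  have hHG : Measurable fun p : (Fin n → ℝ) × ((Fin m → Fin n → ℝ) × (Fin m → ℝ)) =>
      H (p.2.1, fun i => modQ 1 (Real.sqrt k * r * (∑ j, p.2.1 i j * p.1 j) + p.2.2 i)) :=
    hH.comp hG
  have := isProbabilityMeasure_scaledSparseSecret hkn
  rw [sparseCLWE, CLWE, lintegral_map hH hG, lintegral_prod _ hHG.aemeasurable, scaledSparseSecret,
    lintegral_map hHG.lintegral_prod_right' (measurable_of_countable _), ← coe_sparseFinset,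
    lintegral_uniformOn, lintegral_unif, Fintype.card_coe,
    Finset.sum_coe_sort (sparseFinset n k) (fun x => ∫⁻ p, H (toSamples fun j => clweRow q r x (p j))
        ∂(Measure.pi fun _ => (Measure.pi fun _ => gaussV 1).prod (gaussV (9 * k * σ ^ 2))))]
  congr 1
  refine Finset.sum_congr rfl fun x _ => ?_
  have hrow : Measurable fun p : Fin m → Row n => H (toSamples fun j => clweRow q r x (p j)) := by
    have := measurable_clweRow q r x
    exact (hH.comp measurable_toSamples).comp
      (by fun_prop : Measurable fun (p : Fin m → Row n) j => clweRow q r x (p j))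
  have hHx : Measurable fun p : (Fin m → Fin n → ℝ) × (Fin m → ℝ) =>
      H (p.1, fun i => modQ 1 (Real.sqrt k * r * (∑ j, p.1 i j * ((x j : ℝ) / Real.sqrt k)) +
        p.2 i)) := hHG.comp (by fun_prop : Measurable fun p : (Fin m → Fin n → ℝ) × (Fin m → ℝ) =>
          ((fun i => (x i : ℝ) / Real.sqrt k), p))
  rw [lintegral_pi_prod _ _ hrow, gaussian_eq_map _ _ (Nat.cast_nonneg k),
    gaussian_eq_gaussV, one_pow, lintegral_prod _ hHx.aemeasurable,
    ← Measure.pi_map_pi (fun _ => hdiv.aemeasurable)]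
  refine lintegral_congr fun a => ?_
  have hHa : Measurable fun h : Fin m → ℝ =>
      H (a, fun i => modQ 1 (Real.sqrt k * r * (∑ j, a i j * ((x j : ℝ) / Real.sqrt k)) + h i)) :=
    hHx.comp measurable_prodMk_left
  rw [lintegral_map hHa (by fun_prop)]
  refine lintegral_congr fun h => congrArg H (Prod.ext rfl (funext fun j => ?_))
  simp only [toSamples, clweRow, modQ_one, Finset.mul_sum]
  congr 2
  refine Finset.sum_congr rfl fun i _ => ?_
  field_simp

end CLWELaw

/-! ### The reduction with explicit errors -/

lemma Near.abs_toReal_sub_le {δ : ℝ} (hδ : 0 ≤ δ) {a b : ℝ≥0∞} (h : Near (ENNReal.ofReal δ) a b)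
    (ha : a ≤ 1) (hb : b ≤ 1) : |a.toReal - b.toReal| ≤ δ := by
  have ha' : a ≠ ∞ := ne_top_of_le_ne_top ENNReal.one_ne_top ha
  have hb' : b ≠ ∞ := ne_top_of_le_ne_top ENNReal.one_ne_top hb
  have key : ∀ {c d : ℝ≥0∞}, c ≠ ∞ → d ≠ ∞ → c ≤ d + ENNReal.ofReal δ → c.toReal ≤ d.toReal + δ := by
    intro c d hc hd hcd
    have := ENNReal.toReal_mono (ENNReal.add_ne_top.mpr ⟨hd, ENNReal.ofReal_ne_top⟩) hcd
    rwa [ENNReal.toReal_add hd ENNReal.ofReal_ne_top, ENNReal.toReal_ofReal hδ] at this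
  have h1 := key ha' hb' h.1
  have h2 := key hb' ha' h.2
  rw [abs_le]
  constructor <;> linarith

/-- The error of the Gaussian steps with squared width `V` for `N` coordinates. -/
def gaussError (V : ℝ) (N : ℕ) : ℝ := theta V ^ N - 1

lemma ofReal_theta_pow_sub {V : ℝ} (hV : 0 < V) (a b : ℕ) :
    (ENNReal.ofReal (theta V) ^ a) ^ b - 1 = ENNReal.ofReal (gaussError V (a * b)) := by
  have h := one_le_theta hV
  rw [gaussError, ENNReal.ofReal_sub _ zero_le_one, ENNReal.ofReal_one, ← pow_mul,
    ENNReal.ofReal_pow (by linarith)]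

lemma gaussError_nonneg {V : ℝ} (hV : 0 < V) (N : ℕ) : 0 ≤ gaussError V N :=
  sub_nonneg.mpr (one_le_pow₀ (one_le_theta hV))

lemma measurable_liftRows {n m : ℕ} (r : ℝ) :
    Measurable fun (p : (Fin m → Fin n → ℝ) × (Fin m → Row n)) j => liftRow r (p.1 j) (p.2 j) :=
  measurable_pi_lambda _ fun j => (measurable_liftRow r).comp
    (by fun_prop : Measurable fun p : (Fin m → Fin n → ℝ) × (Fin m → Row n) => (p.2 j, p.1 j))

section Explicit

variable {q l n m k : ℕ} {σ r : ℝ}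

lemma near_clwe_secretExp (hr : 0 < r) {G : (Fin m → Row n) → ℝ≥0∞} (hG : Measurable G)
    (hG1 : ∀ p, G p ≤ 1) (V : ℝ) (x : Fin n → ℤ) :
    Near (ENNReal.ofReal (gaussError (r ^ 2) (n * m)))
      (∫⁻ p, G (fun j => clweRow q r x (p j))
        ∂(Measure.pi fun _ => (Measure.pi fun _ => gaussV 1).prod (gaussV (V * σ ^ 2))))
      (∫⁻ Y, secretExp q σ V (fun p => G fun j => liftRow r (Y j) (p j)) x
        ∂(Measure.pi fun _ => Measure.pi fun _ => liftLaw (pow_pos hr 2))) := by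
  have hm : Measurable fun (p : Fin m → Row n) j => clweRow q r x (p j) :=
    measurable_pi_lambda _ fun j => (measurable_clweRow q r x).comp (measurable_pi_apply j)
  have h := near_lift hr (gaussV (V * σ ^ 2)) (hG.comp hm) fun _ => hG1 _
  rw [ofReal_theta_pow_sub (pow_pos hr 2)] at h
  simp only [Function.comp_apply, clweRow_liftRow hr.ne'] at h
  exact h

lemma measurable_secretExp_liftRow {G : (Fin m → Row n) → ℝ≥0∞} (hG : Measurable G) (V : ℝ)
    (x : Fin n → ℤ) : Measurable fun Y : Fin m → Fin n → ℝ =>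
      secretExp q σ V (fun p => G fun j => liftRow r (Y j) (p j)) x := by
  have hm : Measurable fun p : (Fin m → Fin n → ℝ) × (Fin m → Row n) =>
      (p.1, fun j => secretRow q x (p.2 j)) :=
    measurable_fst.prodMk (measurable_pi_lambda _ fun j => (measurable_secretRow q x).comp
      ((measurable_pi_apply j).comp measurable_snd))
  exact Measurable.lintegral_prod_right' (hG.comp ((measurable_liftRows r).comp hm))

lemma near_clwe [NeZero q] {ε : ℝ≥0∞} (hσ : 0 < σ) (hr : 0 < r) (hk : 1 ≤ k) (hkn : k ≤ n)
    {G : (Fin m → Row n) → ℝ≥0∞} (hG : Measurable G) (hG1 : ∀ p, G p ≤ 1)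
    (hclose : ∀ Y : Fin m → Fin n → ℝ,
      LWEClose q l σ (fun p => G fun j => liftRow r (Y j) (p j)) ε) :
    Near (2 * m * ε + (2 * ENNReal.ofReal (gaussError (r ^ 2) (n * m)) +
        4 * ENNReal.ofReal (gaussError (σ ^ 2 / 4) ((n + 1) * m)) +
        ENNReal.ofReal (Real.sqrt ((q : ℝ) ^ (l + 1) / n.choose k)) +
        ENNReal.ofReal (Real.log q / 2 ^ l)))
      (∫⁻ x : sparseFinset n k, ∫⁻ p, G (fun j => clweRow q r x (p j))
        ∂(Measure.pi fun _ => (Measure.pi fun _ => gaussV 1).prod (gaussV (9 * k * σ ^ 2)))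
        ∂unif _)
      (∫⁻ p, G p ∂(Measure.pi fun _ => (Measure.pi fun _ => gaussV 1).prod uniformTorus)) := by
  have : Nonempty (sparseFinset n k) := (sparseFinset_nonempty hkn).to_subtype
  have h1 := Near.lintegral (μ := unif (sparseFinset n k)) fun x =>
    near_clwe_secretExp (q := q) (σ := σ) hr hG hG1 (9 * k) x
  rw [lintegral_lintegral_swap (f := fun (x : sparseFinset n k) (Y : Fin m → Fin n → ℝ) =>
    secretExp q σ (9 * k) (fun p => G fun j => liftRow r (Y j) (p j)) x)
    (measurable_from_prod_countable_right fun x : sparseFinset n k =>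
      measurable_secretExp_liftRow hG (9 * k) x).aemeasurable] at h1
  have h2 := Near.lintegral (μ := Measure.pi fun _ : Fin m => Measure.pi fun _ : Fin n =>
    liftLaw (pow_pos hr 2)) fun Y => near_secretExp (q := q) (l := l) (σ := σ) (k := k)
      hσ (hG.comp ((measurable_liftRows r).comp measurable_prodMk_left)) (fun _ => hG1 _)
      (hclose Y) hk hkn
  have h3 := near_lift hr uniformTorus hG hG1
  rw [ofReal_theta_pow_sub (pow_pos hr 2)] at h3
  rw [thetaConst, ofReal_theta_pow_sub (by positivity)] at h2
  refine ((h1.trans h2).trans h3.symm).mono (le_of_eq ?_)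
  ring

theorem advantage_le [NeZero q] {ε : ℝ} (hσ : 0 < σ) (hr : 0 < r) (hε : 0 ≤ ε)
    (hk : 1 ≤ k) (hkn : k ≤ n) (hl : q = 1 ∨ l ≤ n ^ 2) {T : ℕ}
    (h : ¬ Distinguishable (T + reductionCost n m q) ε (standardLWE q n l σ)
      (uniformSamples q n l)) (D : Distinguisher m n) (hD : D.time ≤ T) :
    D.advantage (sparseCLWE m n k (Real.sqrt k * r) (3 * (σ * Real.sqrt k / q))) (nullCLWE m n) ≤
      2 * m * ε + (2 * gaussError (r ^ 2) (n * m) + 4 * gaussError (σ ^ 2 / 4) ((n + 1) * m) +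
        Real.sqrt ((q : ℝ) ^ (l + 1) / n.choose k) + Real.log q / 2 ^ l) := by
  have key := near_clwe hσ hr hk hkn (G := fun p => accept D (toSamples p))
    ((measurable_accept D).comp measurable_toSamples) (fun p => accept_le_one D _)
    (lweClose_of_not_distinguishable hσ (hk.trans hkn) hl r h D hD)
  rw [Distinguisher.advantage, acceptProb_eq, acceptProb_eq,
    lintegral_sparseCLWE hk hkn σ r (measurable_accept D), lintegral_nullCLWE (measurable_accept D)]
  have hn1 := gaussError_nonneg (pow_pos hr 2) (n * m)
  have hn2 := gaussError_nonneg (V := σ ^ 2 / 4) (by positivity) ((n + 1) * m)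
  have hn3 : 0 ≤ Real.log q := Real.log_natCast_nonneg q
  have : Nonempty (sparseFinset n k) := (sparseFinset_nonempty hkn).to_subtype
  refine Near.abs_toReal_sub_le (by positivity) (key.mono (le_of_eq ?_))
    (lintegral_le_one fun x => lintegral_le_one fun p => accept_le_one _ _)
    (lintegral_le_one fun p => accept_le_one _ _)
  rw [ENNReal.ofReal_add (by positivity) (by positivity),
    ENNReal.ofReal_add (by positivity) (by positivity),
    ENNReal.ofReal_add (by positivity) (by positivity),
    ENNReal.ofReal_add (by positivity) (by positivity), ENNReal.ofReal_mul (by positivity),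
    ENNReal.ofReal_mul (by positivity), ENNReal.ofReal_mul (by positivity),
    ENNReal.ofReal_mul (by positivity), ENNReal.ofReal_natCast, ENNReal.ofReal_ofNat,
    ENNReal.ofReal_ofNat]

end Explicit

/-! ### Asymptotic bounds on the errors -/

/-- The bound `theta V ≤ exp (4 exp (-L))` gives `theta V ^ N ≤ exp (8 exp (-w))`, and `8 ≤ w` makes
the last exponent at most 1, where `exp t - 1 ≤ 2t`. The 2 in the bound on `N` accommodates `(n + 1)
* m ≤ 2 * n * m`. -/
lemma gaussError_le {V L w : ℝ} {N : ℕ} (hV : L ≤ V) (hw : 8 ≤ w) (hL : w ≤ L)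
    (hN : (N : ℝ) ≤ 2 * Real.exp (L - w)) : gaussError V N ≤ 16 * Real.exp (-w) := by
  have hV0 : 0 < V := by linarith
  have hpi := Real.pi_gt_three
  have h8 : 8 * Real.exp (-w) ≤ 1 := by
    rw [Real.exp_neg, ← div_eq_mul_inv, div_le_one (Real.exp_pos w)]
    linarith [Real.add_one_le_exp w]
  have h1 : Real.exp (-(Real.pi * V)) ≤ Real.exp (-L) := Real.exp_le_exp.mpr (by nlinarith)
  have h2 : Real.exp (-L) ≤ Real.exp (-w) := Real.exp_le_exp.mpr (by linarith)
  have h3 : theta V ≤ Real.exp (4 * Real.exp (-L)) := by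
    have := Real.add_one_le_exp (4 * Real.exp (-L))
    linarith [theta_le hV0 (by linarith)]
  have h4 : theta V ^ N ≤ Real.exp (8 * Real.exp (-w)) := by
    calc theta V ^ N ≤ Real.exp (4 * Real.exp (-L)) ^ N :=
          pow_le_pow_left₀ (by linarith [one_le_theta hV0]) h3 N
      _ = Real.exp (N * (4 * Real.exp (-L))) := by rw [← Real.exp_nat_mul]
      _ ≤ _ := by
        rw [Real.exp_le_exp]
        have h5 := mul_le_mul_of_nonneg_right hN (Real.exp_pos (-L)).le
        rw [mul_assoc, ← Real.exp_add, show L - w + -L = -w by ring] at h5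
        linarith
  have h6 := Real.abs_exp_sub_one_le (x := 8 * Real.exp (-w)) (by rwa [abs_of_pos (by positivity)])
  rw [abs_of_pos (a := 8 * Real.exp (-w)) (by positivity), abs_le] at h6
  rw [gaussError]
  linarith [h6.2]

lemma pow_le_pow_mul_choose : ∀ {k n : ℕ}, k ≤ n → ((n : ℝ) / k) ^ k ≤ n.choose k
  | 0, n, _ => by simp
  | k + 1, 0, h => absurd h (by omega)
  | k + 1, n + 1, h => by
    have ih := pow_le_pow_mul_choose (Nat.le_of_succ_le_succ h)
    have hc : ((n + 1).choose (k + 1) : ℝ) = ((n : ℝ) + 1) / (k + 1) * n.choose k := by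
      have := Nat.add_one_mul_choose_eq n k
      have h' : ((n : ℝ) + 1) * n.choose k = (n + 1).choose (k + 1) * (k + 1) := by exact_mod_cast this
      field_simp
      linarith
    rw [hc, pow_succ, mul_comm]
    push_cast
    gcongr
    refine le_trans ?_ ih
    rcases Nat.eq_zero_or_pos k with rfl | hk
    · simp
    have hkn : (k : ℝ) ≤ n := by exact_mod_cast Nat.le_of_succ_le_succ h
    have hk' : (0 : ℝ) < k := by exact_mod_cast hk
    refine pow_le_pow_left₀ (by positivity) ?_ k
    rw [div_le_div_iff₀ (by positivity) hk']
    nlinarith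

/-- The entropy condition with `(n / k) ^ k ≤ n.choose k`. Passing from base 2 uses log 2 ≥ 1/2, and
the square root halves the exponent again. -/
lemma sqrt_div_choose_le {q l n k : ℕ} {w : ℝ} (hq : 0 < q) (hk : 0 < k) (hkn : k ≤ n)
    (hw : 0 ≤ w) (h : ((l : ℝ) + 1) * Real.logb 2 q + w ≤ k * Real.logb 2 ((n : ℝ) / k)) :
    Real.sqrt ((q : ℝ) ^ (l + 1) / n.choose k) ≤ Real.exp (-(w / 4)) := by
  have hq' : (0 : ℝ) < q := by exact_mod_cast hq
  have hk' : (0 : ℝ) < k := by exact_mod_cast hk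
  have hn' : (0 : ℝ) < n := by exact_mod_cast hk.trans_le hkn
  have hc : (0 : ℝ) < n.choose k := by exact_mod_cast Nat.choose_pos hkn
  have hlog2 : (1 : ℝ) / 2 ≤ Real.log 2 := by linarith [Real.log_two_gt_d9]
  have h1 : ((l : ℝ) + 1) * Real.log q + w * Real.log 2 ≤ k * Real.log ((n : ℝ) / k) := by
    have := mul_le_mul_of_nonneg_right h (by linarith : 0 ≤ Real.log 2)
    have e : ∀ x, Real.logb 2 x * Real.log 2 = Real.log x := fun x =>
      div_mul_cancel₀ _ (Real.log_pos one_lt_two).ne'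
    rw [add_mul, mul_assoc, e, mul_assoc, e] at this
    exact this
  have h2 : k * Real.log ((n : ℝ) / k) ≤ Real.log (n.choose k) := by
    rw [← Real.log_pow]
    exact Real.log_le_log (by positivity) (pow_le_pow_mul_choose hkn)
  have h3 : (q : ℝ) ^ (l + 1) / n.choose k ≤ Real.exp (-(w / 2)) := by
    rw [← Real.log_le_iff_le_exp (by positivity), Real.log_div (by positivity) hc.ne', Real.log_pow]
    push_cast
    nlinarith
  calc _ ≤ Real.sqrt (Real.exp (-(w / 2))) := Real.sqrt_le_sqrt h3
    _ = _ := by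
      rw [← Real.exp_half]
      ring_nf

/-- For q ≥ 2 one has log₂ q ≥ 1, while the right side of the entropy condition is at most n². This
removes `l` from the running time. -/
lemma dim_le_sq {q l n k : ℕ} {w : ℝ} (hq : 0 < q) (hk : 0 < k) (hkn : k ≤ n)
    (hw : 0 ≤ w) (h : ((l : ℝ) + 1) * Real.logb 2 q + w ≤ k * Real.logb 2 ((n : ℝ) / k)) :
    q = 1 ∨ l ≤ n ^ 2 := by
  by_cases hq1 : q = 1
  · exact Or.inl hq1
  right
  have hq2 : (2 : ℝ) ≤ q := by exact_mod_cast (by omega : 2 ≤ q)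
  have hk' : (1 : ℝ) ≤ k := by exact_mod_cast hk
  have hkn' : (k : ℝ) ≤ n := by exact_mod_cast hkn
  have hk0 : (0 : ℝ) < k := by linarith
  have hn0 : (0 : ℝ) < n := by linarith
  have h1 : 1 ≤ Real.logb 2 q := by
    rw [Real.le_logb_iff_rpow_le one_lt_two (by linarith)]; simpa using hq2
  have h2 : Real.logb 2 ((n : ℝ) / k) ≤ n := by
    rw [Real.logb_le_iff_le_rpow one_lt_two (by positivity), Real.rpow_natCast]
    refine (div_le_self (by linarith) hk').trans ?_
    exact_mod_cast Nat.lt_two_pow_self.le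
  have h3 : (k : ℝ) * Real.logb 2 ((n : ℝ) / k) ≤ n * n :=
    (mul_le_mul_of_nonneg_left h2 (by linarith)).trans
      (mul_le_mul_of_nonneg_right hkn' (by linarith))
  have h4 : (l : ℝ) ≤ (n : ℝ) ^ 2 := by nlinarith [(Nat.cast_nonneg l : (0 : ℝ) ≤ l)]
  exact_mod_cast h4

/-! ### Negligible functions -/

lemma IsOmegaLog.eventually_le {w : ℕ → ℝ} (hw : IsOmegaLog w) (b : ℝ) :
    ∀ᶠ lam in Filter.atTop, b ≤ w lam := by
  have hlog : Filter.Tendsto (fun lam : ℕ => Real.log lam) Filter.atTop Filter.atTop :=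
    Real.tendsto_log_atTop.comp tendsto_natCast_atTop_atTop
  filter_upwards [hw.eventually_ge_atTop |b|, hlog.eventually_ge_atTop 1] with lam h1 h2
  rw [le_div_iff₀ (by linarith)] at h1
  nlinarith [abs_nonneg b, le_abs_self b]

lemma IsOmegaLog.negligible {w : ℕ → ℝ} (hw : IsOmegaLog w) {c : ℝ} (hc : 0 < c) :
    Negligible fun lam => Real.exp (-(c * w lam)) := by
  intro j
  have hinv : Filter.Tendsto (fun lam : ℕ => ((lam : ℝ))⁻¹) Filter.atTop (nhds 0) :=
    tendsto_inv_atTop_zero.comp tendsto_natCast_atTop_atTop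
  refine squeeze_zero' (.of_forall fun lam => by positivity) ?_ hinv
  filter_upwards [hw.eventually_ge_atTop ((j + 1) / c), Filter.eventually_ge_atTop 2] with lam h1 h2
  have h3 : (2 : ℝ) ≤ lam := by exact_mod_cast h2
  have hlog : 0 < Real.log lam := Real.log_pos (by linarith)
  have hpos : (0 : ℝ) < lam := by linarith
  rw [div_le_div_iff₀ hc hlog] at h1
  calc (lam : ℝ) ^ j * Real.exp (-(c * w lam))
      ≤ (lam : ℝ) ^ j * Real.exp (-((j + 1 : ℕ) * Real.log lam)) := by
        refine mul_le_mul_of_nonneg_left (Real.exp_le_exp.mpr ?_) (by positivity)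
        push_cast
        linarith
    _ = (lam : ℝ)⁻¹ := by
        rw [Real.exp_neg, Real.exp_nat_mul, Real.exp_log hpos, pow_succ]
        field_simp

lemma negligible_of_eventually_zero {f : ℕ → ℝ} (h : ∀ᶠ lam in Filter.atTop, f lam = 0) :
    Negligible f := by
  intro j
  refine (tendsto_const_nhds (x := (0 : ℝ))).congr' ?_
  filter_upwards [h] with lam hlam
  simp [hlam]

lemma advantage_le_one {m n : ℕ} (D : Distinguisher m n) (μ ν : Measure (Samples m n))
    [IsProbabilityMeasure μ] [IsProbabilityMeasure ν] : D.advantage μ ν ≤ 1 := by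
  unfold Distinguisher.advantage Distinguisher.acceptProb
  rw [abs_le]
  constructor <;>
  linarith [measureReal_nonneg (μ := μ.prod (Measure.pi fun _ : Fin D.coins => uniformTorus))
      (s := {p | D.output p.1 p.2 = 1}),
    measureReal_nonneg (μ := ν.prod (Measure.pi fun _ : Fin D.coins => uniformTorus))
      (s := {p | D.output p.1 p.2 = 1}),
    measureReal_le_one (μ := μ.prod (Measure.pi fun _ : Fin D.coins => uniformTorus))
      (s := {p | D.output p.1 p.2 = 1}),
    measureReal_le_one (μ := ν.prod (Measure.pi fun _ : Fin D.coins => uniformTorus))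
      (s := {p | D.output p.1 p.2 = 1})]

/-- The bound on the loss of the reduction. -/
def loss (q l : ℕ) (w₁ w₂ w₃ : ℝ) : ℝ :=
  (if 8 ≤ w₁ ∧ 0 ≤ w₂ ∧ 8 ≤ w₃ then 0 else 2) +
    (32 * Real.exp (-(1 * w₃)) + 65 * Real.exp (-(1 * w₁)) + Real.exp (-(1 / 4 * w₂)) +
      Real.log q / 2 ^ l)

lemma negligible_loss {q l : ℕ → ℕ} {w₁ w₂ w₃ : ℕ → ℝ} (h₁ : IsOmegaLog w₁) (h₂ : IsOmegaLog w₂)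
    (h₃ : IsOmegaLog w₃) (hq : Negligible fun lam => Real.log (q lam) / 2 ^ l lam) :
    Negligible fun lam => loss (q lam) (l lam) (w₁ lam) (w₂ lam) (w₃ lam) := by
  have hbad : Negligible fun lam => if 8 ≤ w₁ lam ∧ 0 ≤ w₂ lam ∧ 8 ≤ w₃ lam then (0 : ℝ) else 2 := by
    refine negligible_of_eventually_zero ?_
    filter_upwards [h₁.eventually_le 8, h₂.eventually_le 0, h₃.eventually_le 8] with lam a b c
    rw [if_pos ⟨a, b, c⟩]
  exact hbad.add (((((h₃.negligible one_pos).const_mul 32).add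
    ((h₁.negligible one_pos).const_mul 65)).add (h₂.negligible (by norm_num))).add hq)

/-- Strictness comes from the coefficient 65, against the 4 · 16 = 64 that is needed. -/
lemma errors_lt_loss {q l n m k : ℕ} {σ w₁ w₂ w₃ : ℝ} (hq : 0 < q) (hm : 0 < m) (hk : 0 < k)
    (hkn : k ≤ n) (hw : 8 ≤ w₁ ∧ 0 ≤ w₂ ∧ 8 ≤ w₃)
    (hσ : 2 * Real.sqrt (Real.log n + Real.log m + w₁) ≤ σ)
    (h : ((l : ℝ) + 1) * Real.logb 2 q + w₂ ≤ k * Real.logb 2 ((n : ℝ) / k)) :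
    2 * gaussError (Real.sqrt (Real.log m + Real.log n + w₃) ^ 2) (n * m) +
        4 * gaussError (σ ^ 2 / 4) ((n + 1) * m) + Real.sqrt ((q : ℝ) ^ (l + 1) / n.choose k) +
        Real.log q / 2 ^ l < loss q l w₁ w₂ w₃ := by
  have hn0 : 0 < n := hk.trans_le hkn
  have hn : (0 : ℝ) < n := by exact_mod_cast hn0
  have hn1 : (1 : ℝ) ≤ n := by exact_mod_cast hn0
  have hm' : (0 : ℝ) < m := by exact_mod_cast hm
  have hln : 0 ≤ Real.log n := Real.log_natCast_nonneg n
  have hlm : 0 ≤ Real.log m := Real.log_natCast_nonneg m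
  have e1 : gaussError (Real.sqrt (Real.log m + Real.log n + w₃) ^ 2) (n * m) ≤
      16 * Real.exp (-w₃) := by
    rw [Real.sq_sqrt (by linarith)]
    refine gaussError_le le_rfl hw.2.2 (by linarith) ?_
    rw [add_sub_cancel_right, Real.exp_add, Real.exp_log hm', Real.exp_log hn]
    push_cast
    nlinarith [mul_pos hn hm']
  have e2 : gaussError (σ ^ 2 / 4) ((n + 1) * m) ≤ 16 * Real.exp (-w₁) := by
    refine gaussError_le (L := Real.log n + Real.log m + w₁) ?_ hw.1 (by linarith) ?_
    · have h0 := Real.sqrt_nonneg (Real.log n + Real.log m + w₁)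
      have h1 := Real.sq_sqrt (show 0 ≤ Real.log n + Real.log m + w₁ by linarith [hw.1])
      nlinarith
    · rw [add_sub_cancel_right, Real.exp_add, Real.exp_log hm', Real.exp_log hn]
      push_cast
      nlinarith
  have e3 := sqrt_div_choose_le hq hk hkn hw.2.1 h
  have e4 := Real.exp_pos (-w₁)
  rw [loss, if_pos hw, one_mul, one_mul, one_div_mul_eq_div]
  linarith

end SparseCLWE

end

theorem corollary5p11 :
    ∃ C : ℝ, 0 < C ∧ ∃ P : MvPolynomial (Fin 5) ℕ,
      ∀ (q l n m k : ℕ → ℕ) (σ w₁ w₂ w₃ : ℕ → ℝ),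
        (∀ lam, 0 < q lam) → (∀ lam, 0 < m lam) →
        (∀ lam, 1 < k lam ∧ k lam < n lam) → (∀ lam, 0 < σ lam) →
        SparseCLWE.IsOmegaLog w₁ → SparseCLWE.IsOmegaLog w₂ → SparseCLWE.IsOmegaLog w₃ →
        SparseCLWE.Negligible (fun lam => Real.log (q lam) / 2 ^ l lam) →
        (∀ lam, 2 * Real.sqrt (Real.log (n lam) + Real.log (m lam) + w₁ lam) ≤ σ lam) →
        (∀ lam, ((l lam : ℝ) + 1) * Real.logb 2 (q lam) + w₂ lam
            ≤ (k lam : ℝ) * Real.logb 2 ((n lam : ℝ) / (k lam : ℝ))) →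
        ∃ ν : ℕ → ℝ, SparseCLWE.Negligible ν ∧
          ∀ (lam T : ℕ) (ε : ℝ), 0 < ε →
            ¬ SparseCLWE.Distinguishable
                (T + SparseCLWE.overhead P (n lam) (m lam) (q lam) (σ lam) lam) ε
                (SparseCLWE.standardLWE (q lam) (n lam) (l lam) (σ lam))
                (SparseCLWE.uniformSamples (q lam) (n lam) (l lam)) →
            ¬ SparseCLWE.Distinguishable T (2 * ε * (m lam : ℝ) + ν lam)
                (SparseCLWE.sparseCLWE (m lam) (n lam) (k lam)
                  (Real.sqrt (k lam) *
                    Real.sqrt (Real.log (m lam) + Real.log (n lam) + w₃ lam))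
                  (C * (σ lam * Real.sqrt (k lam) / (q lam : ℝ))))
                (SparseCLWE.nullCLWE (m lam) (n lam)) := by
  -- 3 is the square root of the total label noise 9k; the polynomial is `reductionCost` in the
  -- variables n, m and ⌈log₂ q⌉.
  refine ⟨3, by norm_num, .X 1 * (2 * .X 0 * (7 * .X 0 ^ 2 + 3 * .X 2 + 14) + 6), ?_⟩
  intro q l n m k σ w₁ w₂ w₃ hq hm hk hσ h₁ h₂ h₃ hneg hσw hkw
  refine ⟨_, SparseCLWE.negligible_loss h₁ h₂ h₃ hneg, ?_⟩
  rintro lam T ε hε hLWE ⟨D, hDT, hadv⟩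
  have : NeZero (q lam) := ⟨(hq lam).ne'⟩
  have hk1 := (hk lam).1
  have hkn := (hk lam).2.le
  have hmε : 0 ≤ 2 * ε * (m lam : ℝ) := by positivity
  -- When some `w` is still too small the loss exceeds 2, while no advantage exceeds 1.
  by_cases hw : 8 ≤ w₁ lam ∧ 0 ≤ w₂ lam ∧ 8 ≤ w₃ lam
  · have hcost : SparseCLWE.overhead (.X 1 * (2 * .X 0 * (7 * .X 0 ^ 2 + 3 * .X 2 + 14) + 6))
        (n lam) (m lam) (q lam) (σ lam) lam =
          SparseCLWE.reductionCost (n lam) (m lam) (q lam) := by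
      simp [SparseCLWE.overhead, SparseCLWE.reductionCost]
    rw [hcost] at hLWE
    have hr : 0 < Real.sqrt (Real.log (m lam) + Real.log (n lam) + w₃ lam) := by
      refine Real.sqrt_pos.mpr ?_
      linarith [Real.log_natCast_nonneg (n lam), Real.log_natCast_nonneg (m lam)]
    have h := SparseCLWE.advantage_le (hσ lam) hr hε.le hk1.le hkn
      (SparseCLWE.dim_le_sq (hq lam) (by omega) hkn hw.2.1 (hkw lam)) hLWE D hDT
    have h' := SparseCLWE.errors_lt_loss (hq lam) (hm lam) (by omega) hkn hw (hσw lam) (hkw lam)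
    linarith
  · have := SparseCLWE.isProbabilityMeasure_sparseCLWE (m := m lam) hkn
      (Real.sqrt (k lam) * Real.sqrt (Real.log (m lam) + Real.log (n lam) + w₃ lam))
      (3 * (σ lam * Real.sqrt (k lam) / (q lam : ℝ)))
    have h := hadv.trans (SparseCLWE.advantage_le_one D _ _)
    have hlog : 0 ≤ Real.log (q lam) / 2 ^ l lam :=
      div_nonneg (Real.log_natCast_nonneg _) (by positivity)
    simp only [SparseCLWE.loss, if_neg hw] at h
    have e1 := Real.exp_pos (-(1 * w₃ lam))
    have e2 := Real.exp_pos (-(1 * w₁ lam))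
    have e3 := Real.exp_pos (-(1 / 4 * w₂ lam))
    linarith
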